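/- Let $n\ge 2$ be an integer, let $a,g>0$, and let $s>\frac n2+1$ be real. For $\sigma\ge 0$ let $H^\sigma(\mathbb R^n)$ be the space of real-valued $f\in L^2(\mathbb R^n)$ with $\Lambda^\sigma f\in L^2(\mathbb R^n)$, normed by $\|f\|_{H^\sigma}=\|f\|_{L^2}+\|\Lambda^\sigma f\|_{L^2}$, where $\widehat{\Lambda^\sigma f}(\xi)=(2\pi|\xi|)^\sigma\hat f(\xi)$ and $\hat f(\xi)=\int_{\mathbb R^n} e^{-2\pi i x\cdot\xi}f(x)\,dx$ (extended to $L^2$). Let $$\mathcal R_af(x)=\mathrm{P.V.}\int_{\mathbb R^n}\mathcal K_a(x-y)f(y)\,dy,\qquad \mathcal K_a(x)=\frac{\Gamma(\frac{n+1}2)}{\pi^{\frac{n+1}2}}\Big(\frac{x}{|x|^{n+1}}-\frac{x}{(|x|^2+a^2)^{\frac{n+1}2}}\Big).$$ Then there is a function $T:[0,\infty)\to(0,\infty)$, depending only on $n,a,g,s$, such that for every $\rho_0\in H^s(\mathbb R^n)$, with $T=T(\|\rho_0\|_{H^s})$, the problem $$\partial_t\rho+g\,\mathcal R_a\rho\cdot\nabla\rho=0\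 \text{ on }\mathbb R^n\times(0,T),\qquad \rho(\cdot,0)=\rho_0,$$ has a unique solution $\rho$ in $C([0,T);H^s(\mathbb R^n))\cap \mathrm{Lip}((0,T);H^{s-1}(\mathbb R^n))$. Here $\rho(t)\in H^s(\mathbb R^n)$ is identified with its $C^1$ representative, the equation is understood pointwise, for all $x\in\mathbb R^n$ and $t\in(0,T)$, and $\mathrm{Lip}$ means globally Lipschitz on $(0,T)$. -/

import Mathlib

open MeasureTheory Set Filter Topology
open scoped FourierTransform ENNReal NNReal RealInnerProductSpace

noncomputable section

namespace KiselevSarsam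

/-- Euclidean space `ℝⁿ`. -/
abbrev Space (n : ℕ) : Type := EuclideanSpace ℝ (Fin n)

/-- The real space `L²(ℝⁿ)`. -/
abbrev L2 (n : ℕ) : Type := Lp ℝ 2 (volume : Measure (Space n))

/-- The complex space `L²(ℝⁿ; ℂ)`. -/
abbrev L2C (n : ℕ) : Type := Lp ℂ 2 (volume : Measure (Space n))

/-! ### Sobolev spaces -/

/-- The (Plancherel) Fourier transform of a real `L²` function, with the normalization
`∫ e^{-2πi x·ξ} f(x) dx`. -/
def fhat {n : ℕ} (f : L2 n) : L2C n :=
  𝓕 (Complex.ofRealCLM.compLpL 2 (volume : Measure (Space n)) f : L2C n)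

theorem fhat_add {n : ℕ} (f g : L2 n) : fhat (f + g) = fhat f + fhat g := by
  simp only [fhat, map_add, FourierTransform.fourier_add]

theorem fhat_smul {n : ℕ} (c : ℝ) (f : L2 n) : fhat (c • f) = (c : ℂ) • fhat f := by
  have h : (Complex.ofRealCLM.compLpL 2 (volume : Measure (Space n)) (c • f) : L2C n)
      = (c : ℂ) • (Complex.ofRealCLM.compLpL 2 (volume : Measure (Space n)) f : L2C n) := by
    rw [map_smul]; rfl
  rw [fhat, h, FourierTransform.fourier_smul]; rfl

/-- The function `ξ ↦ (2π|ξ|)^s f̂(ξ)`, the Fourier transform of `Λ^s f`. -/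
def fracSymbol {n : ℕ} (s : ℝ) (f : L2 n) (ξ : Space n) : ℂ :=
  (((2 * Real.pi * ‖ξ‖) ^ s : ℝ) : ℂ) * fhat f ξ

theorem fracSymbol_add {n : ℕ} (s : ℝ) (f g : L2 n) :
    fracSymbol s (f + g) =ᵐ[volume] fracSymbol s f + fracSymbol s g := by
  filter_upwards [Lp.coeFn_add (fhat f) (fhat g)] with ξ h
  simp only [fracSymbol, fhat_add, Pi.add_apply, h, mul_add]

theorem fracSymbol_smul {n : ℕ} (s c : ℝ) (f : L2 n) :
    fracSymbol s (c • f) =ᵐ[volume] c • fracSymbol s f := by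
  filter_upwards [Lp.coeFn_smul (c : ℂ) (fhat f)] with ξ h
  simp only [fracSymbol, fhat_smul, Pi.smul_apply, h, smul_eq_mul, Complex.real_smul]
  ring

theorem fracSymbol_zero {n : ℕ} (s : ℝ) : fracSymbol s (0 : L2 n) =ᵐ[volume] 0 := by
  have h := fracSymbol_smul s 0 (0 : L2 n)
  simpa using h

/-- The functions `f ∈ L²(ℝⁿ)` with `Λ^s f ∈ L²(ℝⁿ)` (meant for `s ≥ 0`). -/
def sobolevSubmodule (n : ℕ) (s : ℝ) : Submodule ℝ (L2 n) where
  carrier := {f | MemLp (fracSymbol s f) 2 volume}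
  add_mem' {f g} hf hg := (memLp_congr_ae (fracSymbol_add s f g)).2 (MemLp.add hf hg)
  zero_mem' := (memLp_congr_ae (fracSymbol_zero s)).2 MemLp.zero
  smul_mem' c f hf := (memLp_congr_ae (fracSymbol_smul s c f)).2 (MemLp.const_smul hf c)

theorem memLp_fracSymbol {n : ℕ} {s : ℝ} (f : sobolevSubmodule n s) :
    MemLp (fracSymbol s (f : L2 n)) 2 volume := f.2

/-- The nonhomogeneous real Sobolev space `H^s(ℝⁿ)`, `s ≥ 0`. This is a type of its own, because it
carries the `H^s` norm below and not the `L²` norm. -/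
def Hs (n : ℕ) (s : ℝ) : Type := sobolevSubmodule n s

instance (n : ℕ) (s : ℝ) : AddCommGroup (Hs n s) :=
  inferInstanceAs (AddCommGroup (sobolevSubmodule n s))

instance (n : ℕ) (s : ℝ) : Module ℝ (Hs n s) :=
  inferInstanceAs (Module ℝ (sobolevSubmodule n s))

/-- The inclusion of `H^s(ℝⁿ)` in `L²(ℝⁿ)`. -/
def Hs.toL2 {n : ℕ} {s : ℝ} : Hs n s →ₗ[ℝ] L2 n := (sobolevSubmodule n s).subtype

/-- The fractional Laplacian `Λ^s = (-Δ)^{s/2}`: the function `Λ^s f` is the one whose Fourier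
transform is `(2π|ξ|)^s f̂(ξ)`. -/
def fracLapAux (n : ℕ) (s : ℝ) : sobolevSubmodule n s →ₗ[ℝ] L2C n where
  toFun f := 𝓕⁻ (MemLp.toLp (fracSymbol s (f : L2 n)) (memLp_fracSymbol f) : L2C n)
  map_add' f g := by
    rw [← FourierTransform.fourierInv_add, ← MemLp.toLp_add]
    congr 1
    exact MemLp.toLp_congr _ _ (fracSymbol_add s f.1 g.1)
  map_smul' c f := by
    rw [RingHom.id_apply]
    have h : (MemLp.toLp (fracSymbol s ((c • f : sobolevSubmodule n s) : L2 n)) (memLp_fracSymbol (c • f)) : L2C n)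
        = (c : ℂ) • (MemLp.toLp (fracSymbol s (f : L2 n)) (memLp_fracSymbol f) : L2C n) := by
      have h1 : (c : ℂ) • (MemLp.toLp (fracSymbol s (f : L2 n)) (memLp_fracSymbol f) : L2C n)
          = c • (MemLp.toLp (fracSymbol s (f : L2 n)) (memLp_fracSymbol f) : L2C n) := rfl
      rw [h1, ← MemLp.toLp_const_smul]
      exact MemLp.toLp_congr _ _ (fracSymbol_smul s c f.1)
    rw [h, FourierTransform.fourierInv_smul]; rfl

/-- The fractional Laplacian `Λ^s : H^s(ℝⁿ) → L²(ℝⁿ)`. -/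
def fracLap {n : ℕ} {s : ℝ} : Hs n s →ₗ[ℝ] L2C n := fracLapAux n s

/-- The pair `(f, Λ^s f)`, in a product with the norm `‖f‖ + ‖Λ^s f‖`. -/
def Hs.graph {n : ℕ} {s : ℝ} : Hs n s →ₗ[ℝ] WithLp 1 (L2 n × L2C n) :=
  (WithLp.linearEquiv 1 ℝ (L2 n × L2C n)).symm.toLinearMap ∘ₗ (Hs.toL2.prod fracLap)

theorem Hs.graph_injective {n : ℕ} {s : ℝ} :
    Function.Injective (Hs.graph : Hs n s →ₗ[ℝ] WithLp 1 (L2 n × L2C n)) := by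
  intro f g h
  have h1 : Hs.toL2 f = Hs.toL2 g := congrArg (fun p => p.ofLp.1) h
  exact Subtype.ext h1

/-- The norm of `H^s(ℝⁿ)` is `‖f‖_{L²} + ‖Λ^s f‖_{L²}`; see `Hs.norm_def`. -/
instance (n : ℕ) (s : ℝ) : NormedAddCommGroup (Hs n s) :=
  NormedAddCommGroup.induced (Hs n s) (WithLp 1 (L2 n × L2C n)) Hs.graph Hs.graph_injective

theorem Hs.norm_def {n : ℕ} {s : ℝ} (f : Hs n s) : ‖f‖ = ‖Hs.toL2 f‖ + ‖fracLap f‖ := by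
  change ‖Hs.graph f‖ = _
  rw [WithLp.prod_norm_eq_of_L1]; rfl

/-! ### The transform `R_a` -/

/-- The kernel
`K_a(x) = Γ((n+1)/2) / π^((n+1)/2) * (x / |x|^(n+1) - x / (|x|² + a²)^((n+1)/2))`. -/
def kernel {n : ℕ} (a : ℝ) (x : Space n) : Space n :=
  (Real.Gamma (((n : ℝ) + 1) / 2) / Real.pi ^ (((n : ℝ) + 1) / 2)) •
    ((‖x‖ ^ (n + 1))⁻¹ • x - ((‖x‖ ^ 2 + a ^ 2) ^ (((n : ℝ) + 1) / 2))⁻¹ • x)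

/-- `v = R_a f (x) = P.V. ∫ K_a(x - y) f(y) dy`: each truncated integral converges absolutely, and
`v` is their limit as the truncation is removed. -/
def IsTransform {n : ℕ} (a : ℝ) (f : Space n → ℝ) (x v : Space n) : Prop :=
  (∀ ε > 0, IntegrableOn (fun y => f y • kernel a (x - y)) {y | ε < ‖x - y‖} volume) ∧
  Tendsto (fun ε : ℝ => ∫ y in {y | ε < ‖x - y‖}, f y • kernel a (x - y)) (𝓝[>] 0) (𝓝 v)

/-! ### Solutions -/

/-- The curve `ρ` solves `∂ₜρ + g R_aρ · ∇ρ = 0` on `ℝⁿ × (0,T)` in the classical sense. As usual,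
an element of `H^s`, `s > n/2 + 1`, is identified with its (unique) `C¹` representative; these are
the functions `r t`. The vector field `u t` is `R_a ρ(t)`. -/
def SolvesEquation {n : ℕ} {s : ℝ} (a g T : ℝ) (ρ : ℝ → Hs n s) : Prop :=
  ∃ (r : ℝ → Space n → ℝ) (u : ℝ → Space n → Space n),
    (∀ t ∈ Ico 0 T, ContDiff ℝ 1 (r t) ∧ (Hs.toL2 (ρ t) : Space n → ℝ) =ᵐ[volume] r t) ∧
    (∀ t ∈ Ioo 0 T, ∀ x, IsTransform a (r t) x (u t x)) ∧
    (∀ t ∈ Ioo 0 T, ∀ x, HasDerivAt (fun τ => r τ x) (-(g * ⟪u t x, gradient (r t) x⟫)) t)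

/-- `ρ ∈ Lip((0,T); H^σ)`: seen as a curve in `L²`, `ρ` takes values in `H^σ` on `(0,T)` and is
Lipschitz there for the norm of `H^σ`. -/
def MemLip {n : ℕ} {s : ℝ} (σ T : ℝ) (ρ : ℝ → Hs n s) : Prop :=
  ∃ q : ℝ → Hs n σ, (∀ t ∈ Ioo 0 T, Hs.toL2 (q t) = Hs.toL2 (ρ t)) ∧
    ∃ L : ℝ≥0, LipschitzOnWith L q (Ioo 0 T)

/-- `ρ` is a solution in `C([0,T); H^s) ∩ Lip((0,T); H^{s-1})` of the equation
`∂ₜρ + g R_aρ · ∇ρ = 0` with initial datum `ρ₀`. Only the values of `ρ` on `[0,T)` matter. -/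
structure IsSolution {n : ℕ} {s : ℝ} (a g T : ℝ) (ρ₀ : Hs n s) (ρ : ℝ → Hs n s) : Prop where
  continuousOn : ContinuousOn ρ (Ico 0 T)
  lipschitz : MemLip (s - 1) T ρ
  equation : SolvesEquation a g T ρ
  initial : ρ 0 = ρ₀

end KiselevSarsam

end

/-! Everything is moved to the Fourier side. The transform is the Fourier multiplier -i·`symb a`,
where `symb a` is real, odd and bounded: writing the kernel as a superposition of Gaussians gives a
bound that does not depend on a (`inner_symb`, `norm_symb_le`). With V(ξ) = (1+|ξ|)^s ρ̂(ξ) the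
equation becomes ((1+|ξ|)^(-1) V)' = -N(V,V), where N is bilinear with an explicit real symbol. It
is bounded on L² because s - 1 > n/2 makes (1+|ξ|)^(-(s-1)) square integrable
(`IsVel.isSymbol_baseSym`, `IsSymbol.exists_bilinear`).

This equation loses one derivative, and an energy estimate recovers it (`IsVel.energy_estimate`).
The commutator of the weight (1+|ξ|)^s with u·∇ gains a derivative in exchange for a factor |ξ-η|.
The remaining transport term is symmetrized in ξ and η; since the symbol is odd and ρ is real, the
derivative moves to the velocity (`IsVel.abs_re_tri_le`). All this is done with an extra weight
φ(1+|ξ|), where φ is nondecreasing and φ(r)/r is nonincreasing.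

For existence, truncation to |ξ| ≤ K turns the equation into an ordinary differential equation. Its
solutions stay real and are bounded, in every weighted norm, on a time interval that does not depend
on K (`IsVel.exists_galerkin`). For large K two of them are close in the L² norm of ρ
(`IsVel.galerkin_difference`). Closeness in H^s requires uniformly small high frequencies: the datum
admits an unbounded weight φ with φV₀ still square integrable (`exists_adapted_weight`), and the
weighted bound propagates this. Hence the approximations converge uniformly in time in H^s itself
(`IsVel.uniformCauchySeqOn_galerkin`), so that strong continuity in time needs no separate argument.

Uniqueness is an L² estimate for differences (`IsVel.difference_energy`, `IsVel.eqOn_of_solutions`).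
A given solution is only known to satisfy the equation pointwise. Evaluation at x is the pairing
with an L² function `evKer`, and these pairings separate points, so the pointwise equation implies
the one on the Fourier side (`IsSolution.hasDerivAt_lift`). Read backwards, the same pairing shows
that the constructed curve is a classical solution (`exists_isSolution`). -/

noncomputable section

namespace KiselevSarsam

/-! ### Young's inequality in trilinear form -/

section Young

variable {n : ℕ} {F : Type*} [NormedAddCommGroup F]

/-- The map `(ξ, η) ↦ (ξ - η, η)` preserves Lebesgue measure. -/
theorem measurePreserving_sub_snd :
    MeasurePreserving (fun p : Space n × Space n => (p.1 - p.2, p.2)) := by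
  exact measurePreserving_sub_prod (volume : Measure (Space n)) (volume : Measure (Space n))

theorem quasiMeasurePreserving_sub' :
    Measure.QuasiMeasurePreserving (fun p : Space n × Space n => p.1 - p.2) :=
  (Measure.quasiMeasurePreserving_fst (μ := (volume : Measure (Space n)))
    (ν := (volume : Measure (Space n)))).comp measurePreserving_sub_snd.quasiMeasurePreserving

/-- The map `(ζ, η) ↦ (ζ + η, η)` preserves Lebesgue measure. -/
theorem measurePreserving_add_snd :
    MeasurePreserving (fun p : Space n × Space n => (p.1 + p.2, p.2)) := by
  exact measurePreserving_add_prod (volume : Measure (Space n)) (volume : Measure (Space n))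

/-- The Cauchy–Schwarz inequality for the lower Lebesgue integral. -/
theorem lintegral_enorm_mul_le {α : Type*} [MeasurableSpace α] {μ : Measure α}
    {F G : Type*} [NormedAddCommGroup F] [NormedAddCommGroup G]
    {f : α → F} {g : α → G} (hf : AEStronglyMeasurable f μ) (hg : AEStronglyMeasurable g μ) :
    ∫⁻ x, ‖f x‖ₑ * ‖g x‖ₑ ∂μ ≤ eLpNorm f 2 μ * eLpNorm g 2 μ := by
  have h := ENNReal.lintegral_mul_le_Lp_mul_Lq μ Real.HolderConjugate.two_two hf.enorm hg.enorm
  rw [eLpNorm_eq_lintegral_rpow_enorm_toReal two_ne_zero ENNReal.ofNat_ne_top,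
    eLpNorm_eq_lintegral_rpow_enorm_toReal two_ne_zero ENNReal.ofNat_ne_top]
  simpa using h

variable {f g k : Space n → ℂ}

/-- The substitution ζ = ξ - η isolates the integrable factor; for fixed ζ, Cauchy–Schwarz bounds
the rest uniformly in the shift. -/
theorem lintegral_trilinear_le_fst (hf : AEStronglyMeasurable f volume)
    (hg : AEStronglyMeasurable g volume) (hk : AEStronglyMeasurable k volume) :
    ∫⁻ p : Space n × Space n, ‖f (p.1 - p.2)‖ₑ * ‖g p.2‖ₑ * ‖k p.1‖ₑ
      ≤ eLpNorm f 1 volume * eLpNorm g 2 volume * eLpNorm k 2 volume := by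
  have hadd : Measure.QuasiMeasurePreserving (fun p : Space n × Space n => p.1 + p.2) :=
    (Measure.quasiMeasurePreserving_fst (μ := (volume : Measure (Space n)))
      (ν := (volume : Measure (Space n)))).comp measurePreserving_add_snd.quasiMeasurePreserving
  have hm : AEMeasurable (fun p : Space n × Space n => ‖f p.1‖ₑ * (‖g p.2‖ₑ * ‖k (p.1 + p.2)‖ₑ))
      (volume.prod volume) :=
    (hf.comp_fst.enorm).mul ((hg.comp_snd.enorm).mul (hk.comp_quasiMeasurePreserving hadd).enorm)
  calc ∫⁻ p : Space n × Space n, ‖f (p.1 - p.2)‖ₑ * ‖g p.2‖ₑ * ‖k p.1‖ₑ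
      = ∫⁻ p : Space n × Space n, ‖f p.1‖ₑ * (‖g p.2‖ₑ * ‖k (p.1 + p.2)‖ₑ) := by
        rw [← Measure.volume_eq_prod, ← measurePreserving_sub_snd.map_eq] at hm
        conv_rhs => rw [← measurePreserving_sub_snd.map_eq]
        rw [lintegral_map' hm measurePreserving_sub_snd.aemeasurable]
        simp [mul_assoc]
    _ = ∫⁻ ζ, ∫⁻ η, ‖f ζ‖ₑ * (‖g η‖ₑ * ‖k (ζ + η)‖ₑ) := lintegral_prod _ hm
    _ ≤ ∫⁻ ζ, ‖f ζ‖ₑ * (eLpNorm g 2 volume * eLpNorm k 2 volume) := by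
        refine lintegral_mono fun ζ => ?_
        rw [lintegral_const_mul' _ _ enorm_ne_top]
        gcongr
        have hmp := measurePreserving_add_left (volume : Measure (Space n)) ζ
        refine (lintegral_enorm_mul_le hg (hk.comp_measurePreserving hmp)).trans_eq ?_
        rw [eLpNorm_comp_measurePreserving hk hmp]
    _ = _ := by
        rw [lintegral_mul_const'' _ hf.enorm, eLpNorm_one_eq_lintegral_enorm, mul_assoc]

/-- Here η is frozen instead: the integrable factor depends on η alone, and Cauchy–Schwarz in ξ is
translation invariant. -/
theorem lintegral_trilinear_le_snd (hf : AEStronglyMeasurable f volume)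
    (hg : AEStronglyMeasurable g volume) (hk : AEStronglyMeasurable k volume) :
    ∫⁻ p : Space n × Space n, ‖f (p.1 - p.2)‖ₑ * ‖g p.2‖ₑ * ‖k p.1‖ₑ
      ≤ eLpNorm f 2 volume * eLpNorm g 1 volume * eLpNorm k 2 volume := by
  have hm : AEMeasurable (fun p : Space n × Space n => ‖g p.2‖ₑ * (‖f (p.1 - p.2)‖ₑ * ‖k p.1‖ₑ))
      (volume.prod volume) :=
    (hg.comp_snd.enorm).mul
      ((hf.comp_quasiMeasurePreserving quasiMeasurePreserving_sub').enorm.mul hk.comp_fst.enorm)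
  calc ∫⁻ p : Space n × Space n, ‖f (p.1 - p.2)‖ₑ * ‖g p.2‖ₑ * ‖k p.1‖ₑ
      = ∫⁻ p : Space n × Space n, ‖g p.2‖ₑ * (‖f (p.1 - p.2)‖ₑ * ‖k p.1‖ₑ) := by
        congr 1; ext p; ring
    _ = ∫⁻ η, ∫⁻ ξ, ‖g η‖ₑ * (‖f (ξ - η)‖ₑ * ‖k ξ‖ₑ) := lintegral_prod_symm _ hm
    _ ≤ ∫⁻ η, ‖g η‖ₑ * (eLpNorm f 2 volume * eLpNorm k 2 volume) := by
        refine lintegral_mono fun η => ?_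
        rw [lintegral_const_mul' _ _ enorm_ne_top]
        gcongr
        have hmp := measurePreserving_sub_right (volume : Measure (Space n)) η
        refine (lintegral_enorm_mul_le (hf.comp_measurePreserving hmp) hk).trans_eq ?_
        rw [eLpNorm_comp_measurePreserving hf hmp]
    _ = _ := by
        rw [lintegral_mul_const'' _ hg.enorm, eLpNorm_one_eq_lintegral_enorm]; ring

theorem aestronglyMeasurable_trilinear (hf : AEStronglyMeasurable f volume)
    (hg : AEStronglyMeasurable g volume) (hk : AEStronglyMeasurable k volume) :
    AEStronglyMeasurable (fun p : Space n × Space n => ‖f (p.1 - p.2)‖ * ‖g p.2‖ * ‖k p.1‖)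
      volume :=
  (((hf.comp_quasiMeasurePreserving quasiMeasurePreserving_sub').norm.mul hg.comp_snd.norm).mul
    hk.comp_fst.norm)

theorem integrable_trilinear_of_lintegral_le {C : ℝ≥0∞} (hC : C ≠ ∞)
    (hf : AEStronglyMeasurable f volume)
    (hg : AEStronglyMeasurable g volume) (hk : AEStronglyMeasurable k volume)
    (h : ∫⁻ p : Space n × Space n, ‖f (p.1 - p.2)‖ₑ * ‖g p.2‖ₑ * ‖k p.1‖ₑ ≤ C) :
    Integrable (fun p : Space n × Space n => ‖f (p.1 - p.2)‖ * ‖g p.2‖ * ‖k p.1‖) ∧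
      ∫ p : Space n × Space n, ‖f (p.1 - p.2)‖ * ‖g p.2‖ * ‖k p.1‖ ≤ C.toReal := by
  have hm := aestronglyMeasurable_trilinear hf hg hk
  have he : ∀ p : Space n × Space n, ‖‖f (p.1 - p.2)‖ * ‖g p.2‖ * ‖k p.1‖‖ₑ
      = ‖f (p.1 - p.2)‖ₑ * ‖g p.2‖ₑ * ‖k p.1‖ₑ := fun p => by
    simp only [enorm_mul, enorm_norm]
  refine ⟨⟨hm, ?_⟩, ?_⟩
  · rw [hasFiniteIntegral_iff_enorm]
    simp only [he]
    exact h.trans_lt hC.lt_top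
  · rw [integral_eq_lintegral_of_nonneg_ae (Eventually.of_forall fun p => by positivity) hm]
    refine ENNReal.toReal_mono hC (le_trans (le_of_eq ?_) h)
    congr 1; ext p
    rw [← he, Real.enorm_of_nonneg (by positivity)]

theorem integrable_trilinear_fst (hf : MemLp f 1 volume) (hg : MemLp g 2 volume)
    (hk : MemLp k 2 volume) :
    Integrable (fun p : Space n × Space n => ‖f (p.1 - p.2)‖ * ‖g p.2‖ * ‖k p.1‖) ∧
      ∫ p : Space n × Space n, ‖f (p.1 - p.2)‖ * ‖g p.2‖ * ‖k p.1‖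
        ≤ lpNorm f 1 volume * lpNorm g 2 volume * lpNorm k 2 volume := by
  have h := integrable_trilinear_of_lintegral_le
    (ENNReal.mul_ne_top (ENNReal.mul_ne_top hf.2.ne hg.2.ne) hk.2.ne) hf.1 hg.1 hk.1
    (lintegral_trilinear_le_fst hf.1 hg.1 hk.1)
  rwa [ENNReal.toReal_mul, ENNReal.toReal_mul, toReal_eLpNorm hf.1, toReal_eLpNorm hg.1,
    toReal_eLpNorm hk.1] at h

theorem integrable_trilinear_snd (hf : MemLp f 2 volume) (hg : MemLp g 1 volume)
    (hk : MemLp k 2 volume) :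
    Integrable (fun p : Space n × Space n => ‖f (p.1 - p.2)‖ * ‖g p.2‖ * ‖k p.1‖) ∧
      ∫ p : Space n × Space n, ‖f (p.1 - p.2)‖ * ‖g p.2‖ * ‖k p.1‖
        ≤ lpNorm f 2 volume * lpNorm g 1 volume * lpNorm k 2 volume := by
  have h := integrable_trilinear_of_lintegral_le
    (ENNReal.mul_ne_top (ENNReal.mul_ne_top hf.2.ne hg.2.ne) hk.2.ne) hf.1 hg.1 hk.1
    (lintegral_trilinear_le_snd hf.1 hg.1 hk.1)
  rwa [ENNReal.toReal_mul, ENNReal.toReal_mul, toReal_eLpNorm hf.1, toReal_eLpNorm hg.1,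
    toReal_eLpNorm hk.1] at h

end Young

/-! ### Trilinear forms and bilinear operators with a symbol -/

section Trilinear

open scoped ComplexConjugate

variable {n : ℕ}

/-- The trilinear form `∫∫ b(ξ, η) f(ξ - η) g(η) \overline{k(ξ)} dη dξ`. -/
def tri (b : Space n → Space n → ℝ) (f g k : Space n → ℂ) : ℂ :=
  ∫ p : Space n × Space n, (b p.1 p.2 : ℂ) * (f (p.1 - p.2) * g p.2 * conj (k p.1))

variable {b : Space n → Space n → ℝ} {f g k f' g' k' f₁ f₂ g₁ g₂ : Space n → ℂ}

theorem triIntegrand_congr (hf : f =ᵐ[volume] f') (hg : g =ᵐ[volume] g') (hk : k =ᵐ[volume] k') :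
    (fun p : Space n × Space n => (b p.1 p.2 : ℂ) * (f (p.1 - p.2) * g p.2 * conj (k p.1)))
      =ᵐ[volume] fun p => (b p.1 p.2 : ℂ) * (f' (p.1 - p.2) * g' p.2 * conj (k' p.1)) := by
  have h1 := quasiMeasurePreserving_sub'.ae_eq_comp hf
  have h2 := (Measure.quasiMeasurePreserving_snd (μ := (volume : Measure (Space n)))
    (ν := (volume : Measure (Space n)))).ae_eq_comp hg
  have h3 := (Measure.quasiMeasurePreserving_fst (μ := (volume : Measure (Space n)))
    (ν := (volume : Measure (Space n)))).ae_eq_comp hk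
  filter_upwards [h1, h2, h3] with p e1 e2 e3
  simp only [Function.comp] at e1 e2 e3
  rw [e1, e2, e3]

theorem tri_congr (hf : f =ᵐ[volume] f') (hg : g =ᵐ[volume] g') (hk : k =ᵐ[volume] k') :
    tri b f g k = tri b f' g' k' :=
  integral_congr_ae (triIntegrand_congr hf hg hk)

theorem aestronglyMeasurable_triIntegrand (hb : Measurable (Function.uncurry b))
    (hf : AEStronglyMeasurable f volume) (hg : AEStronglyMeasurable g volume)
    (hk : AEStronglyMeasurable k volume) :
    AEStronglyMeasurable (fun p : Space n × Space n =>
      (b p.1 p.2 : ℂ) * (f (p.1 - p.2) * g p.2 * conj (k p.1))) volume := by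
  refine (Complex.measurable_ofReal.comp hb).aestronglyMeasurable.mul ?_
  exact ((hf.comp_quasiMeasurePreserving quasiMeasurePreserving_sub').mul hg.comp_snd).mul
    (Complex.continuous_conj.comp_aestronglyMeasurable hk.comp_fst)

/-- The trilinear form is controlled by Young's inequality once its integrand is dominated by
two products, each of an integrable and two square integrable factors. -/
theorem integrable_tri_of_le (hb : Measurable (Function.uncurry b))
    (hf : AEStronglyMeasurable f volume) (hg : AEStronglyMeasurable g volume)
    (hk : MemLp k 2 volume) (hf₁ : MemLp f₁ 1 volume) (hg₁ : MemLp g₁ 2 volume)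
    (hf₂ : MemLp f₂ 2 volume) (hg₂ : MemLp g₂ 1 volume)
    (h : ∀ ξ η, |b ξ η| * (‖f (ξ - η)‖ * ‖g η‖) ≤
      ‖f₁ (ξ - η)‖ * ‖g₁ η‖ + ‖f₂ (ξ - η)‖ * ‖g₂ η‖) :
    Integrable (fun p : Space n × Space n =>
      (b p.1 p.2 : ℂ) * (f (p.1 - p.2) * g p.2 * conj (k p.1))) ∧
    ‖tri b f g k‖ ≤ (lpNorm f₁ 1 volume * lpNorm g₁ 2 volume +
      lpNorm f₂ 2 volume * lpNorm g₂ 1 volume) * lpNorm k 2 volume := by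
  obtain ⟨i1, b1⟩ := integrable_trilinear_fst hf₁ hg₁ hk
  obtain ⟨i2, b2⟩ := integrable_trilinear_snd hf₂ hg₂ hk
  have hle : ∀ p : Space n × Space n,
      ‖(b p.1 p.2 : ℂ) * (f (p.1 - p.2) * g p.2 * conj (k p.1))‖
        ≤ ‖f₁ (p.1 - p.2)‖ * ‖g₁ p.2‖ * ‖k p.1‖ + ‖f₂ (p.1 - p.2)‖ * ‖g₂ p.2‖ * ‖k p.1‖ := by
    intro p
    have := mul_le_mul_of_nonneg_right (h p.1 p.2) (norm_nonneg (k p.1))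
    simp only [norm_mul, Complex.norm_real, Real.norm_eq_abs, RCLike.norm_conj]
    linarith
  refine ⟨(i1.add i2).mono' (aestronglyMeasurable_triIntegrand hb hf hg hk.1)
    (Eventually.of_forall hle), ?_⟩
  refine (norm_integral_le_of_norm_le (i1.add i2) (Eventually.of_forall hle)).trans ?_
  rw [integral_add' i1 i2]
  linarith

/-- The symbol `b` is dominated by `C (h(ξ - η) + h(η))` with `h` square integrable. -/
structure IsSymbol (b : Space n → Space n → ℝ) (h : Space n → ℝ) (C : ℝ) : Prop where
  measurable : Measurable (Function.uncurry b)
  nonneg : ∀ ξ, 0 ≤ h ξ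
  memLp : MemLp h 2 volume
  const_nonneg : 0 ≤ C
  le : ∀ ξ η, |b ξ η| ≤ C * (h (ξ - η) + h η)

/-- Cauchy–Schwarz. With h a negative power of 1+|ξ| this is the Sobolev embedding on the Fourier
side: a weighted L² norm controls the L¹ norm of the transform. -/
theorem memLp_mul_one {h : Space n → ℝ} (hh : MemLp h 2 volume) (hf : MemLp f 2 volume) :
    MemLp (fun ξ => (h ξ : ℂ) * f ξ) 1 volume ∧
      lpNorm (fun ξ => (h ξ : ℂ) * f ξ) 1 volume ≤ lpNorm h 2 volume * lpNorm f 2 volume := by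
  have hm : AEStronglyMeasurable (fun ξ => (h ξ : ℂ) * f ξ) volume :=
    (Complex.continuous_ofReal.comp_aestronglyMeasurable hh.1).mul hf.1
  have hle : eLpNorm (fun ξ => (h ξ : ℂ) * f ξ) 1 volume ≤
      eLpNorm h 2 volume * eLpNorm f 2 volume := by
    rw [eLpNorm_one_eq_lintegral_enorm]
    refine le_trans (le_of_eq ?_) (lintegral_enorm_mul_le hh.1 hf.1)
    congr 1; ext ξ
    rw [enorm_mul]; congr 1
    simp [enorm_eq_nnnorm]
  refine ⟨⟨hm, hle.trans_lt (ENNReal.mul_lt_top hh.2 hf.2)⟩, ?_⟩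
  rw [← toReal_eLpNorm hm, ← toReal_eLpNorm hh.1, ← toReal_eLpNorm hf.1, ← ENNReal.toReal_mul]
  exact ENNReal.toReal_mono (ENNReal.mul_lt_top hh.2 hf.2).ne hle

/-- Of the two terms that dominate the symbol, h(ξ-η) turns f from square integrable into
integrable, and h(η) does the same for g. Each term is then an instance of Young's inequality. -/
theorem IsSymbol.integrable_tri {h : Space n → ℝ} {C : ℝ} (hb : IsSymbol b h C)
    (hf : MemLp f 2 volume) (hg : MemLp g 2 volume) (hk : MemLp k 2 volume) :
    Integrable (fun p : Space n × Space n =>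
      (b p.1 p.2 : ℂ) * (f (p.1 - p.2) * g p.2 * conj (k p.1))) ∧
    ‖tri b f g k‖ ≤ 2 * C * lpNorm h 2 volume *
      (lpNorm f 2 volume * lpNorm g 2 volume * lpNorm k 2 volume) := by
  obtain ⟨m1, n1⟩ := memLp_mul_one (hb.memLp.const_mul C) hf
  obtain ⟨m2, n2⟩ := memLp_mul_one (hb.memLp.const_mul C) hg
  have hC : lpNorm (fun ξ => C * h ξ) 2 volume = C * lpNorm h 2 volume := by
    have := lpNorm_const_smul (p := 2) C h (volume : Measure (Space n))
    rw [coe_nnnorm, Real.norm_of_nonneg hb.const_nonneg] at this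
    exact this
  rw [hC] at n1 n2
  obtain ⟨i, e⟩ := integrable_tri_of_le (b := b) hb.measurable hf.1 hg.1 hk m1 hg hf m2
    (fun ξ η => by
      have := mul_le_mul_of_nonneg_right (hb.le ξ η)
        (by positivity : 0 ≤ ‖f (ξ - η)‖ * ‖g η‖)
      have h1 := hb.nonneg (ξ - η)
      have h2 := hb.nonneg η
      have h3 := hb.const_nonneg
      simp only [norm_mul, Complex.norm_real, Real.norm_eq_abs]
      rw [abs_of_nonneg h1, abs_of_nonneg h2, abs_of_nonneg h3]
      linarith)
  refine ⟨i, e.trans ?_⟩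
  have p1 := lpNorm_nonneg (f := f) (p := 2) (μ := volume)
  have p2 := lpNorm_nonneg (f := g) (p := 2) (μ := volume)
  have p3 := lpNorm_nonneg (f := k) (p := 2) (μ := volume)
  calc _ ≤ (C * lpNorm h 2 volume * lpNorm f 2 volume * lpNorm g 2 volume +
        lpNorm f 2 volume * (C * lpNorm h 2 volume * lpNorm g 2 volume)) * lpNorm k 2 volume := by
        gcongr
    _ = _ := by ring

theorem lpNorm_coeFn (V : L2C n) : lpNorm V 2 volume = ‖V‖ := by
  rw [← toReal_eLpNorm (Lp.aestronglyMeasurable V), Lp.norm_def]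

theorem tri_add_left (h1 : Integrable (fun p : Space n × Space n =>
      (b p.1 p.2 : ℂ) * (f (p.1 - p.2) * g p.2 * conj (k p.1))))
    (h2 : Integrable (fun p : Space n × Space n =>
      (b p.1 p.2 : ℂ) * (f' (p.1 - p.2) * g p.2 * conj (k p.1)))) :
    tri b (f + f') g k = tri b f g k + tri b f' g k := by
  rw [tri, tri, tri, ← integral_add h1 h2]
  congr 1; ext p; simp only [Pi.add_apply]; ring

theorem tri_add_mid (h1 : Integrable (fun p : Space n × Space n =>
      (b p.1 p.2 : ℂ) * (f (p.1 - p.2) * g p.2 * conj (k p.1))))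
    (h2 : Integrable (fun p : Space n × Space n =>
      (b p.1 p.2 : ℂ) * (f (p.1 - p.2) * g' p.2 * conj (k p.1)))) :
    tri b f (g + g') k = tri b f g k + tri b f g' k := by
  rw [tri, tri, tri, ← integral_add h1 h2]
  congr 1; ext p; simp only [Pi.add_apply]; ring

theorem tri_add_right (h1 : Integrable (fun p : Space n × Space n =>
      (b p.1 p.2 : ℂ) * (f (p.1 - p.2) * g p.2 * conj (k p.1))))
    (h2 : Integrable (fun p : Space n × Space n =>
      (b p.1 p.2 : ℂ) * (f (p.1 - p.2) * g p.2 * conj (k' p.1)))) :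
    tri b f g (k + k') = tri b f g k + tri b f g k' := by
  rw [tri, tri, tri, ← integral_add h1 h2]
  congr 1; ext p; simp only [Pi.add_apply, map_add]; ring

theorem tri_smul_left (c : ℂ) : tri b (c • f) g k = c * tri b f g k := by
  rw [tri, tri, ← integral_const_mul]
  congr 1; ext p; simp only [Pi.smul_apply, smul_eq_mul]; ring

theorem tri_smul_mid (c : ℂ) : tri b f (c • g) k = c * tri b f g k := by
  rw [tri, tri, ← integral_const_mul]
  congr 1; ext p; simp only [Pi.smul_apply, smul_eq_mul]; ring

theorem tri_smul_right (c : ℂ) : tri b f g (c • k) = conj c * tri b f g k := by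
  rw [tri, tri, ← integral_const_mul]
  congr 1; ext p; simp only [Pi.smul_apply, smul_eq_mul, map_mul]; ring

/-- A symbol defines a bounded bilinear operator on `L²`. -/
theorem IsSymbol.exists_bilinear {h : Space n → ℝ} {C : ℝ} (hb : IsSymbol b h C) :
    ∃ N : L2C n →L[ℝ] L2C n →L[ℝ] L2C n, ∀ V W k : L2C n, inner ℂ k (N V W) = tri b V W k := by
  have hint : ∀ V W k : L2C n, Integrable (fun p : Space n × Space n =>
      (b p.1 p.2 : ℂ) * (V (p.1 - p.2) * W p.2 * conj (k p.1))) := fun V W k =>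
    (hb.integrable_tri (Lp.memLp V) (Lp.memLp W) (Lp.memLp k)).1
  have hbd : ∀ V W k : L2C n, ‖tri b V W k‖ ≤
      2 * C * lpNorm h 2 volume * (‖V‖ * ‖W‖ * ‖k‖) := fun V W k => by
    have := (hb.integrable_tri (Lp.memLp V) (Lp.memLp W) (Lp.memLp k)).2
    simpa only [lpNorm_coeFn] using this
  have hex : ∀ V W : L2C n, ∃ U : L2C n, ∀ k : L2C n, inner ℂ k U = tri b V W k := by
    intro V W
    -- The form is conjugate linear in k, so its conjugate is a bounded functional, which the Riesz
    -- theorem represents.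
    let φ : L2C n →ₗ[ℂ] ℂ :=
      { toFun := fun k => conj (tri b V W k)
        map_add' := fun k k' => by
          rw [tri_congr (ae_eq_refl _) (ae_eq_refl _) (Lp.coeFn_add k k'),
            tri_add_right (hint V W k) (hint V W k'), map_add]
        map_smul' := fun c k => by
          rw [tri_congr (ae_eq_refl _) (ae_eq_refl _) (Lp.coeFn_smul c k), tri_smul_right]
          simp }
    let Φ : L2C n →L[ℂ] ℂ := φ.mkContinuous (2 * C * lpNorm h 2 volume * (‖V‖ * ‖W‖))
      (fun k => by
        have := hbd V W k
        simp only [φ, LinearMap.coe_mk, AddHom.coe_mk, RCLike.norm_conj]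
        linarith)
    refine ⟨(InnerProductSpace.toDual ℂ (L2C n)).symm Φ, fun k => ?_⟩
    rw [← inner_conj_symm, InnerProductSpace.toDual_symm_apply]
    simp [Φ, φ]
  choose U hU using hex
  let N : L2C n →ₗ[ℝ] L2C n →ₗ[ℝ] L2C n := LinearMap.mk₂ ℝ U
    (fun V V' W => ext_inner_left ℂ fun k => by
      rw [inner_add_right, hU, hU, hU,
        tri_congr (Lp.coeFn_add V V') (ae_eq_refl _) (ae_eq_refl _),
        tri_add_left (hint V W k) (hint V' W k)])
    (fun c V W => ext_inner_left ℂ fun k => by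
      have e : (⇑(c • V) : Space n → ℂ) =ᵐ[volume] (c : ℂ) • ⇑V := Lp.coeFn_smul c V
      rw [inner_smul_right_eq_smul, hU, hU, tri_congr e (ae_eq_refl _) (ae_eq_refl _),
        tri_smul_left, Complex.real_smul])
    (fun V W W' => ext_inner_left ℂ fun k => by
      rw [inner_add_right, hU, hU, hU,
        tri_congr (ae_eq_refl _) (Lp.coeFn_add W W') (ae_eq_refl _),
        tri_add_mid (hint V W k) (hint V W' k)])
    (fun c V W => ext_inner_left ℂ fun k => by
      have e : (⇑(c • W) : Space n → ℂ) =ᵐ[volume] (c : ℂ) • ⇑W := Lp.coeFn_smul c W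
      rw [inner_smul_right_eq_smul, hU, hU, tri_congr (ae_eq_refl _) e (ae_eq_refl _),
        tri_smul_mid, Complex.real_smul])
  refine ⟨N.mkContinuous₂ (2 * C * lpNorm h 2 volume) fun V W => ?_, fun V W k => ?_⟩
  · change ‖U V W‖ ≤ _
    by_cases h0 : ‖U V W‖ = 0
    · rw [h0]
      have := hb.const_nonneg
      have := lpNorm_nonneg (f := h) (p := 2) (μ := volume)
      positivity
    -- The operator bound follows by testing with k = U V W itself.
    · have h1 := hbd V W (U V W)
      rw [← hU, inner_self_eq_norm_sq_to_K] at h1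
      have h2 : ‖((‖U V W‖ : ℂ)) ^ 2‖ = ‖U V W‖ * ‖U V W‖ := by
        rw [norm_pow, Complex.norm_real, norm_norm, sq]
      have h1' : ‖U V W‖ * ‖U V W‖ ≤
        2 * C * lpNorm h 2 volume * (‖V‖ * ‖W‖ * ‖U V W‖) := by rw [← h2]; exact h1
      have h3 : 0 < ‖U V W‖ := lt_of_le_of_ne (norm_nonneg _) (Ne.symm h0)
      refine le_of_mul_le_mul_right ?_ h3
      linarith
  · exact hU V W k

end Trilinear

/-! ### Multiplication operators and the conjugate reflection on `L²` -/

section Operators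

open scoped ComplexConjugate

variable {n : ℕ}

/-- Bounded measurable real functions. -/
def IsMult (m : Space n → ℝ) : Prop := Measurable m ∧ ∃ C, ∀ ξ, |m ξ| ≤ C

theorem memLp_mult {m : Space n → ℝ} {C : ℝ} (hm : Measurable m) (hC : ∀ ξ, |m ξ| ≤ C)
    {f : Space n → ℂ} (hf : MemLp f 2 volume) : MemLp (fun ξ => (m ξ : ℂ) * f ξ) 2 volume := by
  refine MemLp.of_le_mul (c := C) hf
    ((Complex.measurable_ofReal.comp hm).aestronglyMeasurable.mul hf.1)
    (Eventually.of_forall fun ξ => ?_)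
  rw [norm_mul, Complex.norm_real, Real.norm_eq_abs]
  exact mul_le_mul_of_nonneg_right (hC ξ) (norm_nonneg _)

theorem IsMult.memLp {m : Space n → ℝ} (hm : IsMult m)
    {f : Space n → ℂ} (hf : MemLp f 2 volume) : MemLp (fun ξ => (m ξ : ℂ) * f ξ) 2 volume :=
  memLp_mult hm.1 hm.2.choose_spec hf

theorem IsMult.mul {m m' : Space n → ℝ} (hm : IsMult m) (hm' : IsMult m') :
    IsMult (fun ξ => m ξ * m' ξ) := by
  obtain ⟨h1, C, hC⟩ := hm
  obtain ⟨h2, C', hC'⟩ := hm'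
  refine ⟨h1.mul h2, C * C', fun ξ => ?_⟩
  rw [abs_mul]
  exact mul_le_mul (hC ξ) (hC' ξ) (abs_nonneg _) ((abs_nonneg _).trans (hC ξ))

/-- Multiplication by a bounded measurable real function, as an operator on `L²`. -/
def mulLp (m : Space n → ℝ) (hm : IsMult m) : L2C n →L[ℝ] L2C n :=
  LinearMap.mkContinuous
    { toFun := fun V => (hm.memLp (Lp.memLp V)).toLp
      map_add' := fun V W => by
        rw [← MemLp.toLp_add]
        refine MemLp.toLp_congr _ _ ?_
        filter_upwards [Lp.coeFn_add V W] with ξ h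
        simp only [h, Pi.add_apply, mul_add]
      map_smul' := fun c V => by
        rw [RingHom.id_apply, ← MemLp.toLp_const_smul]
        refine MemLp.toLp_congr _ _ ?_
        filter_upwards [Lp.coeFn_smul c V] with ξ h
        simp only [h, Pi.smul_apply, Complex.real_smul]
        ring }
    (hm.2.choose) (fun V => by
      refine Lp.norm_le_mul_norm_of_ae_le_mul ?_
      filter_upwards [MemLp.coeFn_toLp (hm.memLp (Lp.memLp V))] with ξ h
      simp only [LinearMap.coe_mk, AddHom.coe_mk]
      rw [h, norm_mul, Complex.norm_real, Real.norm_eq_abs]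
      exact mul_le_mul_of_nonneg_right (hm.2.choose_spec ξ) (norm_nonneg _))

variable {m m' : Space n → ℝ}

theorem coeFn_mulLp (hm : IsMult m) (V : L2C n) :
    mulLp m hm V =ᵐ[volume] fun ξ => (m ξ : ℂ) * V ξ :=
  MemLp.coeFn_toLp (hm.memLp (Lp.memLp V))

theorem norm_mulLp_eq (hm : IsMult m) (V : L2C n) :
    ‖mulLp m hm V‖ = lpNorm (fun ξ => (m ξ : ℂ) * V ξ) 2 volume := by
  rw [← toReal_eLpNorm (hm.memLp (Lp.memLp V)).1, Lp.norm_def,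
    eLpNorm_congr_ae (coeFn_mulLp hm V)]

theorem norm_mulLp_le_norm_mulLp (hm : IsMult m) (hm' : IsMult m') {C : ℝ} {V W : L2C n}
    (h : ∀ᵐ ξ, |m ξ| * ‖V ξ‖ ≤ C * (|m' ξ| * ‖W ξ‖)) :
    ‖mulLp m hm V‖ ≤ C * ‖mulLp m' hm' W‖ := by
  refine Lp.norm_le_mul_norm_of_ae_le_mul ?_
  filter_upwards [coeFn_mulLp hm V, coeFn_mulLp hm' W, h] with ξ h1 h2 h3
  rw [h1, h2]
  simpa [norm_mul] using h3

theorem norm_mulLp_le (hm : IsMult m) {C : ℝ} (hC : ∀ ξ, |m ξ| ≤ C) (V : L2C n) :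
    ‖mulLp m hm V‖ ≤ C * ‖V‖ := by
  refine Lp.norm_le_mul_norm_of_ae_le_mul ?_
  filter_upwards [coeFn_mulLp hm V] with ξ h1
  rw [h1, norm_mul, Complex.norm_real, Real.norm_eq_abs]
  exact mul_le_mul_of_nonneg_right (hC ξ) (norm_nonneg _)

theorem mulLp_mulLp (hm : IsMult m) (hm' : IsMult m') (V : L2C n) :
    mulLp m hm (mulLp m' hm' V) = mulLp (fun ξ => m ξ * m' ξ) (hm.mul hm') V := by
  refine Lp.ext ?_
  filter_upwards [coeFn_mulLp hm (mulLp m' hm' V), coeFn_mulLp hm' V,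
    coeFn_mulLp (hm.mul hm') V] with ξ h1 h2 h3
  rw [h1, h2, h3]; push_cast; ring

theorem mulLp_congr (hm : IsMult m) (hm' : IsMult m') {V W : L2C n}
    (h : ∀ᵐ ξ, (m ξ : ℂ) * V ξ = m' ξ * W ξ) : mulLp m hm V = mulLp m' hm' W := by
  refine Lp.ext ?_
  filter_upwards [coeFn_mulLp hm V, coeFn_mulLp hm' W, h] with ξ h1 h2 h3
  rw [h1, h2, h3]

theorem inner_mulLp (hm : IsMult m) (k V : L2C n) :
    inner ℂ k (mulLp m hm V) = inner ℂ (mulLp m hm k) V := by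
  rw [L2.inner_def, L2.inner_def]
  refine integral_congr_ae ?_
  filter_upwards [coeFn_mulLp hm V, coeFn_mulLp hm k] with ξ h1 h2
  rw [h1, h2]
  simp only [RCLike.inner_apply, map_mul, Complex.conj_ofReal]
  ring

theorem tri_mulLp {b : Space n → Space n → ℝ} (hm : IsMult m) (V W k : L2C n) :
    tri b V W (mulLp m hm k) = tri (fun ξ η => m ξ * b ξ η) V W k := by
  rw [tri_congr (ae_eq_refl _) (ae_eq_refl _) (coeFn_mulLp hm k), tri, tri]
  congr 1; ext p
  simp only [map_mul, Complex.conj_ofReal]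
  push_cast; ring

/-- A function is Hermitian when `f(-ξ)` is the conjugate of `f(ξ)`. -/
def IsHerm (f : Space n → ℂ) : Prop := ∀ᵐ ξ, f (-ξ) = conj (f ξ)

theorem IsHerm.mul_real {f : Space n → ℂ} (hf : IsHerm f) (hm : ∀ ξ, m (-ξ) = m ξ) :
    IsHerm (fun ξ => (m ξ : ℂ) * f ξ) := by
  filter_upwards [hf] with ξ h
  rw [h, hm, map_mul, Complex.conj_ofReal]

theorem measurePreserving_neg_space : MeasurePreserving (fun ξ : Space n => -ξ) :=
  Measure.measurePreserving_neg (volume : Measure (Space n))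

theorem memLp_conjRefl {f : Space n → ℂ} (hf : MemLp f 2 volume) :
    MemLp (fun ξ => conj (f (-ξ))) 2 volume :=
  (hf.comp_measurePreserving measurePreserving_neg_space).star

theorem ae_neg {P : Space n → Prop} (h : ∀ᵐ ξ, P ξ) : ∀ᵐ ξ, P (-ξ) :=
  measurePreserving_neg_space.quasiMeasurePreserving.ae h

/-- The conjugate reflection `f ↦ \overline{f(-·)}` on `L²`. -/
def conjRefl : L2C n →L[ℝ] L2C n :=
  LinearMap.mkContinuous
    { toFun := fun V => (memLp_conjRefl (Lp.memLp V)).toLp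
      map_add' := fun V W => by
        rw [← MemLp.toLp_add]
        refine MemLp.toLp_congr _ _ ?_
        filter_upwards [ae_neg (Lp.coeFn_add V W)] with ξ h
        simp only [h, Pi.add_apply, map_add]
      map_smul' := fun c V => by
        rw [RingHom.id_apply, ← MemLp.toLp_const_smul]
        refine MemLp.toLp_congr _ _ ?_
        filter_upwards [ae_neg (Lp.coeFn_smul c V)] with ξ h
        simp only [h, Pi.smul_apply, Complex.real_smul, map_mul, Complex.conj_ofReal] }
    1 (fun V => by
      rw [one_mul]
      simp only [LinearMap.coe_mk, AddHom.coe_mk]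
      rw [Lp.norm_toLp, Lp.norm_def]
      refine ENNReal.toReal_mono (Lp.memLp V).2.ne (le_of_eq ?_)
      refine Eq.trans ?_ (eLpNorm_comp_measurePreserving (Lp.memLp V).1
        measurePreserving_neg_space)
      refine eLpNorm_congr_norm_ae (Eventually.of_forall fun ξ => ?_)
      simp)

theorem coeFn_conjRefl (V : L2C n) : conjRefl V =ᵐ[volume] fun ξ => conj (V (-ξ)) :=
  MemLp.coeFn_toLp (memLp_conjRefl (Lp.memLp V))

theorem norm_conjRefl (V : L2C n) : ‖conjRefl V‖ = ‖V‖ := by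
  rw [Lp.norm_def, Lp.norm_def, eLpNorm_congr_ae (coeFn_conjRefl V)]
  congr 1
  refine Eq.trans ?_ (eLpNorm_comp_measurePreserving (Lp.memLp V).1
    measurePreserving_neg_space)
  refine eLpNorm_congr_norm_ae (Eventually.of_forall fun ξ => ?_)
  simp

/-- Hermitian symmetry is the Fourier form of being real valued. As the fixed point set of a
continuous operator it is visibly closed under limits and can be propagated by ODE uniqueness. -/
theorem conjRefl_eq_iff (V : L2C n) : conjRefl V = V ↔ IsHerm V := by
  constructor
  · intro h
    filter_upwards [coeFn_conjRefl V] with ξ h1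
    rw [h] at h1
    rw [h1, Complex.conj_conj]
  · intro h
    refine Lp.ext ?_
    filter_upwards [coeFn_conjRefl V, h] with ξ h1 h2
    rw [h1, h2, Complex.conj_conj]

theorem conjRefl_mulLp (hm : IsMult m) (hs : ∀ ξ, m (-ξ) = m ξ) (V : L2C n) :
    conjRefl (mulLp m hm V) = mulLp m hm (conjRefl V) := by
  refine Lp.ext ?_
  filter_upwards [coeFn_conjRefl (mulLp m hm V), ae_neg (coeFn_mulLp hm V),
    coeFn_mulLp hm (conjRefl V), coeFn_conjRefl V] with ξ h1 h2 h3 h4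
  rw [h1, h2, h3, h4, hs, map_mul, Complex.conj_ofReal]

theorem inner_conjRefl (k U : L2C n) : inner ℂ k (conjRefl U) = conj (inner ℂ (conjRefl k) U) := by
  rw [L2.inner_def, L2.inner_def, ← integral_conj,
    ← integral_neg_eq_self (fun a => conj (inner ℂ (conjRefl k a) (U a)))]
  refine integral_congr_ae ?_
  filter_upwards [coeFn_conjRefl U, ae_neg (coeFn_conjRefl k)] with ξ h1 h2
  rw [h1, h2]
  simp [mul_comm]

theorem conj_tri_conjRefl {b : Space n → Space n → ℝ} (hb : ∀ ξ η, b (-ξ) (-η) = b ξ η)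
    (V W k : L2C n) : conj (tri b V W (conjRefl k)) = tri b (conjRefl V) (conjRefl W) k := by
  have : (volume : Measure (Space n × Space n)).IsNegInvariant :=
    ⟨(measurePreserving_neg_space.prod measurePreserving_neg_space).map_eq⟩
  rw [tri_congr (coeFn_conjRefl V) (coeFn_conjRefl W) (ae_eq_refl _),
    tri_congr (ae_eq_refl _) (ae_eq_refl _) (coeFn_conjRefl k), tri, tri, ← integral_conj,
    ← integral_neg_eq_self]
  congr 1; ext p
  simp only [Prod.fst_neg, Prod.snd_neg, hb, map_mul, Complex.conj_ofReal, Complex.conj_conj,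
    neg_neg, neg_sub_neg, neg_sub]

/-- An operator with a real, even symbol sends transforms of real functions to transforms of real
functions. -/
theorem conjRefl_bilinear {b : Space n → Space n → ℝ} (hb : ∀ ξ η, b (-ξ) (-η) = b ξ η)
    {N : L2C n →L[ℝ] L2C n →L[ℝ] L2C n} (hN : ∀ V W k : L2C n, inner ℂ k (N V W) = tri b V W k)
    (V W : L2C n) : conjRefl (N V W) = N (conjRefl V) (conjRefl W) := by
  refine ext_inner_left ℂ fun k => ?_
  rw [inner_conjRefl, hN, hN, conj_tri_conjRefl hb]

end Operators

/-! ### Weights -/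

section Weights

/-- Weights on `[1, ∞)` that grow, but not faster than linearly. -/
structure IsWeight (φ : ℝ → ℝ) : Prop where
  nonneg : ∀ r, 1 ≤ r → 0 ≤ φ r
  mono : ∀ q r, 1 ≤ q → q ≤ r → φ q ≤ φ r
  slow : ∀ q r, 1 ≤ q → q ≤ r → φ r * q ≤ φ q * r

theorem isWeight_one : IsWeight (fun _ => 1) :=
  ⟨fun _ _ => zero_le_one, fun _ _ _ _ => le_rfl, fun q r _ h => by linarith⟩

variable {φ : ℝ → ℝ} {s : ℝ}

/-- Bernoulli's inequality for (q/r)^s, multiplied by r^s. -/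
theorem rpow_sub_rpow_le (hs : 1 ≤ s) {q r : ℝ} (hq : 1 ≤ q) (hqr : q ≤ r) :
    r ^ s - q ^ s ≤ s * (r - q) * r ^ (s - 1) := by
  have hr : 0 < r := by linarith
  have h := one_add_mul_self_le_rpow_one_add (s := q / r - 1)
    (by have : 0 ≤ q / r := by positivity
        linarith) hs
  rw [add_sub_cancel, Real.div_rpow (by linarith) hr.le, le_div_iff₀ (by positivity)] at h
  have h2 : r ^ s = r * r ^ (s - 1) := by
    rw [Real.rpow_sub_one hr.ne']; field_simp
  have h3 : s * (q / r - 1) * r ^ s = s * (q - r) * r ^ (s - 1) := by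
    rw [h2]; field_simp
  linarith

theorem IsWeight.mul_rpow_mono (hφ : IsWeight φ) (hs : 1 ≤ s) {q r : ℝ} (hq : 1 ≤ q)
    (hqr : q ≤ r) : φ q * q ^ (s - 1) ≤ φ r * r ^ (s - 1) :=
  mul_le_mul (hφ.mono q r hq hqr) (Real.rpow_le_rpow (by linarith) hqr (by linarith))
    (by positivity) (hφ.nonneg r (by linarith))

/-- The increment splits into φ(r)(r^s - q^s), controlled by Bernoulli, and q^s(φ(r) - φ(q)),
controlled because φ(r)/r does not increase. -/
theorem IsWeight.sub_le (hφ : IsWeight φ) (hs : 1 ≤ s) {q r : ℝ} (hq : 1 ≤ q) (hqr : q ≤ r) :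
    |r ^ s * φ r - q ^ s * φ q| ≤ (s + 1) * (r - q) * (φ r * r ^ (s - 1)) := by
  have hr : 0 < r := by linarith
  have hφq := hφ.nonneg q hq
  have hφr := hφ.nonneg r (by linarith)
  rw [abs_of_nonneg (sub_nonneg.2 (mul_le_mul (Real.rpow_le_rpow (by linarith) hqr (by linarith))
    (hφ.mono q r hq hqr) hφq (by positivity)))]
  have h1 := mul_le_mul_of_nonneg_left (rpow_sub_rpow_le hs hq hqr) hφr
  have h2 : q ^ s = q * q ^ (s - 1) := by
    rw [Real.rpow_sub_one (by linarith)]; field_simp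
  have h3 := hφ.slow q r hq hqr
  have h4 : q ^ s * (φ r - φ q) ≤ (r - q) * (φ q * q ^ (s - 1)) := by
    rw [h2]
    have h5 : 0 ≤ q ^ (s - 1) := by positivity
    nlinarith
  have h6 := mul_le_mul_of_nonneg_left (hφ.mul_rpow_mono hs hq hqr) (sub_nonneg.2 hqr)
  nlinarith

/-- Sublinear growth makes φ doubling: one factor 2 comes from φ and a factor 2^(s-1) from the
power. -/
theorem IsWeight.le_two_rpow_mul (hφ : IsWeight φ) (hs : 1 ≤ s) {r m : ℝ} (hr : 1 ≤ r)
    (hm : 1 ≤ m) (h : r ≤ 2 * m) : φ r * r ^ (s - 1) ≤ 2 ^ s * (φ m * m ^ (s - 1)) := by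
  have h1 : φ r ≤ 2 * φ m := by
    rcases le_total r m with hrm | hmr
    · linarith [hφ.mono r m hr hrm, hφ.nonneg m hm]
    · have h2 := hφ.slow m r hm hmr
      have h3 := hφ.nonneg m hm
      have h4 : φ r * m ≤ (2 * φ m) * m := by nlinarith
      exact le_of_mul_le_mul_right h4 (by linarith)
  have h2 : r ^ (s - 1) ≤ 2 ^ (s - 1) * m ^ (s - 1) := by
    rw [← Real.mul_rpow (by norm_num) (by linarith)]
    exact Real.rpow_le_rpow (by linarith) h (by linarith)
  have h3 : (2 : ℝ) ^ s = 2 * 2 ^ (s - 1) := by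
    rw [Real.rpow_sub_one (by norm_num)]; ring
  calc φ r * r ^ (s - 1) ≤ (2 * φ m) * (2 ^ (s - 1) * m ^ (s - 1)) :=
        mul_le_mul h1 h2 (by positivity) (by linarith [hφ.nonneg m hm])
    _ = _ := by rw [h3]; ring

/-- The increments of `r ^ s φ(r)`, for arguments that satisfy triangle inequalities. -/
theorem IsWeight.abs_sub_le (hφ : IsWeight φ) (hs : 1 ≤ s) {r q p z : ℝ} (hr : 1 ≤ r) (hq : 1 ≤ q)
    (hp : 1 ≤ p) (hz : |r - q| ≤ z) (hpq : r ≤ p + q) :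
    |r ^ s * φ r - q ^ s * φ q| ≤
      (s + 1) * 2 ^ s * z * (φ p * p ^ (s - 1) + φ q * q ^ (s - 1)) := by
  have hP : 0 ≤ φ p * p ^ (s - 1) := mul_nonneg (hφ.nonneg p hp) (by positivity)
  have hQ : 0 ≤ φ q * q ^ (s - 1) := mul_nonneg (hφ.nonneg q hq) (by positivity)
  have h2 : (1 : ℝ) ≤ 2 ^ s := Real.one_le_rpow (by norm_num) (by linarith)
  have hz0 : 0 ≤ z := (abs_nonneg _).trans hz
  obtain ⟨hz1, hz2⟩ := abs_le.1 hz
  rcases le_total q r with h | h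
  · have h3 : φ r * r ^ (s - 1) ≤ 2 ^ s * (φ p * p ^ (s - 1) + φ q * q ^ (s - 1)) := by
      -- Since r ≤ p + q, the larger of p and q is at least r/2, and doubling compares r with it.
      rcases le_total p q with hpq' | hpq'
      · refine (hφ.le_two_rpow_mul hs hr hq (by linarith)).trans ?_
        gcongr; linarith
      · refine (hφ.le_two_rpow_mul hs hr hp (by linarith)).trans ?_
        gcongr; linarith
    calc _ ≤ (s + 1) * (r - q) * (φ r * r ^ (s - 1)) := hφ.sub_le hs hq h
      _ ≤ (s + 1) * z * (2 ^ s * (φ p * p ^ (s - 1) + φ q * q ^ (s - 1))) := by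
        refine mul_le_mul (by gcongr) h3
          (mul_nonneg (hφ.nonneg r hr) (by positivity)) (by positivity)
      _ = _ := by ring
  · rw [abs_sub_comm]
    calc _ ≤ (s + 1) * (q - r) * (φ q * q ^ (s - 1)) := hφ.sub_le hs hr h
      _ ≤ (s + 1) * z * (2 ^ s * (φ p * p ^ (s - 1) + φ q * q ^ (s - 1))) := by
        refine mul_le_mul (by gcongr; linarith) ?_ hQ (by positivity)
        nlinarith
      _ = _ := by ring

end Weights

/-! ### The symbol of the nonlinearity and the energy estimates -/

section Energy

open scoped ComplexConjugate

variable {n : ℕ}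

/-- The bracket `1 + |ξ|`. -/
def br (ξ : Space n) : ℝ := 1 + ‖ξ‖

theorem one_le_br (ξ : Space n) : 1 ≤ br ξ := by simp [br]

theorem br_pos (ξ : Space n) : 0 < br ξ := zero_lt_one.trans_le (one_le_br ξ)

theorem norm_le_br (ξ : Space n) : ‖ξ‖ ≤ br ξ := by simp [br]

theorem br_neg (ξ : Space n) : br (-ξ) = br ξ := by simp [br]

theorem continuous_br : Continuous (br : Space n → ℝ) := continuous_const.add continuous_norm

theorem measurable_br : Measurable (br : Space n → ℝ) := continuous_br.measurable

theorem measurable_br_rpow (σ : ℝ) : Measurable (fun ξ : Space n => br ξ ^ σ) :=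
  measurable_br.pow_const σ

theorem br_le_add (ξ η : Space n) : br ξ ≤ br (ξ - η) + br η := by
  have := norm_sub_norm_le ξ η
  simp only [br]; linarith

theorem abs_br_sub_le (ξ η : Space n) : |br ξ - br η| ≤ ‖ξ - η‖ := by
  simpa [br] using abs_norm_sub_norm_le ξ η

theorem br_rpow_nonneg (σ : ℝ) (ξ : Space n) : 0 ≤ br ξ ^ σ := Real.rpow_nonneg (br_pos ξ).le σ

theorem br_rpow_le_one {σ : ℝ} (hσ : σ ≤ 0) (ξ : Space n) : br ξ ^ σ ≤ 1 :=
  Real.rpow_le_one_of_one_le_of_nonpos (one_le_br ξ) hσ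

theorem br_rpow_mul (σ τ : ℝ) (ξ : Space n) : br ξ ^ σ * br ξ ^ τ = br ξ ^ (σ + τ) :=
  (Real.rpow_add (br_pos ξ) σ τ).symm

theorem br_mul_rpow (σ : ℝ) (ξ : Space n) : br ξ * br ξ ^ σ = br ξ ^ (1 + σ) := by
  rw [Real.rpow_add (br_pos ξ), Real.rpow_one]

theorem isMult_br_rpow {σ : ℝ} (hσ : σ ≤ 0) : IsMult (fun ξ : Space n => br ξ ^ σ) :=
  ⟨measurable_br_rpow σ, 1, fun ξ => by
    rw [abs_of_nonneg (br_rpow_nonneg σ ξ)]; exact br_rpow_le_one hσ ξ⟩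

/-- With σ = s - 1 this is where the hypothesis s > n/2 + 1 is spent. -/
theorem memLp_br_rpow {σ : ℝ} (hσ : (n : ℝ) / 2 < σ) :
    MemLp (fun ξ : Space n => br ξ ^ (-σ)) 2 volume := by
  rw [memLp_two_iff_integrable_sq (measurable_br_rpow _).aestronglyMeasurable]
  have h := integrable_one_add_norm (E := Space n) (μ := volume) (r := 2 * σ)
    (by rw [finrank_euclideanSpace_fin]; linarith)
  refine h.congr (Eventually.of_forall fun ξ => ?_)
  change (1 + ‖ξ‖) ^ (-(2 * σ)) = (br ξ ^ (-σ)) ^ 2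
  rw [← Real.rpow_natCast, ← Real.rpow_mul (br_pos ξ).le]
  congr 1; push_cast; ring

/-- The Fourier multipliers `c` (up to the factor `-i`) of the velocity. -/
structure IsVel (c : Space n → Space n) (C : ℝ) : Prop where
  measurable : Measurable c
  odd : ∀ ζ, c (-ζ) = -c ζ
  le : ∀ ζ, ‖c ζ‖ ≤ C

/-- The symbol of the bilinear operator `u · ∇`. -/
def qsym (c : Space n → Space n) (ξ η : Space n) : ℝ := ⟪c (ξ - η), η⟫

/-- The symbol of the nonlinearity, as an operator from `H^s × H^s` to `H^{s-1}`. -/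
def baseSym (c : Space n → Space n) (s : ℝ) (ξ η : Space n) : ℝ :=
  br ξ ^ (s - 1) * (qsym c ξ η * (br (ξ - η) ^ (-s) * br η ^ (-s)))

variable {c : Space n → Space n} {C s : ℝ}

theorem IsVel.const_nonneg (hc : IsVel c C) : 0 ≤ C := (norm_nonneg _).trans (hc.le 0)

theorem IsVel.measurable_qsym (hc : IsVel c C) : Measurable (Function.uncurry (qsym c)) := by
  unfold qsym
  exact (hc.measurable.comp (measurable_fst.sub measurable_snd)).inner measurable_snd

theorem IsVel.abs_qsym_le (hc : IsVel c C) (ξ η : Space n) : |qsym c ξ η| ≤ C * ‖η‖ :=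
  (abs_real_inner_le_norm _ _).trans (mul_le_mul_of_nonneg_right (hc.le _) (norm_nonneg _))

theorem IsVel.measurable_baseSym (hc : IsVel c C) :
    Measurable (Function.uncurry (baseSym c s)) := by
  unfold baseSym
  exact ((measurable_br_rpow _).comp measurable_fst).mul (hc.measurable_qsym.mul
    (((measurable_br_rpow _).comp (measurable_fst.sub measurable_snd)).mul
      ((measurable_br_rpow _).comp measurable_snd)))

theorem IsVel.baseSym_neg (hc : IsVel c C) (ξ η : Space n) :
    baseSym c s (-ξ) (-η) = baseSym c s ξ η := by
  have h : -ξ - -η = -(ξ - η) := by abel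
  simp only [baseSym, qsym, h, br_neg, hc.odd, inner_neg_neg]

theorem br_rpow_le_add (hs : 1 ≤ s) (ξ η : Space n) :
    br ξ ^ (s - 1) ≤ 2 ^ s * (br (ξ - η) ^ (s - 1) + br η ^ (s - 1)) := by
  have h := br_le_add ξ η
  have h2 : (0 : ℝ) ≤ 2 ^ s := by positivity
  have p1 := br_rpow_nonneg (s - 1) (ξ - η)
  have p2 := br_rpow_nonneg (s - 1) η
  rcases le_total (br (ξ - η)) (br η) with h1 | h1
  · have := isWeight_one.le_two_rpow_mul hs (one_le_br ξ) (one_le_br η) (by linarith)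
    nlinarith
  · have := isWeight_one.le_two_rpow_mul hs (one_le_br ξ) (one_le_br (ξ - η)) (by linarith)
    nlinarith

/-- The factor (1+|ξ|)^(s-1) is distributed over the two incoming frequencies, and the gradient
costs one power of 1+|η|. In either case one variable keeps the decay of order s - 1, at least, and
the factor in the other stays bounded. -/
theorem IsVel.isSymbol_baseSym (hc : IsVel c C) (hs : (n : ℝ) / 2 + 1 < s) :
    IsSymbol (baseSym c s) (fun ξ => br ξ ^ (-(s - 1))) (C * 2 ^ s) where
  measurable := hc.measurable_baseSym
  nonneg := br_rpow_nonneg _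
  memLp := memLp_br_rpow (by linarith)
  const_nonneg := mul_nonneg hc.const_nonneg (by positivity)
  le ξ η := by
    have hn : (0 : ℝ) ≤ n := by positivity
    have h1s : 1 ≤ s := by linarith
    have hC := hc.const_nonneg
    have e1 : br η * br η ^ (-s) = br η ^ (-(s - 1)) := by
      rw [br_mul_rpow]; congr 1; ring
    have e2 : br (ξ - η) ^ (s - 1) * br (ξ - η) ^ (-s) ≤ 1 := by
      rw [br_rpow_mul]; exact br_rpow_le_one (by linarith) _
    have e3 : br η ^ (s - 1) * br η ^ (-(s - 1)) = 1 := by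
      rw [br_rpow_mul]; simp
    have e4 : br (ξ - η) ^ (-s) ≤ br (ξ - η) ^ (-(s - 1)) :=
      Real.rpow_le_rpow_of_exponent_le (one_le_br _) (by linarith)
    have q := hc.abs_qsym_le ξ η
    have q' : C * ‖η‖ ≤ C * br η := mul_le_mul_of_nonneg_left (norm_le_br η) hC
    rw [baseSym, abs_mul, abs_mul, abs_of_nonneg (br_rpow_nonneg _ ξ),
      abs_of_nonneg (mul_nonneg (br_rpow_nonneg _ _) (br_rpow_nonneg _ _))]
    calc _ ≤ (2 ^ s * (br (ξ - η) ^ (s - 1) + br η ^ (s - 1))) *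
          ((C * br η) * (br (ξ - η) ^ (-s) * br η ^ (-s))) := by
          refine mul_le_mul (br_rpow_le_add h1s ξ η)
            (mul_le_mul_of_nonneg_right (q.trans q')
              (mul_nonneg (br_rpow_nonneg _ _) (br_rpow_nonneg _ _)))
            (mul_nonneg (abs_nonneg _) (mul_nonneg (br_rpow_nonneg _ _) (br_rpow_nonneg _ _)))
            (mul_nonneg (by positivity)
              (add_nonneg (br_rpow_nonneg _ _) (br_rpow_nonneg _ _)))
      _ = C * 2 ^ s * ((br (ξ - η) ^ (s - 1) * br (ξ - η) ^ (-s)) * (br η * br η ^ (-s)) +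
          (br η ^ (s - 1) * (br η * br η ^ (-s))) * br (ξ - η) ^ (-s)) := by ring
      _ ≤ _ := by
          rw [e1, e3, one_mul, add_comm (br (ξ - η) ^ (-(s - 1)))]
          refine mul_le_mul_of_nonneg_left (add_le_add ?_ e4) (mul_nonneg hC (by positivity))
          exact mul_le_of_le_one_left (br_rpow_nonneg _ _) e2

/-- The transport term loses no derivative: symmetrization moves it to the velocity. -/
theorem IsVel.abs_re_tri_le (hc : IsVel c C) {v G : Space n → ℂ} (hv : IsHerm v)
    (hv1 : MemLp (fun ξ => (br ξ : ℂ) * v ξ) 1 volume) (hvm : AEStronglyMeasurable v volume)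
    (hG : MemLp G 2 volume)
    (hG1 : MemLp (fun ξ => (br ξ : ℂ) * G ξ) 2 volume) :
    Integrable (fun p : Space n × Space n =>
      (qsym c p.1 p.2 : ℂ) * (v (p.1 - p.2) * G p.2 * conj (G p.1))) ∧
    |(tri (qsym c) v G G).re| ≤
      C * lpNorm (fun ξ => (br ξ : ℂ) * v ξ) 1 volume * lpNorm G 2 volume ^ 2 := by
  have hC := hc.const_nonneg
  have z1 : MemLp (fun _ : Space n => (0 : ℂ)) 1 volume := MemLp.zero
  have z2 : MemLp (fun _ : Space n => (0 : ℂ)) 2 volume := MemLp.zero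
  obtain ⟨hi, -⟩ := integrable_tri_of_le (b := qsym c) hc.measurable_qsym hvm hG.1 hG
    (hv1.const_mul (C : ℂ)) hG1 z2 z1 (fun ξ η => by
      have h1 := one_le_br (ξ - η)
      simp only [norm_mul, Complex.norm_real, Real.norm_eq_abs, norm_zero, mul_zero, add_zero,
        abs_of_nonneg hC, abs_of_nonneg (br_pos _).le]
      calc _ ≤ (C * br η) * (‖v (ξ - η)‖ * ‖G η‖) := by
            refine mul_le_mul_of_nonneg_right ((hc.abs_qsym_le ξ η).trans
              (mul_le_mul_of_nonneg_left (norm_le_br η) hC)) (by positivity)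
        _ = (C * (1 * ‖v (ξ - η)‖)) * (br η * ‖G η‖) := by ring
        _ ≤ _ := by
            have := br_pos η
            gcongr)
  refine ⟨hi, ?_⟩
  have hv' : ∀ᵐ p : Space n × Space n, v (-(p.1 - p.2)) = conj (v (p.1 - p.2)) :=
    quasiMeasurePreserving_sub'.ae hv
  have hswap : tri (qsym c) v G G = ∫ p : Space n × Space n,
      (qsym c p.2 p.1 : ℂ) * (v (p.2 - p.1) * G p.1 * conj (G p.2)) := by
    rw [tri, Measure.volume_eq_prod, ← integral_prod_swap]
    rfl
  have hi2 : Integrable (fun p : Space n × Space n =>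
      (qsym c p.2 p.1 : ℂ) * (v (p.2 - p.1) * G p.1 * conj (G p.2))) := by
    have := hi
    rw [Measure.volume_eq_prod] at this ⊢
    exact this.swap
  -- Adding the conjugate of the swapped integral replaces η by η - ξ, because c is odd and v
  -- Hermitian. This is the symbol of minus the divergence of the velocity: integration by parts in
  -- ∫ (u·∇G) G.
  let b' : Space n → Space n → ℝ := fun ξ η => -⟪c (ξ - η), ξ - η⟫
  have hsum : tri (qsym c) v G G + conj (tri (qsym c) v G G) = tri b' v G G := by
    nth_rewrite 2 [hswap]
    have hi3 : Integrable (fun p : Space n × Space n =>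
        conj ((qsym c p.2 p.1 : ℂ) * (v (p.2 - p.1) * G p.1 * conj (G p.2)))) :=
      Complex.conjCLE.toContinuousLinearMap.integrable_comp hi2
    rw [← integral_conj, tri, ← integral_add hi hi3, tri]
    refine integral_congr_ae ?_
    filter_upwards [hv'] with p hp
    have e : p.2 - p.1 = -(p.1 - p.2) := by abel
    have e2 : qsym c p.2 p.1 = -⟪c (p.1 - p.2), p.1⟫ := by
      rw [qsym, e, hc.odd, inner_neg_left]
    have e3 : b' p.1 p.2 = -⟪c (p.1 - p.2), p.1⟫ + ⟪c (p.1 - p.2), p.2⟫ := by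
      simp only [b', inner_sub_right]; ring
    rw [e2, e3, e, hp]
    simp only [map_mul, Complex.conj_conj, Complex.conj_ofReal, qsym]
    push_cast; ring
  have hb'm : Measurable (Function.uncurry b') := by
    have h1 : Measurable (fun p : Space n × Space n => p.1 - p.2) :=
      measurable_fst.sub measurable_snd
    exact ((hc.measurable.comp h1).inner h1).neg
  obtain ⟨-, hbd⟩ := integrable_tri_of_le (b := b') hb'm hvm hG.1 hG
    (hv1.const_mul (C : ℂ)) hG z2 z1 (fun ξ η => by
      simp only [norm_mul, Complex.norm_real, Real.norm_eq_abs, norm_zero, mul_zero, add_zero,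
        abs_of_nonneg hC, abs_of_nonneg (br_pos _).le, b', abs_neg]
      have h1 : |⟪c (ξ - η), ξ - η⟫| ≤ C * br (ξ - η) :=
        (abs_real_inner_le_norm _ _).trans
          (mul_le_mul (hc.le _) (norm_le_br _) (norm_nonneg _) hC)
      calc _ ≤ (C * br (ξ - η)) * (‖v (ξ - η)‖ * ‖G η‖) :=
            mul_le_mul_of_nonneg_right h1 (by positivity)
        _ = _ := by ring)
  have h2 : (tri b' v G G).re = 2 * (tri (qsym c) v G G).re := by
    rw [← hsum]; simp; ring
  have h3 := (Complex.abs_re_le_norm (tri b' v G G)).trans hbd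
  have hCn : lpNorm (fun ξ => (C : ℂ) * ((br ξ : ℂ) * v ξ)) 1 volume =
      C * lpNorm (fun ξ => (br ξ : ℂ) * v ξ) 1 volume := by
    have := lpNorm_const_smul (p := 1) (C : ℂ) (fun ξ => (br ξ : ℂ) * v ξ)
      (volume : Measure (Space n))
    rw [coe_nnnorm, Complex.norm_real, Real.norm_of_nonneg hC] at this
    exact this
  rw [h2, hCn, abs_mul, abs_two, lpNorm_fun_zero, zero_mul, add_zero] at h3
  have h4 : 0 ≤ lpNorm (fun ξ => (br ξ : ℂ) * v ξ) 1 volume := lpNorm_nonneg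
  have h5 := mul_nonneg (mul_nonneg hC h4) (sq_nonneg (lpNorm G 2 volume))
  nlinarith [abs_nonneg (tri (qsym c) v G G).re]

/-- The `L²` bound for the term in which the velocity is rough. -/
theorem IsVel.norm_tri_le (hc : IsVel c C) {d w k : Space n → ℂ} (hd : MemLp d 2 volume)
    (hwm : AEStronglyMeasurable w volume)
    (hw : MemLp (fun ξ => (br ξ : ℂ) * w ξ) 1 volume) (hk : MemLp k 2 volume) :
    ‖tri (qsym c) d w k‖ ≤
      C * lpNorm (fun ξ => (br ξ : ℂ) * w ξ) 1 volume * lpNorm d 2 volume * lpNorm k 2 volume := by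
  have hC := hc.const_nonneg
  have z1 : MemLp (fun _ : Space n => (0 : ℂ)) 1 volume := MemLp.zero
  have z2 : MemLp (fun _ : Space n => (0 : ℂ)) 2 volume := MemLp.zero
  have hCn : lpNorm (fun ξ => (C : ℂ) * ((br ξ : ℂ) * w ξ)) 1 volume =
      C * lpNorm (fun ξ => (br ξ : ℂ) * w ξ) 1 volume := by
    have := lpNorm_const_smul (p := 1) (C : ℂ) (fun ξ => (br ξ : ℂ) * w ξ)
      (volume : Measure (Space n))
    rw [coe_nnnorm, Complex.norm_real, Real.norm_of_nonneg hC] at this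
    exact this
  obtain ⟨-, hbd⟩ := integrable_tri_of_le (b := qsym c) hc.measurable_qsym hd.1 hwm hk
    z1 z2 hd (hw.const_mul (C : ℂ)) (fun ξ η => by
      simp only [norm_mul, Complex.norm_real, Real.norm_eq_abs, norm_zero, mul_zero, zero_add,
        abs_of_nonneg hC, abs_of_nonneg (br_pos _).le]
      calc _ ≤ (C * br η) * (‖d (ξ - η)‖ * ‖w η‖) := by
            refine mul_le_mul_of_nonneg_right ((hc.abs_qsym_le ξ η).trans
              (mul_le_mul_of_nonneg_left (norm_le_br η) hC)) (by positivity)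
        _ = _ := by ring)
  rw [hCn, lpNorm_fun_zero, zero_mul, zero_add] at hbd
  linarith

/-- The constant of the energy estimate. -/
def energyConst (n : ℕ) (C s : ℝ) : ℝ :=
  (2 * (s + 1) * 2 ^ s + 1) * C * lpNorm (fun ξ : Space n => br ξ ^ (-(s - 1))) 2 volume

/-- The transform of an H^s function remains integrable after multiplication by 1+|ξ|, which bounds
the gradient on the Fourier side. -/
theorem memLp_br_mul (hs : (n : ℝ) / 2 + 1 < s) {V : Space n → ℂ} (hV : MemLp V 2 volume) :
    MemLp (fun ξ => (br ξ : ℂ) * (((br ξ ^ (-s) : ℝ) : ℂ) * V ξ)) 1 volume ∧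
    lpNorm (fun ξ => (br ξ : ℂ) * (((br ξ ^ (-s) : ℝ) : ℂ) * V ξ)) 1 volume ≤
      lpNorm (fun ξ : Space n => br ξ ^ (-(s - 1))) 2 volume * lpNorm V 2 volume := by
  have e : (fun ξ => (br ξ : ℂ) * (((br ξ ^ (-s) : ℝ) : ℂ) * V ξ)) =
      fun ξ => ((br ξ ^ (-(s - 1)) : ℝ) : ℂ) * V ξ := by
    ext ξ
    rw [← mul_assoc, ← Complex.ofReal_mul]
    congr 2
    rw [br_mul_rpow]; congr 1; ring
  rw [e]
  exact memLp_mul_one (memLp_br_rpow (by linarith)) hV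

/-- The energy estimate with a weight. -/
theorem IsVel.energy_estimate (hc : IsVel c C) (hs : (n : ℝ) / 2 + 1 < s) {φ : ℝ → ℝ}
    (hφ : IsWeight φ) (hφm : Measurable φ) {V : Space n → ℂ} (hV : MemLp V 2 volume)
    (hVh : IsHerm V)
    (hZ : MemLp (fun ξ => (φ (br ξ) : ℂ) * V ξ) 2 volume)
    (hZ1 : MemLp (fun ξ => (br ξ : ℂ) * ((φ (br ξ) : ℂ) * V ξ)) 2 volume) :
    |(tri (fun ξ η => φ (br ξ) * br ξ * baseSym c s ξ η) V V
        (fun ξ => (φ (br ξ) : ℂ) * V ξ)).re| ≤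
      energyConst n C s * lpNorm V 2 volume *
        lpNorm (fun ξ => (φ (br ξ) : ℂ) * V ξ) 2 volume ^ 2 := by
  have hn : (0 : ℝ) ≤ n := by positivity
  have h1s : 1 ≤ s := by linarith
  have hC := hc.const_nonneg
  set Z : Space n → ℂ := fun ξ => (φ (br ξ) : ℂ) * V ξ with hZdef
  set h : Space n → ℝ := fun ξ => br ξ ^ (-(s - 1)) with hh
  set H := lpNorm h 2 volume with hH
  obtain ⟨mv, nv⟩ := memLp_br_mul hs hV
  obtain ⟨hi2, hb2⟩ := hc.abs_re_tri_le (v := fun ξ => ((br ξ ^ (-s) : ℝ) : ℂ) * V ξ) (G := Z)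
    (hVh.mul_real (m := fun ξ => br ξ ^ (-s)) (fun ξ => by simp only [br_neg])) mv
    ((Complex.measurable_ofReal.comp (measurable_br_rpow _)).aestronglyMeasurable.mul hV.1) hZ hZ1
  -- The commutator part of the symbol: the full weight at the output frequency ξ minus its value at
  -- η. In what remains, the weight at η cancels the factor (1+|η|)^(-s) and leaves φ on the
  -- transported function.
  let e1 : Space n → Space n → ℝ := fun ξ η =>
    qsym c ξ η * (br ξ ^ s * φ (br ξ) - br η ^ s * φ (br η)) * (br (ξ - η) ^ (-s) * br η ^ (-s))
  have hom : Measurable (fun ξ : Space n => br ξ ^ s * φ (br ξ)) :=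
    (measurable_br_rpow s).mul (hφm.comp measurable_br)
  have he1 : Measurable (Function.uncurry e1) :=
    (hc.measurable_qsym.mul ((hom.comp measurable_fst).sub (hom.comp measurable_snd))).mul
      (((measurable_br_rpow _).comp (measurable_fst.sub measurable_snd)).mul
        ((measurable_br_rpow _).comp measurable_snd))
  -- This is C from the velocity symbol times the constant of `IsWeight.abs_sub_le`. It appears
  -- twice in `energyConst`, once for each term that dominates the commutator; the summand 1 there
  -- is the transport term.
  set K : ℝ := C * ((s + 1) * 2 ^ s) with hK
  have hK0 : 0 ≤ K := by positivity
  obtain ⟨mh, nh⟩ := memLp_mul_one (h := h) (memLp_br_rpow (by linarith)) hV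
  have hKn : lpNorm (fun ξ => (K : ℂ) * ((h ξ : ℂ) * V ξ)) 1 volume =
      K * lpNorm (fun ξ => (h ξ : ℂ) * V ξ) 1 volume := by
    have := lpNorm_const_smul (p := 1) (K : ℂ) (fun ξ => (h ξ : ℂ) * V ξ)
      (volume : Measure (Space n))
    rw [coe_nnnorm, Complex.norm_real, Real.norm_of_nonneg hK0] at this
    exact this
  obtain ⟨hi1, hb1⟩ := integrable_tri_of_le (b := e1) he1 hV.1 hV.1 hZ
    (mh.const_mul (K : ℂ)) hZ hZ (mh.const_mul (K : ℂ)) (fun ξ η => by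
      have hp := br_pos (ξ - η)
      have hq := br_pos η
      have k1 : ‖η‖ * br η ^ (-s) ≤ h η := by
        have : h η = br η * br η ^ (-s) := by
          rw [br_mul_rpow, hh]; simp only; congr 1; ring
        rw [this]
        exact mul_le_mul_of_nonneg_right (norm_le_br η) (br_rpow_nonneg _ _)
      have k2 : ‖ξ - η‖ * br (ξ - η) ^ (-s) ≤ h (ξ - η) := by
        have : h (ξ - η) = br (ξ - η) * br (ξ - η) ^ (-s) := by
          rw [br_mul_rpow, hh]; simp only; congr 1; ring
        rw [this]
        exact mul_le_mul_of_nonneg_right (norm_le_br _) (br_rpow_nonneg _ _)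
      have k3 : ‖ξ - η‖ * br (ξ - η) ^ (s - 1) * br (ξ - η) ^ (-s) ≤ 1 := by
        have h1 := mul_le_mul_of_nonneg_right (norm_le_br (ξ - η))
          (mul_nonneg (br_rpow_nonneg (s - 1) (ξ - η)) (br_rpow_nonneg (-s) (ξ - η)))
        have h2 : br (ξ - η) * (br (ξ - η) ^ (s - 1) * br (ξ - η) ^ (-s)) = 1 := by
          rw [br_rpow_mul, br_mul_rpow]; ring_nf; simp
        linarith
      have k4 : ‖η‖ * br η ^ (s - 1) * br η ^ (-s) ≤ 1 := by
        have h1 := mul_le_mul_of_nonneg_right (norm_le_br η)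
          (mul_nonneg (br_rpow_nonneg (s - 1) η) (br_rpow_nonneg (-s) η))
        have h2 : br η * (br η ^ (s - 1) * br η ^ (-s)) = 1 := by
          rw [br_rpow_mul, br_mul_rpow]; ring_nf; simp
        linarith
      have f1 := hφ.nonneg _ (one_le_br (ξ - η))
      have f2 := hφ.nonneg _ (one_le_br η)
      have h0 := br_rpow_nonneg (-(s - 1)) (ξ - η)
      have h0' := br_rpow_nonneg (-(s - 1)) η
      have key := hφ.abs_sub_le h1s (one_le_br ξ) (one_le_br η) (one_le_br (ξ - η))
        (abs_br_sub_le ξ η) (br_le_add ξ η)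
      have hsym : |e1 ξ η| ≤ K * (φ (br (ξ - η)) * h η + h (ξ - η) * φ (br η)) := by
        have r1 := br_rpow_nonneg (-s) (ξ - η)
        have r2 := br_rpow_nonneg (-s) η
        have r3 := br_rpow_nonneg (s - 1) (ξ - η)
        have r4 := br_rpow_nonneg (s - 1) η
        calc |e1 ξ η| = |qsym c ξ η| * |br ξ ^ s * φ (br ξ) - br η ^ s * φ (br η)| *
              (br (ξ - η) ^ (-s) * br η ^ (-s)) := by
              simp only [e1]
              rw [abs_mul, abs_mul, abs_of_nonneg (mul_nonneg r1 r2)]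
          _ ≤ (C * ‖η‖) * ((s + 1) * 2 ^ s * ‖ξ - η‖ * (φ (br (ξ - η)) * br (ξ - η) ^ (s - 1) +
              φ (br η) * br η ^ (s - 1))) * (br (ξ - η) ^ (-s) * br η ^ (-s)) := by
              refine mul_le_mul_of_nonneg_right ?_ (mul_nonneg r1 r2)
              exact mul_le_mul (hc.abs_qsym_le ξ η) key (abs_nonneg _) (by positivity)
          _ = K * (φ (br (ξ - η)) * (‖ξ - η‖ * br (ξ - η) ^ (s - 1) * br (ξ - η) ^ (-s)) *
                (‖η‖ * br η ^ (-s)) +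
              φ (br η) * (‖η‖ * br η ^ (s - 1) * br η ^ (-s)) *
                (‖ξ - η‖ * br (ξ - η) ^ (-s))) := by rw [hK]; ring
          _ ≤ K * (φ (br (ξ - η)) * 1 * h η + φ (br η) * 1 * h (ξ - η)) := by
              gcongr
          _ = _ := by ring
      simp only [norm_mul, Complex.norm_real, Real.norm_eq_abs, hZdef, abs_of_nonneg hK0,
        abs_of_nonneg f1, abs_of_nonneg f2]
      rw [abs_of_nonneg (show 0 ≤ h (ξ - η) from h0), abs_of_nonneg (show 0 ≤ h η from h0')]
      refine (mul_le_mul_of_nonneg_right hsym (by positivity)).trans (le_of_eq ?_)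
      ring)
  have hsplit : tri (fun ξ η => φ (br ξ) * br ξ * baseSym c s ξ η) V V Z =
      tri e1 V V Z + tri (qsym c) (fun ξ => ((br ξ ^ (-s) : ℝ) : ℂ) * V ξ) Z Z := by
    rw [tri, tri, tri, ← integral_add hi1 hi2]
    congr 1; ext p
    have a1 : br p.1 * br p.1 ^ (s - 1) = br p.1 ^ s := by
      rw [br_mul_rpow]; congr 1; ring
    have a2 : br p.2 ^ s * br p.2 ^ (-s) = 1 := by rw [br_rpow_mul]; simp
    have a3 : φ (br p.1) * br p.1 * baseSym c s p.1 p.2 = e1 p.1 p.2 +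
        qsym c p.1 p.2 * br (p.1 - p.2) ^ (-s) * φ (br p.2) := by
      have b1 : φ (br p.1) * br p.1 * baseSym c s p.1 p.2 =
          φ (br p.1) * (br p.1 * br p.1 ^ (s - 1)) *
            (qsym c p.1 p.2 * (br (p.1 - p.2) ^ (-s) * br p.2 ^ (-s))) := by
        rw [baseSym]; ring
      rw [b1, a1]
      simp only [e1]
      linear_combination ((qsym c p.1 p.2 * br (p.1 - p.2) ^ (-s) * φ (br p.2))) * a2
    rw [a3]
    simp only [hZdef]
    push_cast
    ring
  rw [hsplit, Complex.add_re]
  have hVn : 0 ≤ lpNorm V 2 volume := lpNorm_nonneg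
  have hZn : 0 ≤ lpNorm Z 2 volume := lpNorm_nonneg
  have b1 : |(tri e1 V V Z).re| ≤ 2 * K * H * lpNorm V 2 volume * lpNorm Z 2 volume ^ 2 := by
    refine (Complex.abs_re_le_norm _).trans (hb1.trans ?_)
    rw [hKn]
    have := mul_le_mul_of_nonneg_left nh (mul_nonneg hK0 (sq_nonneg (lpNorm Z 2 volume)))
    nlinarith
  have b2 : |(tri (qsym c) (fun ξ => ((br ξ ^ (-s) : ℝ) : ℂ) * V ξ) Z Z).re| ≤
      C * H * lpNorm V 2 volume * lpNorm Z 2 volume ^ 2 := by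
    refine hb2.trans ?_
    have := mul_le_mul_of_nonneg_left nv (mul_nonneg hC (sq_nonneg (lpNorm Z 2 volume)))
    nlinarith
  refine (abs_add_le _ _).trans ((add_le_add b1 b2).trans (le_of_eq ?_))
  rw [energyConst, hK]
  ring

end Energy

/-! ### Ordinary differential equations in Banach and Hilbert spaces -/

section ODE

variable {E : Type*} [NormedAddCommGroup E]

/-- The radial retraction to the ball of radius `R`. -/
def retr [NormedSpace ℝ E] (R : ℝ) (x : E) : E := (R / max R ‖x‖) • x

variable [NormedSpace ℝ E] {R : ℝ}

theorem retr_of_norm_le (hR : 0 < R) {x : E} (hx : ‖x‖ ≤ R) : retr R x = x := by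
  rw [retr, max_eq_left hx, div_self hR.ne', one_smul]

theorem norm_retr_le (hR : 0 < R) (x : E) : ‖retr R x‖ ≤ R := by
  have h : 0 < max R ‖x‖ := lt_max_of_lt_left hR
  rw [retr, norm_smul, Real.norm_of_nonneg (by positivity), div_mul_eq_mul_div, div_le_iff₀ h]
  exact mul_le_mul_of_nonneg_left (le_max_right _ _) hR.le

/-- In a general normed space the radial retraction is only 2-Lipschitz: moving the point and
changing the scaling factor each contribute ‖x - y‖. -/
theorem norm_retr_sub_le (hR : 0 < R) (x y : E) : ‖retr R x - retr R y‖ ≤ 2 * ‖x - y‖ := by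
  have hx : 0 < max R ‖x‖ := lt_max_of_lt_left hR
  have hy : 0 < max R ‖y‖ := lt_max_of_lt_left hR
  have e : retr R x - retr R y =
      (R / max R ‖x‖) • (x - y) + (R / max R ‖x‖ - R / max R ‖y‖) • y := by
    simp only [retr, smul_sub, sub_smul]; abel
  have h1 : R / max R ‖x‖ ≤ 1 := (div_le_one hx).2 (le_max_left _ _)
  have h2 : |R / max R ‖x‖ - R / max R ‖y‖| * ‖y‖ ≤ ‖x - y‖ := by
    have h3 : R / max R ‖x‖ - R / max R ‖y‖ =
        (R / max R ‖x‖) * (max R ‖y‖ - max R ‖x‖) / max R ‖y‖ := by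
      field_simp
    rw [h3, abs_div, abs_mul, abs_of_pos hy, abs_of_nonneg (by positivity : 0 ≤ R / max R ‖x‖),
      div_mul_eq_mul_div, div_le_iff₀ hy]
    have h4 : |max R ‖y‖ - max R ‖x‖| ≤ ‖x - y‖ := by
      have h5 := abs_max_sub_max_le_abs ‖y‖ ‖x‖ R
      rw [max_comm ‖y‖, max_comm ‖x‖] at h5
      exact h5.trans ((abs_norm_sub_norm_le y x).trans_eq (norm_sub_rev y x))
    calc _ ≤ 1 * ‖x - y‖ * max R ‖y‖ := by gcongr; exact le_max_right _ _
      _ = _ := by ring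
  rw [e]
  refine (norm_add_le _ _).trans ?_
  rw [norm_smul, norm_smul, Real.norm_of_nonneg (by positivity), Real.norm_eq_abs]
  nlinarith [norm_nonneg (x - y)]

/-- A bounded Lipschitz autonomous field has solutions on every interval `[0, T]`. -/
theorem exists_solution_of_bounded_lipschitz [CompleteSpace E] {F : E → E} {L K : ℝ≥0}
    (hL : ∀ x, ‖F x‖ ≤ L) (hK : LipschitzWith K F) {T : ℝ} (hT : 0 ≤ T) (x₀ : E) :
    ∃ α : ℝ → E, α 0 = x₀ ∧ ∀ t ∈ Icc 0 T, HasDerivWithinAt α (F (α t)) (Icc 0 T) t := by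
  -- A curve of speed at most L stays within distance L·T of its start, so the local theorem on that
  -- ball already covers all of [0, T].
  have h : IsPicardLindelof (fun _ => F) (⟨0, le_rfl, hT⟩ : Icc (0 : ℝ) T) x₀
      (L * T.toNNReal) 0 L K :=
    IsPicardLindelof.of_time_independent (fun x _ => hL x) hK.lipschitzOnWith (by simp [hT])
  exact h.exists_eq_forall_mem_Icc_hasDerivWithinAt₀

theorem hasDerivWithinAt_Ici_of_Icc {f : ℝ → E} {f' : E} {T t : ℝ} (ht : t ∈ Ico 0 T)
    (h : HasDerivWithinAt f f' (Icc 0 T) t) : HasDerivWithinAt f f' (Ici t) t := by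
  refine h.mono_of_mem_nhdsWithin ?_
  filter_upwards [Icc_mem_nhdsGE ht.2] with x hx
  exact ⟨ht.1.trans hx.1, hx.2⟩

theorem le_gronwallBound_of_hasDerivWithinAt {f f' : ℝ → ℝ} {K ε T : ℝ}
    (hf : ContinuousOn f (Icc 0 T)) (hf' : ∀ t ∈ Ico 0 T, HasDerivWithinAt f (f' t) (Ici t) t)
    (bound : ∀ t ∈ Ico 0 T, f' t ≤ K * f t + ε) :
    ∀ t ∈ Icc 0 T, f t ≤ gronwallBound (f 0) K ε t := by
  intro t ht
  have := le_gronwallBound_of_liminf_deriv_right_le hf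
    (fun x hx r hr => (hf' x hx).liminf_right_slope_le hr) le_rfl bound t ht
  rwa [sub_zero] at this

/-- Grönwall's inequality for the square of a Hilbert norm. -/
theorem norm_sq_le_gronwallBound {H : Type*} [NormedAddCommGroup H] [InnerProductSpace ℂ H]
    [NormedSpace ℝ H] [IsScalarTower ℝ ℂ H]
    {Z Z' : ℝ → H} {K ε T : ℝ} (hZ : ContinuousOn Z (Icc 0 T))
    (hZ' : ∀ t ∈ Ico 0 T, HasDerivWithinAt Z (Z' t) (Ici t) t)
    (bound : ∀ t ∈ Ico 0 T, 2 * (inner ℂ (Z t) (Z' t)).re ≤ K * ‖Z t‖ ^ 2 + ε) :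
    ∀ t ∈ Icc 0 T, ‖Z t‖ ^ 2 ≤ gronwallBound (‖Z 0‖ ^ 2) K ε t := by
  refine le_gronwallBound_of_hasDerivWithinAt (f' := fun t => 2 * (inner ℂ (Z t) (Z' t)).re)
    (hZ.norm.pow 2) (fun t ht => ?_) bound
  have h1 := HasDerivWithinAt.inner ℂ (hZ' t ht) (hZ' t ht)
  have h2 := Complex.reCLM.hasFDerivAt.comp_hasDerivWithinAt t h1
  have e1 : (Complex.reCLM ∘ fun t => inner ℂ (Z t) (Z t)) = fun t => ‖Z t‖ ^ 2 := by
    ext τ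
    rw [Function.comp, inner_self_eq_norm_sq_to_K, Complex.reCLM_apply]
    norm_cast
  have e2 : Complex.reCLM (inner ℂ (Z t) (Z' t) + inner ℂ (Z' t) (Z t)) =
      2 * (inner ℂ (Z t) (Z' t)).re := by
    rw [Complex.reCLM_apply, Complex.add_re, ← inner_conj_symm (Z' t), Complex.conj_re]; ring
  rw [e1, e2] at h2
  exact h2

end ODE

/-! ### Galerkin approximations -/

section Galerkin

variable {n : ℕ}

/-- The indicator function of the ball of radius `K`. -/
def cut (K : ℝ) (ξ : Space n) : ℝ := if ‖ξ‖ ≤ K then 1 else 0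

theorem cut_neg (K : ℝ) (ξ : Space n) : cut K (-ξ) = cut K ξ := by simp [cut]

theorem cut_mul_cut {K L : ℝ} (h : K ≤ L) (ξ : Space n) : cut L ξ * cut K ξ = cut K ξ := by
  unfold cut
  split_ifs with h1 h2 <;> simp
  exact h1 (by linarith)

theorem measurable_cut (K : ℝ) : Measurable (cut K : Space n → ℝ) :=
  Measurable.ite (measurableSet_le measurable_norm measurable_const) measurable_const
    measurable_const

theorem abs_cut_le (K : ℝ) (ξ : Space n) : |cut K ξ| ≤ 1 := by
  unfold cut; split_ifs <;> simp

theorem isMult_cut (K : ℝ) : IsMult (cut K : Space n → ℝ) :=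
  ⟨measurable_cut K, 1, abs_cut_le K⟩

theorem isMult_weight {φ : ℝ → ℝ} (hφ : IsWeight φ) (hφm : Measurable φ) (K : ℝ) :
    IsMult (fun ξ : Space n => φ (br ξ) * cut K ξ) := by
  -- The absolute value serves negative K, for which the multiplier vanishes but φ(1 + K) may have
  -- any sign.
  refine ⟨(hφm.comp measurable_br).mul (measurable_cut K), |φ (1 + K)|, fun ξ => ?_⟩
  simp only [cut]
  split_ifs with h
  · rw [mul_one, abs_of_nonneg (hφ.nonneg _ (one_le_br ξ))]
    refine (hφ.mono _ _ (one_le_br ξ) ?_).trans (le_abs_self _)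
    simp only [br]; linarith
  · simp

theorem isWeight_id : IsWeight (fun r => r) :=
  ⟨fun _ h => by linarith, fun _ _ _ h => h, fun q r _ _ => by linarith⟩

/-- The multiplier `(1 + |ξ|) 1_{|ξ| ≤ K}`. -/
def brCut (K : ℝ) (ξ : Space n) : ℝ := br ξ * cut K ξ

theorem isMult_brCut (K : ℝ) : IsMult (brCut K : Space n → ℝ) :=
  isMult_weight isWeight_id measurable_id K

variable {c : Space n → Space n} {C s : ℝ} {N : L2C n →L[ℝ] L2C n →L[ℝ] L2C n}

theorem mulLp_weight_congr {φ : ℝ → ℝ} (hφ : IsWeight φ) (hφm : Measurable φ) {K : ℝ} {V : L2C n}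
    (hV : mulLp (cut K) (isMult_cut K) V = V) :
    mulLp _ (isMult_weight hφ hφm K) V =ᵐ[volume] fun ξ => (φ (br ξ) : ℂ) * V ξ := by
  filter_upwards [coeFn_mulLp (isMult_weight hφ hφm K) V, coeFn_mulLp (isMult_cut K) V]
    with ξ h1 h2
  rw [hV] at h2
  rw [h1]
  nth_rewrite 2 [h2]
  push_cast; ring

/-- The energy estimate for the truncated equation. -/
theorem IsVel.galerkin_energy (hc : IsVel c C) (hs : (n : ℝ) / 2 + 1 < s)
    (hN : ∀ V W k : L2C n, inner ℂ k (N V W) = tri (baseSym c s) V W k)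
    {φ : ℝ → ℝ} (hφ : IsWeight φ) (hφm : Measurable φ) {K : ℝ} {V : L2C n}
    (hV : mulLp (cut K) (isMult_cut K) V = V) (hVh : conjRefl V = V) :
    |(inner ℂ (mulLp _ (isMult_weight hφ hφm K) V)
      (mulLp _ (isMult_weight hφ hφm K) (mulLp (brCut K) (isMult_brCut K) (N V V)))).re| ≤
      energyConst n C s * ‖V‖ * ‖mulLp _ (isMult_weight hφ hφm K) V‖ ^ 2 := by
  have hM := isMult_weight (n := n) hφ hφm K
  have hZ := mulLp_weight_congr hφ hφm hV
  have hZ2 : MemLp (fun ξ => (φ (br ξ) : ℂ) * V ξ) 2 volume :=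
    (memLp_congr_ae hZ).1 (Lp.memLp _)
  have hV' : V =ᵐ[volume] fun ξ => (cut K ξ : ℂ) * V ξ := by
    have h := coeFn_mulLp (isMult_cut K) V
    rw [hV] at h; exact h
  have hZ1 : MemLp (fun ξ => (br ξ : ℂ) * ((φ (br ξ) : ℂ) * V ξ)) 2 volume := by
    refine (memLp_congr_ae ?_).1 ((isMult_brCut K).memLp (Lp.memLp (mulLp _ hM V)))
    filter_upwards [coeFn_mulLp hM V, hV'] with ξ h1 h2
    rw [h1]
    nth_rewrite 2 [h2]
    have := cut_mul_cut (le_refl K) ξ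
    have hcc : (cut K ξ : ℂ) * cut K ξ = cut K ξ := by exact_mod_cast this
    simp only [brCut]
    push_cast
    linear_combination ((br ξ : ℂ) * φ (br ξ) * V ξ) * hcc
  have key := hc.energy_estimate hs hφ hφm (Lp.memLp V) ((conjRefl_eq_iff V).1 hVh) hZ2 hZ1
  have hn : lpNorm (fun ξ => (φ (br ξ) : ℂ) * V ξ) 2 volume = ‖mulLp _ hM V‖ := by
    rw [← toReal_eLpNorm hZ2.1, Lp.norm_def, eLpNorm_congr_ae hZ]
  rw [lpNorm_coeFn, hn] at key
  convert key using 3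
  -- All multipliers are moved to the test function and from there into the symbol. The cutoffs are
  -- idempotent and are absorbed by the frequency support of V.
  rw [inner_mulLp, inner_mulLp, hN, tri_mulLp, tri_mulLp]
  have hZc : mulLp _ hM V =ᵐ[volume] fun ξ => ((φ (br ξ) * cut K ξ : ℝ) : ℂ) * V ξ :=
    coeFn_mulLp hM V
  have hZd : (fun ξ => (φ (br ξ) : ℂ) * V ξ) =ᵐ[volume]
      fun ξ => ((φ (br ξ) * cut K ξ : ℝ) : ℂ) * V ξ := hZ.symm.trans hZc
  rw [tri_congr (ae_eq_refl _) (ae_eq_refl _) hZc, tri_congr (ae_eq_refl _) (ae_eq_refl _) hZd,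
    tri, tri]
  congr 1; ext p
  have := cut_mul_cut (le_refl K) p.1
  have hcc : (cut K p.1 : ℂ) * cut K p.1 = cut K p.1 := by exact_mod_cast this
  simp only [brCut, map_mul, Complex.conj_ofReal]
  push_cast
  linear_combination ((φ (br p.1) : ℂ) * br p.1 * baseSym c s p.1 p.2 * (V (p.1 - p.2) * V p.2 *
    (φ (br p.1) * (starRingEnd ℂ) (V p.1))) * (1 + cut K p.1)) * hcc

theorem mulLp_cut_brCut (K : ℝ) (U : L2C n) :
    mulLp (cut K) (isMult_cut K) (mulLp (brCut K) (isMult_brCut K) U) =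
      mulLp (brCut K) (isMult_brCut K) U := by
  rw [mulLp_mulLp]
  refine mulLp_congr _ _ (Eventually.of_forall fun ξ => ?_)
  have := cut_mul_cut (le_refl K) ξ
  congr 2
  simp only [brCut]
  linear_combination br ξ * this

theorem norm_mulLp_cut_le (K : ℝ) (U : L2C n) : ‖mulLp (cut K) (isMult_cut K) U‖ ≤ ‖U‖ := by
  simpa using norm_mulLp_le (isMult_cut K) (abs_cut_le K) U

theorem energyConst_nonneg (hs : (n : ℝ) / 2 + 1 < s) (hC : 0 ≤ C) : 0 ≤ energyConst n C s := by
  have hn : (0 : ℝ) ≤ n := by positivity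
  have : 0 ≤ s := by linarith
  have h : 0 ≤ lpNorm (fun ξ : Space n => br ξ ^ (-(s - 1))) 2 volume := lpNorm_nonneg
  unfold energyConst
  positivity

/-- Solutions of the truncated equation, with bounds that do not depend on the truncation. -/
theorem IsVel.exists_galerkin (hc : IsVel c C) (hs : (n : ℝ) / 2 + 1 < s)
    (hN : ∀ V W k : L2C n, inner ℂ k (N V W) = tri (baseSym c s) V W k)
    {R T : ℝ} (hR : 0 < R) (hT : 0 ≤ T) (hRT : 4 * energyConst n C s * R * T ≤ 1)
    {V₀ : L2C n} (hV₀ : conjRefl V₀ = V₀) (hV₀R : ‖V₀‖ ≤ R) (K : ℝ) :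
    ∃ V : ℝ → L2C n, V 0 = mulLp (cut K) (isMult_cut K) V₀ ∧ ∀ t ∈ Icc 0 T,
      HasDerivWithinAt V (-(mulLp (brCut K) (isMult_brCut K) (N (V t) (V t)))) (Icc 0 T) t ∧
      mulLp (cut K) (isMult_cut K) (V t) = V t ∧ conjRefl (V t) = V t ∧ ‖V t‖ ≤ 2 * R ∧
      ∀ (φ : ℝ → ℝ) (hφ : IsWeight φ) (hφm : Measurable φ),
        ‖mulLp _ (isMult_weight hφ hφm K) (V t)‖ ≤ 2 * ‖mulLp _ (isMult_weight hφ hφm K) V₀‖ := by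
  have hR2 : 0 < 2 * R := by linarith
  set P := mulLp (cut K : Space n → ℝ) (isMult_cut K) with hP
  set M := mulLp (brCut K : Space n → ℝ) (isMult_brCut K) with hM
  -- Retracting to radius 2R makes the quadratic field bounded and globally Lipschitz. The a priori
  -- bound shows at the end that the retraction never acts.
  let F : L2C n → L2C n := fun V => -(M (N (retr (2 * R) V) (retr (2 * R) V)))
  have hFb : ∀ V, ‖F V‖ ≤ (‖M‖₊ * (‖N‖₊ * (2 * R).toNNReal * (2 * R).toNNReal) : ℝ≥0) := by
    intro V
    have h1 := norm_retr_le hR2 V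
    simp only [F, norm_neg, NNReal.coe_mul, coe_nnnorm, Real.coe_toNNReal _ hR2.le]
    refine (M.le_opNorm _).trans (mul_le_mul_of_nonneg_left ?_ (norm_nonneg _))
    refine (N.le_opNorm₂ _ _).trans ?_
    gcongr
  -- 8R counts two terms, each with one argument of norm at most 2R and one difference, for which
  -- the retraction costs a factor 2.
  have hFl : LipschitzWith (‖M‖₊ * (‖N‖₊ * (8 * R).toNNReal)) F := by
    refine LipschitzWith.of_dist_le_mul fun V W => ?_
    rw [dist_eq_norm, dist_eq_norm]
    set v := retr (2 * R) V with hv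
    set w := retr (2 * R) W with hw
    have e : F V - F W = -(M (N v (v - w) + N (v - w) w)) := by
      simp only [F, map_sub, sub_apply, ← hv, ← hw, map_add]
      abel
    have h1 := norm_retr_le hR2 V
    have h2 := norm_retr_le hR2 W
    have h3 := norm_retr_sub_le hR2 V W
    rw [← hv] at h1 h3
    rw [← hw] at h2 h3
    rw [e, norm_neg]
    simp only [NNReal.coe_mul, coe_nnnorm, Real.coe_toNNReal _ (by linarith : 0 ≤ 8 * R)]
    rw [mul_assoc]
    refine (M.le_opNorm _).trans (mul_le_mul_of_nonneg_left ?_ (norm_nonneg _))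
    refine (norm_add_le _ _).trans ((add_le_add (N.le_opNorm₂ _ _) (N.le_opNorm₂ _ _)).trans ?_)
    calc ‖N‖ * ‖v‖ * ‖v - w‖ + ‖N‖ * ‖v - w‖ * ‖w‖
        ≤ ‖N‖ * (2 * R) * (2 * ‖V - W‖) + ‖N‖ * (2 * ‖V - W‖) * (2 * R) := by gcongr
      _ = _ := by ring
  obtain ⟨V, hV0, hVd⟩ := exists_solution_of_bounded_lipschitz hFb hFl hT (P V₀)
  have hVc : ContinuousOn V (Icc 0 T) := fun t ht => (hVd t ht).continuousWithinAt
  have hVr : ∀ t ∈ Ico 0 T, HasDerivWithinAt V (F (V t)) (Ici t) t := fun t ht =>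
    hasDerivWithinAt_Ici_of_Icc ht (hVd t (Ico_subset_Icc_self ht))
  have hPP : P (P V₀) = P V₀ := by
    rw [hP, mulLp_mulLp]
    refine mulLp_congr _ _ (Eventually.of_forall fun ξ => ?_)
    rw [cut_mul_cut le_rfl]
  -- The field takes values in the range of the cutoff, so PV - V has zero derivative and vanishes
  -- initially.
  have hPV : ∀ t ∈ Icc 0 T, P (V t) = V t := by
    intro t ht
    have hd : ∀ t ∈ Ico 0 T, HasDerivWithinAt (fun t => P (V t) - V t) 0 (Ici t) t := by
      intro t ht
      have h1 := (P.hasFDerivAt.comp_hasDerivWithinAt t (hVr t ht)).sub (hVr t ht)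
      have h2 : P (F (V t)) - F (V t) = 0 := by
        simp only [F, map_neg, hP, hM, mulLp_cut_brCut, sub_self]
      rw [h2] at h1
      exact h1
    have h := constant_of_has_deriv_right_zero
      ((P.continuous.comp_continuousOn hVc).sub hVc) hd t ht
    simp only [Function.comp_def, Pi.sub_apply, hV0, hPP, sub_self] at h
    exact sub_eq_zero.1 h
  have hJF : ∀ W, conjRefl (F W) = F (conjRefl W) := by
    intro W
    have h1 : conjRefl (retr (2 * R) W) = retr (2 * R) (conjRefl W) := by
      rw [retr, retr, map_smul, norm_conjRefl]
    simp only [F, map_neg, hM]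
    rw [conjRefl_mulLp _ (fun ξ => by simp only [brCut, br_neg, cut_neg]),
      conjRefl_bilinear hc.baseSym_neg hN, h1]
  -- The reflected curve solves the same equation with the same datum, and ODE uniqueness makes V
  -- Hermitian.
  have hJV : ∀ t ∈ Icc 0 T, conjRefl (V t) = V t := by
    have h := ODE_solution_unique_of_mem_Icc_right (v := fun _ => F) (s := fun _ => univ)
      (f := fun t => conjRefl (V t)) (g := V) (a := 0) (b := T)
      (fun t _ => hFl.lipschitzOnWith) (conjRefl.continuous.comp_continuousOn hVc)
      (fun t ht => by
        have h1 := conjRefl.hasFDerivAt.comp_hasDerivWithinAt t (hVr t ht)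
        rw [hJF] at h1
        exact h1) (fun _ _ => trivial) hVc hVr (fun _ _ => trivial)
      (by rw [hV0, hP, conjRefl_mulLp _ (cut_neg K), hV₀])
    exact h
  have hCe := energyConst_nonneg hs hc.const_nonneg
  have hE : ∀ t ∈ Icc 0 T, ∀ (φ : ℝ → ℝ) (hφ : IsWeight φ) (hφm : Measurable φ),
      ‖mulLp _ (isMult_weight hφ hφm K) (V t)‖ ≤ 2 * ‖mulLp _ (isMult_weight hφ hφm K) V₀‖ := by
    intro t ht φ hφ hφm
    set Q := mulLp _ (isMult_weight (n := n) hφ hφm K) with hQ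
    have hbound : ∀ t ∈ Ico 0 T, 2 * (inner ℂ (Q (V t)) (Q (F (V t)))).re ≤
        (4 * energyConst n C s * R) * ‖Q (V t)‖ ^ 2 + 0 := by
      intro t ht
      have h1 := hc.galerkin_energy hs hN hφ hφm (hPV t (Ico_subset_Icc_self ht))
        (hJV t (Ico_subset_Icc_self ht))
      rw [← hQ] at h1
      set lam := 2 * R / max (2 * R) ‖V t‖ with hlam
      have hmx : 0 < max (2 * R) ‖V t‖ := lt_max_of_lt_left hR2
      have hl0 : 0 ≤ lam := by positivity
      have hl1 : lam ≤ 1 := (div_le_one hmx).2 (le_max_left _ _)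
      have hl2 : lam * ‖V t‖ ≤ 2 * R := by
        have := norm_retr_le hR2 (V t)
        rwa [retr, norm_smul, Real.norm_of_nonneg hl0] at this
      -- The retraction only multiplies the quadratic term by λ². One λ turns ‖V‖ into at most 2R
      -- and the other is at most 1, so the energy estimate closes before any bound on V is known.
      have hF : F (V t) = -((lam * lam) • M (N (V t) (V t))) := by
        simp only [F, retr, ← hlam, map_smul, smul_apply, smul_smul]
      rw [hF, map_neg, map_smul, inner_neg_right, inner_smul_right_eq_smul, Complex.neg_re,
        Complex.real_smul, Complex.re_ofReal_mul]
      have h2 := (abs_le.1 h1).1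
      have h3 : -(lam * lam * (inner ℂ (Q (V t)) (Q (M (N (V t) (V t))))).re) ≤
          lam * lam * (energyConst n C s * ‖V t‖ * ‖Q (V t)‖ ^ 2) := by
        rw [← mul_neg]
        refine mul_le_mul_of_nonneg_left ?_ (by positivity)
        linarith
      have h4 : lam * lam * (energyConst n C s * ‖V t‖ * ‖Q (V t)‖ ^ 2) ≤
          1 * (2 * R) * (energyConst n C s * ‖Q (V t)‖ ^ 2) := by
        have : lam * lam * (energyConst n C s * ‖V t‖ * ‖Q (V t)‖ ^ 2) =
          lam * (lam * ‖V t‖) * (energyConst n C s * ‖Q (V t)‖ ^ 2) := by ring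
        rw [this]
        gcongr
      nlinarith
    have h := norm_sq_le_gronwallBound (Z := fun t => Q (V t)) (Z' := fun t => Q (F (V t)))
      (Q.continuous.comp_continuousOn hVc)
      (fun t ht => Q.hasFDerivAt.comp_hasDerivWithinAt t (hVr t ht)) hbound t ht
    rw [gronwallBound_ε0] at h
    have hQ0 : Q (V 0) = Q V₀ := by
      rw [hV0, hQ, hP, mulLp_mulLp]
      refine mulLp_congr _ _ (Eventually.of_forall fun ξ => ?_)
      congr 2
      rw [mul_assoc, cut_mul_cut le_rfl]
    -- The bound e ≤ 4 = 2² is the factor 2 in the statement, after taking square roots.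
    have hexp : Real.exp (4 * energyConst n C s * R * t) ≤ 4 := by
      have h1 : 4 * energyConst n C s * R * t ≤ 1 :=
        (mul_le_mul_of_nonneg_left ht.2 (by positivity)).trans hRT
      have h2 := Real.exp_le_exp.2 h1
      have h3 := Real.exp_one_lt_d9
      linarith
    simp only [hQ0] at h
    refine abs_le_of_sq_le_sq' ?_ (by positivity) |>.2
    nlinarith [sq_nonneg ‖Q V₀‖]
  refine ⟨V, hV0, fun t ht => ?_⟩
  have hVt : ‖V t‖ ≤ 2 * R := by
    -- The trivial weight gives the unweighted bound that makes the retraction inactive.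
    have h := hE t ht (fun _ => 1) isWeight_one measurable_const
    have e : ∀ W, mulLp _ (isMult_weight (n := n) isWeight_one measurable_const K) W = P W :=
      fun W => mulLp_congr _ _ (Eventually.of_forall fun ξ => by simp)
    rw [e, e, hPV t ht] at h
    have := norm_mulLp_cut_le K V₀
    linarith
  refine ⟨?_, hPV t ht, hJV t ht, hVt, hE t ht⟩
  have h := hVd t ht
  simp only [F, retr_of_norm_le hR2 hVt] at h
  exact h

end Galerkin

/-! ### Difference estimates -/

section Difference

variable {n : ℕ} {c : Space n → Space n} {C s : ℝ} {N : L2C n →L[ℝ] L2C n →L[ℝ] L2C n}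

/-- The `L²` norm of the weight that dominates the symbol. -/
def decayNorm (n : ℕ) (s : ℝ) : ℝ := lpNorm (fun ξ : Space n => br ξ ^ (-(s - 1))) 2 volume

theorem decayNorm_nonneg (n : ℕ) (s : ℝ) : 0 ≤ decayNorm n s := lpNorm_nonneg

/-- Multiplication by `(1 + |ξ|) ^ (-σ)`. -/
def lower (n : ℕ) (σ : ℝ) (hσ : 0 ≤ σ) : L2C n →L[ℝ] L2C n :=
  mulLp (fun ξ => br ξ ^ (-σ)) (isMult_br_rpow (neg_nonpos.2 hσ))

theorem coeFn_lower {σ : ℝ} (hσ : 0 ≤ σ) (V : L2C n) :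
    lower n σ hσ V =ᵐ[volume] fun ξ => ((br ξ ^ (-σ) : ℝ) : ℂ) * V ξ := coeFn_mulLp _ V

theorem lower_injective {σ : ℝ} (hσ : 0 ≤ σ) : Function.Injective (lower n σ hσ) := by
  intro V W h
  refine Lp.ext ?_
  have h1 := coeFn_lower hσ V
  rw [h] at h1
  filter_upwards [h1, coeFn_lower hσ W] with ξ e1 e2
  have : ((br ξ ^ (-σ) : ℝ) : ℂ) ≠ 0 := by
    exact_mod_cast (Real.rpow_pos_of_pos (br_pos ξ) _).ne'
  exact mul_left_cancel₀ this (e1.symm.trans e2)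

/-- Removing the outer factor (1+|ξ|)^(s-1) leaves the plain form of u·∇, evaluated on unweighted
Fourier transforms; this is the level at which differences are estimated. -/
theorem inner_lower_bilinear (hs : 0 ≤ s - 1)
    (hN : ∀ V W k : L2C n, inner ℂ k (N V W) = tri (baseSym c s) V W k) (V W k : L2C n) :
    inner ℂ k (lower n (s - 1) hs (N V W)) = tri (qsym c) (fun ξ => ((br ξ ^ (-s) : ℝ) : ℂ) * V ξ)
      (fun ξ => ((br ξ ^ (-s) : ℝ) : ℂ) * W ξ) k := by
  rw [lower, inner_mulLp, hN, tri_mulLp, tri, tri]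
  congr 1; ext p
  have h : br p.1 ^ (-(s - 1)) * br p.1 ^ (s - 1) = 1 := by rw [br_rpow_mul]; simp
  have h' : br p.1 ^ (-(s - 1)) * baseSym c s p.1 p.2 =
      qsym c p.1 p.2 * (br (p.1 - p.2) ^ (-s) * br p.2 ^ (-s)) := by
    rw [baseSym, ← mul_assoc, h, one_mul]
  rw [h']; push_cast; ring

/-- The `L²` energy estimate for differences of solutions. -/
theorem IsVel.difference_energy (hc : IsVel c C) (hs : (n : ℝ) / 2 + 1 < s) (hs0 : 0 ≤ s)
    (hs1 : 0 ≤ s - 1)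
    (hN : ∀ V W k : L2C n, inner ℂ k (N V W) = tri (baseSym c s) V W k)
    (D V W : L2C n) (hW : conjRefl W = W) :
    |(inner ℂ (lower n s hs0 D) (lower n (s - 1) hs1 (N D V + N W D))).re| ≤
      C * decayNorm n s * (‖V‖ + ‖W‖) * ‖lower n s hs0 D‖ ^ 2 := by
  have hC := hc.const_nonneg
  have mD := isMult_br_rpow (n := n) (neg_nonpos.2 hs0)
  have hd : MemLp (fun ξ => ((br ξ ^ (-s) : ℝ) : ℂ) * D ξ) 2 volume := mD.memLp (Lp.memLp D)
  have hdn : lpNorm (fun ξ => ((br ξ ^ (-s) : ℝ) : ℂ) * D ξ) 2 volume = ‖lower n s hs0 D‖ :=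
    (norm_mulLp_eq mD D).symm
  have hd1 : MemLp (fun ξ => (br ξ : ℂ) * (((br ξ ^ (-s) : ℝ) : ℂ) * D ξ)) 2 volume := by
    have h := (isMult_br_rpow (n := n) (neg_nonpos.2 hs1)).memLp (Lp.memLp D)
    refine (memLp_congr_ae (Eventually.of_forall fun ξ => ?_)).1 h
    rw [← mul_assoc, ← Complex.ofReal_mul, br_mul_rpow]
    congr 4; ring
  have hsm : ∀ U : L2C n, AEStronglyMeasurable (fun ξ => ((br ξ ^ (-s) : ℝ) : ℂ) * U ξ) volume :=
    fun U => (mD.memLp (Lp.memLp U)).1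
  obtain ⟨mV, nV⟩ := memLp_br_mul hs (Lp.memLp V)
  obtain ⟨mW, nW⟩ := memLp_br_mul hs (Lp.memLp W)
  rw [lpNorm_coeFn] at nV nW
  -- In N D V the difference generates the velocity and the gradient falls on the regular V, so no
  -- derivative is lost. In N W D the difference is transported by a regular real velocity, and
  -- symmetrization applies.
  have t1 := hc.norm_tri_le hd (hsm V) mV (Lp.memLp (lower n s hs0 D))
  rw [hdn, lpNorm_coeFn] at t1
  have t2 := (hc.abs_re_tri_le (((conjRefl_eq_iff W).1 hW).mul_real
    (m := fun ξ => br ξ ^ (-s)) (fun ξ => by simp only [br_neg])) mW (hsm W) hd hd1).2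
  rw [hdn] at t2
  have e2 : tri (qsym c) (fun ξ => ((br ξ ^ (-s) : ℝ) : ℂ) * W ξ)
      (fun ξ => ((br ξ ^ (-s) : ℝ) : ℂ) * D ξ) (lower n s hs0 D) =
      tri (qsym c) (fun ξ => ((br ξ ^ (-s) : ℝ) : ℂ) * W ξ)
      (fun ξ => ((br ξ ^ (-s) : ℝ) : ℂ) * D ξ) (fun ξ => ((br ξ ^ (-s) : ℝ) : ℂ) * D ξ) :=
    tri_congr (ae_eq_refl _) (ae_eq_refl _) (coeFn_lower hs0 D)
  rw [map_add, inner_add_right, inner_lower_bilinear hs1 hN, inner_lower_bilinear hs1 hN,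
    Complex.add_re, e2]
  have hsq := mul_nonneg hC (sq_nonneg ‖lower n s hs0 D‖)
  have a1 := mul_le_mul_of_nonneg_left nV hsq
  have a2 := mul_le_mul_of_nonneg_left nW hsq
  have t1' := (Complex.abs_re_le_norm _).trans t1
  refine (abs_add_le _ _).trans ((add_le_add t1' t2).trans ?_)
  change _ ≤ C * lpNorm (fun ξ : Space n => br ξ ^ (-(s - 1))) 2 volume * (‖V‖ + ‖W‖) *
    ‖lower n s hs0 D‖ ^ 2
  nlinarith

theorem lower_brCut (hs0 : 0 ≤ s) (hs1 : 0 ≤ s - 1) (K : ℝ) (U : L2C n) :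
    lower n s hs0 (mulLp (brCut K) (isMult_brCut K) U) =
      mulLp (cut K) (isMult_cut K) (lower n (s - 1) hs1 U) := by
  rw [lower, lower, mulLp_mulLp, mulLp_mulLp]
  refine mulLp_congr _ _ (Eventually.of_forall fun ξ => ?_)
  congr 2
  have : br ξ * br ξ ^ (-s) = br ξ ^ (-(s - 1)) := by rw [br_mul_rpow]; congr 1; ring
  simp only [brCut, ← this]
  ring

/-- Only frequencies above K contribute, and there (1+|ξ|)^(-σ) is at most (1+K)^(-σ). -/
theorem norm_cut_sub_lower_le {σ K L : ℝ} (hσ : 0 ≤ σ) (hK : 0 ≤ K) (hKL : K ≤ L)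
    (U : L2C n) :
    ‖mulLp (cut L) (isMult_cut L) (lower n σ hσ U) - mulLp (cut K) (isMult_cut K)
      (lower n σ hσ U)‖ ≤ (1 + K) ^ (-σ) * ‖U‖ := by
  refine Lp.norm_le_mul_norm_of_ae_le_mul ?_
  have h1K : 0 < 1 + K := by linarith
  filter_upwards [Lp.coeFn_sub (mulLp (cut L) (isMult_cut L) (lower n σ hσ U))
    (mulLp (cut K) (isMult_cut K) (lower n σ hσ U)), coeFn_mulLp (isMult_cut L) (lower n σ hσ U),
    coeFn_mulLp (isMult_cut K) (lower n σ hσ U), coeFn_lower hσ U] with ξ h1 h2 h3 h4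
  rw [h1, Pi.sub_apply, h2, h3, h4, ← sub_mul, ← Complex.ofReal_sub, norm_mul, norm_mul,
    Complex.norm_real, Complex.norm_real, Real.norm_eq_abs, Real.norm_eq_abs,
    abs_of_nonneg (br_rpow_nonneg _ _), ← mul_assoc]
  refine mul_le_mul_of_nonneg_right ?_ (norm_nonneg _)
  by_cases h : ‖ξ‖ ≤ K
  · simp only [cut, h, h.trans hKL, if_true, sub_self, abs_zero, zero_mul]
    positivity
  · have h5 : |cut L ξ - cut K ξ| ≤ 1 := by
      simp only [cut, h, if_false, sub_zero]
      split_ifs <;> simp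
    have h6 : br ξ ^ (-σ) ≤ (1 + K) ^ (-σ) := by
      refine Real.rpow_le_rpow_of_nonpos h1K ?_ (by linarith)
      simp only [br]; linarith
    calc _ ≤ 1 * br ξ ^ (-σ) := mul_le_mul_of_nonneg_right h5 (br_rpow_nonneg _ _)
      _ ≤ _ := by linarith

/-- Two Galerkin approximations are close in `L²`. -/
theorem IsVel.galerkin_difference (hc : IsVel c C) (hs : (n : ℝ) / 2 + 1 < s) (hs0 : 0 ≤ s)
    (hs1 : 0 ≤ s - 1)
    (hN : ∀ V W k : L2C n, inner ℂ k (N V W) = tri (baseSym c s) V W k)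
    {R T K L : ℝ} (hR : 0 < R) (hK : 0 ≤ K) (hKL : K ≤ L) {V₀ : L2C n}
    (hV₀ : ‖V₀‖ ≤ R) {V W : ℝ → L2C n}
    (hV0 : V 0 = mulLp (cut K) (isMult_cut K) V₀) (hW0 : W 0 = mulLp (cut L) (isMult_cut L) V₀)
    (hV : ∀ t ∈ Icc 0 T,
      HasDerivWithinAt V (-(mulLp (brCut K) (isMult_brCut K) (N (V t) (V t)))) (Icc 0 T) t ∧
      mulLp (cut K) (isMult_cut K) (V t) = V t ∧ ‖V t‖ ≤ 2 * R)
    (hW : ∀ t ∈ Icc 0 T,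
      HasDerivWithinAt W (-(mulLp (brCut L) (isMult_brCut L) (N (W t) (W t)))) (Icc 0 T) t ∧
      mulLp (cut L) (isMult_cut L) (W t) = W t ∧ conjRefl (W t) = W t ∧ ‖W t‖ ≤ 2 * R) :
    ∀ t ∈ Icc 0 T, ‖lower n s hs0 (W t - V t)‖ ^ 2 ≤ ((1 + K) ^ (-(s - 1))) ^ 2 *
      ((R ^ 2 + (‖N‖ * (2 * R) ^ 2) ^ 2) * Real.exp ((8 * C * decayNorm n s * R + 1) * T)) := by
  set ε := (1 + K) ^ (-(s - 1)) with hε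
  set B := ‖N‖ * (2 * R) ^ 2 with hB
  -- The factor 8R is twice the bound 4R for ‖V‖ + ‖W‖. The extra 1 comes from splitting the error
  -- term by 2xy ≤ x² + y², and makes division by a in Grönwall's bound harmless.
  set a := 8 * C * decayNorm n s * R + 1 with ha
  have hε0 : 0 ≤ ε := by positivity
  have hC := hc.const_nonneg
  have hdn := decayNorm_nonneg n s
  have ha1 : 1 ≤ a := by
    have : 0 ≤ 8 * C * decayNorm n s * R := by positivity
    linarith
  set S := lower n s hs0 with hS
  set Z' : ℝ → L2C n := fun t => S (-(mulLp (brCut L) (isMult_brCut L) (N (W t) (W t))) -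
    -(mulLp (brCut K) (isMult_brCut K) (N (V t) (V t)))) with hZ'
  have hcont : ContinuousOn (fun t => S (W t - V t)) (Icc 0 T) :=
    S.continuous.comp_continuousOn
      (ContinuousOn.sub (fun t ht => (hW t ht).1.continuousWithinAt)
        (fun t ht => (hV t ht).1.continuousWithinAt))
  have hder : ∀ t ∈ Ico 0 T, HasDerivWithinAt (fun t => S (W t - V t)) (Z' t) (Ici t) t := by
    intro t ht
    have ht' := Ico_subset_Icc_self ht
    exact S.hasFDerivAt.comp_hasDerivWithinAt t
      ((hasDerivWithinAt_Ici_of_Icc ht (hW t ht').1).sub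
        (hasDerivWithinAt_Ici_of_Icc ht (hV t ht').1))
  have hbound : ∀ t ∈ Ico 0 T, 2 * (inner ℂ (S (W t - V t)) (Z' t)).re ≤
      a * ‖S (W t - V t)‖ ^ 2 + (ε * B) ^ 2 := by
    intro t ht
    obtain ⟨-, pV, nV⟩ := hV t (Ico_subset_Icc_self ht)
    obtain ⟨-, pW, jW, nW⟩ := hW t (Ico_subset_Icc_self ht)
    set D := W t - V t with hD
    set PL := mulLp (cut L : Space n → ℝ) (isMult_cut L) with hPL
    set PK := mulLp (cut K : Space n → ℝ) (isMult_cut K) with hPK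
    set A := lower n (s - 1) hs1 with hA
    have hPV : PL (V t) = V t := by
      rw [← pV, hPL, hPK, mulLp_mulLp]
      refine mulLp_congr _ _ (Eventually.of_forall fun ξ => ?_)
      rw [cut_mul_cut hKL]
    have hPD : PL (S D) = S D := by
      have h1 : PL (S D) = S (PL D) := by
        rw [hPL, hS, lower, mulLp_mulLp, mulLp_mulLp]
        refine mulLp_congr _ _ (Eventually.of_forall fun ξ => ?_)
        rw [mul_comm (cut L ξ)]
      rw [h1, hD, map_sub PL, pW, hPV]
    -- The second bracket is the consistency error: the two truncations act differently on the same
    -- nonlinearity N(V,V). It is small because A gains s - 1 powers.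
    have e : Z' t = -(PL (A (N D (V t) + N (W t) D))) -
        (PL (A (N (V t) (V t))) - PK (A (N (V t) (V t)))) := by
      have h1 : N (W t) (W t) = N D (V t) + N (W t) D + N (V t) (V t) := by
        simp only [hD, map_sub, sub_apply]
        abel
      simp only [hZ', map_sub, map_neg, hS]
      rw [lower_brCut hs0 hs1, lower_brCut hs0 hs1, h1, map_add, map_add]
      abel
    have h1 := hc.difference_energy hs hs0 hs1 hN D (V t) (W t) jW
    have h2 := norm_cut_sub_lower_le hs1 hK hKL (N (V t) (V t))
    have h3 : ‖N (V t) (V t)‖ ≤ B := by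
      refine (N.le_opNorm₂ _ _).trans ?_
      rw [hB, mul_assoc, sq]
      gcongr
    have h4 : ‖PL (A (N (V t) (V t))) - PK (A (N (V t) (V t)))‖ ≤ ε * B :=
      h2.trans (mul_le_mul_of_nonneg_left h3 hε0)
    have h5 : -(inner ℂ (S D) (PL (A (N (V t) (V t))) - PK (A (N (V t) (V t))))).re ≤
        ‖S D‖ * (ε * B) :=
      (neg_le_abs _).trans ((Complex.abs_re_le_norm _).trans ((norm_inner_le_norm _ _).trans
        (mul_le_mul_of_nonneg_left h4 (norm_nonneg _))))
    have h6 : C * decayNorm n s * (‖V t‖ + ‖W t‖) * ‖S D‖ ^ 2 ≤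
        C * decayNorm n s * (4 * R) * ‖S D‖ ^ 2 := by
      gcongr; linarith
    have h7 := (neg_le_abs _).trans h1
    rw [e, inner_sub_right, inner_neg_right, hPL, inner_mulLp, ← hPL, hPD, Complex.sub_re,
      Complex.neg_re]
    have h8 : 2 * (‖S D‖ * (ε * B)) ≤ ‖S D‖ ^ 2 + (ε * B) ^ 2 := by
      nlinarith [sq_nonneg (‖S D‖ - ε * B)]
    rw [ha]
    linarith
  intro t ht
  have h := norm_sq_le_gronwallBound hcont hder hbound t ht
  rw [gronwallBound_of_K_ne_0 (by linarith)] at h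
  have h0 : ‖S (W 0 - V 0)‖ ≤ ε * R := by
    have h1 := norm_cut_sub_lower_le hs0 hK hKL V₀
    have h2 : S (W 0 - V 0) = mulLp (cut L) (isMult_cut L) (lower n s hs0 V₀) -
        mulLp (cut K) (isMult_cut K) (lower n s hs0 V₀) := by
      rw [hW0, hV0, map_sub, hS]
      congr 1 <;>
      · rw [lower, mulLp_mulLp, mulLp_mulLp]
        refine mulLp_congr _ _ (Eventually.of_forall fun ξ => ?_)
        rw [mul_comm (cut _ ξ)]
    rw [h2]
    refine h1.trans (mul_le_mul ?_ hV₀ (norm_nonneg _) hε0)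
    exact Real.rpow_le_rpow_of_exponent_le (by linarith) (by linarith)
  have h1 : ‖S (W 0 - V 0)‖ ^ 2 ≤ (ε * R) ^ 2 := pow_le_pow_left₀ (norm_nonneg _) h0 2
  have h2 : Real.exp (a * t) ≤ Real.exp (a * T) :=
    Real.exp_le_exp.2 (mul_le_mul_of_nonneg_left ht.2 (by linarith))
  have h3 : 0 < Real.exp (a * t) := Real.exp_pos _
  have h4 : (ε * B) ^ 2 / a * (Real.exp (a * t) - 1) ≤ (ε * B) ^ 2 * Real.exp (a * T) := by
    have h5 : 1 ≤ Real.exp (a * t) := Real.one_le_exp (mul_nonneg (by linarith) ht.1)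
    refine mul_le_mul (div_le_self (sq_nonneg _) ha1) (by linarith) (by linarith) (sq_nonneg _)
  refine h.trans ((add_le_add (mul_le_mul h1 h2 h3.le (sq_nonneg _)) h4).trans (le_of_eq ?_))
  ring

end Difference

/-! ### A slowly growing weight adapted to a square integrable function -/

section AdaptedWeight

variable {n : ℕ}

/-- The truncated linear weight `min 1 (r / ρ)`. -/
def ramp (ρ r : ℝ) : ℝ := min 1 (r / ρ)

theorem ramp_nonneg {ρ r : ℝ} (hρ : 0 < ρ) (hr : 0 ≤ r) : 0 ≤ ramp ρ r :=
  le_min zero_le_one (by positivity)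

theorem ramp_mono {ρ : ℝ} (hρ : 0 < ρ) : Monotone (ramp ρ) := fun q r h =>
  min_le_min_left _ (by gcongr)

theorem ramp_slow {ρ q r : ℝ} (hq : 0 ≤ q) (hqr : q ≤ r) :
    ramp ρ r * q ≤ ramp ρ q * r := by
  unfold ramp
  rcases le_total 1 (q / ρ) with h | h
  · rw [min_eq_left h, one_mul]
    calc _ ≤ 1 * q := mul_le_mul_of_nonneg_right (min_le_left _ _) hq
      _ ≤ r := by linarith
  · rw [min_eq_right h]
    calc _ ≤ r / ρ * q := mul_le_mul_of_nonneg_right (min_le_right _ _) hq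
      _ = _ := by ring

theorem isMult_ramp {ρ : ℝ} (hρ : 0 < ρ) : IsMult (fun ξ : Space n => ramp ρ (br ξ)) :=
  ⟨(ramp_mono hρ).measurable.comp measurable_br, 1, fun ξ => by
    rw [abs_of_nonneg (ramp_nonneg hρ (br_pos ξ).le)]; exact min_le_left _ _⟩

theorem norm_sq_eq_integral (V : L2C n) : ‖V‖ ^ 2 = ∫ ξ, ‖V ξ‖ ^ 2 := by
  have h : inner ℂ V V = ((∫ ξ, ‖V ξ‖ ^ 2 : ℝ) : ℂ) := by
    rw [L2.inner_def, ← integral_complex_ofReal]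
    refine integral_congr_ae (Eventually.of_forall fun ξ => ?_)
    simp only [inner_self_eq_norm_sq_to_K]
    norm_cast
  rw [inner_self_eq_norm_sq_to_K] at h
  exact Complex.ofReal_injective (by rw [← h]; norm_cast)

/-- At each fixed frequency the ramp tends to 0 as its scale grows, so dominated convergence
applies. -/
theorem exists_ramp_small (V : L2C n) {ε : ℝ} (hε : 0 < ε) (ρ₀ : ℝ) :
    ∃ ρ, ∃ hρ : 0 < ρ, ρ₀ ≤ ρ ∧ ‖mulLp _ (isMult_ramp (n := n) hρ) V‖ ≤ ε := by
  have hint : Integrable (fun ξ => ‖V ξ‖ ^ 2) :=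
    (memLp_two_iff_integrable_sq_norm (Lp.memLp V).1).1 (Lp.memLp V)
  have hlim : Tendsto (fun ρ : ℝ => ∫ ξ, ramp ρ (br ξ) ^ 2 * ‖V ξ‖ ^ 2) atTop
      (𝓝 (∫ _ : Space n, (0 : ℝ))) := by
    refine tendsto_integral_filter_of_dominated_convergence (fun ξ => ‖V ξ‖ ^ 2) ?_ ?_ hint ?_
    · filter_upwards [eventually_gt_atTop 0] with ρ hρ
      exact (((isMult_ramp (n := n) hρ).1.pow_const 2).aestronglyMeasurable).mul hint.1
    · filter_upwards [eventually_gt_atTop 0] with ρ hρ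
      refine Eventually.of_forall fun ξ => ?_
      have h0 := ramp_nonneg hρ (br_pos ξ).le
      have h1 : ramp ρ (br ξ) ≤ 1 := min_le_left _ _
      rw [Real.norm_of_nonneg (by positivity)]
      refine mul_le_of_le_one_left (by positivity) (pow_le_one₀ h0 h1)
    · refine Eventually.of_forall fun ξ => ?_
      have h1 : Tendsto (fun ρ : ℝ => ramp ρ (br ξ)) atTop (𝓝 0) := by
        have h2 : Tendsto (fun ρ : ℝ => br ξ / ρ) atTop (𝓝 0) :=
          tendsto_const_nhds.div_atTop tendsto_id
        have h3 := (tendsto_const_nhds (x := (1 : ℝ)) (f := (atTop : Filter ℝ))).min h2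
        simpa [ramp] using h3
      simpa using (h1.pow 2).mul_const (‖V ξ‖ ^ 2)
  rw [integral_zero] at hlim
  obtain ⟨ρ, h1, h2, h3⟩ := ((hlim.eventually_le_const (by positivity : 0 < ε ^ 2)).and
    ((eventually_gt_atTop 0).and (eventually_ge_atTop ρ₀))).exists
  refine ⟨ρ, h2, h3, ?_⟩
  refine abs_le_of_sq_le_sq' ?_ hε.le |>.2
  refine le_trans (le_of_eq ?_) h1
  rw [norm_sq_eq_integral]
  refine integral_congr_ae ?_
  filter_upwards [coeFn_mulLp (isMult_ramp (n := n) h2) V] with ξ h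
  rw [h, norm_mul, Complex.norm_real, Real.norm_eq_abs, mul_pow, sq_abs]

/-- Every square integrable function remains so after multiplication by some unbounded weight. -/
theorem exists_adapted_weight (V : L2C n) : ∃ φ : ℝ → ℝ, IsWeight φ ∧ Measurable φ ∧
    Tendsto φ atTop atTop ∧ MemLp (fun ξ => (φ (br ξ) : ℂ) * V ξ) 2 volume := by
  -- The weight will be a sum of ramps. Scales ρ_j ≥ 2^j make the sum finite at every r, and the
  -- bounds 2^(-j) make it square integrable against V.
  have hex := fun j : ℕ => exists_ramp_small V (ε := (1 / 2) ^ j) (by positivity) (2 ^ j)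
  choose ρ hρ hρj hρV using hex
  have hsum : ∀ r, Summable (fun j => ramp (ρ j) r) := by
    intro r
    refine Summable.of_norm_bounded (g := fun j : ℕ => |r| * (1 / 2) ^ j)
      (summable_geometric_two.mul_left |r|) ?_
    intro j
    have h1 : |r / ρ j| ≤ |r| * (1 / 2) ^ j := by
      rw [abs_div, abs_of_pos (hρ j), div_eq_mul_inv, one_div, inv_pow]
      gcongr
      exact hρj j
    refine le_trans ?_ h1
    rw [Real.norm_eq_abs]
    unfold ramp
    rcases le_total 1 (r / ρ j) with h | h
    · rw [min_eq_left h, abs_one]; exact h.trans (le_abs_self _)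
    · rw [min_eq_right h]
  set φ : ℝ → ℝ := fun r => ∑' j, ramp (ρ j) r with hφ
  have hmono : Monotone φ := fun q r h =>
    (hsum q).tsum_le_tsum (fun j => ramp_mono (hρ j) h) (hsum r)
  refine ⟨φ, ⟨fun r hr => tsum_nonneg fun j => ramp_nonneg (hρ j) (by linarith),
    fun q r _ h => hmono h, fun q r hq h => ?_⟩, hmono.measurable, ?_, ?_⟩
  · simp only [hφ]
    rw [← tsum_mul_right, ← tsum_mul_right]
    exact ((hsum r).mul_right q).tsum_le_tsum
      (fun j => ramp_slow (by linarith) h) ((hsum q).mul_right r)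
  -- Beyond the largest of the first m scales, the first m ramps all equal 1.
  · refine tendsto_atTop_atTop_of_monotone hmono fun b => ?_
    obtain ⟨m, hm⟩ := exists_nat_ge b
    obtain ⟨r, hr⟩ := (Finset.image ρ (Finset.range m)).exists_le
    refine ⟨max r 0, hm.trans ?_⟩
    have h1 : ∑ j ∈ Finset.range m, ramp (ρ j) (max r 0) = m := by
      have : ∀ j ∈ Finset.range m, ramp (ρ j) (max r 0) = 1 := by
        intro j hj
        refine min_eq_left ?_
        rw [le_div_iff₀ (hρ j), one_mul]
        exact (hr _ (Finset.mem_image_of_mem ρ hj)).trans (le_max_left _ _)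
      rw [Finset.sum_congr rfl this]; simp
    rw [← h1]
    exact (hsum _).sum_le_tsum _ fun j _ => ramp_nonneg (hρ j) (le_max_right _ _)
  · set f : ℕ → Space n → ℂ := fun m ξ => ((∑ j ∈ Finset.range m, ramp (ρ j) (br ξ) : ℝ) : ℂ) * V ξ
      with hf
    have hfe : ∀ m, f m =ᵐ[volume] (∑ j ∈ Finset.range m, mulLp _ (isMult_ramp (n := n) (hρ j)) V :
        L2C n) := by
      intro m
      induction m with
      | zero =>
        filter_upwards [Lp.coeFn_zero ℂ 2 (volume : Measure (Space n))] with ξ h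
        rw [Finset.sum_range_zero, h]
        simp [hf]
      | succ m ih =>
        rw [Finset.sum_range_succ]
        filter_upwards [ih, Lp.coeFn_add (∑ j ∈ Finset.range m,
          mulLp _ (isMult_ramp (n := n) (hρ j)) V) (mulLp _ (isMult_ramp (n := n) (hρ m)) V),
          coeFn_mulLp (isMult_ramp (n := n) (hρ m)) V] with ξ h1 h2 h3
        rw [h2, Pi.add_apply, ← h1, h3]
        simp only [hf, Finset.sum_range_succ]
        push_cast; ring
    have hfn : ∀ m, eLpNorm (f m) 2 volume ≤ ENNReal.ofReal 2 := by
      intro m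
      rw [eLpNorm_congr_ae (hfe m), ← ENNReal.ofReal_toReal (Lp.eLpNorm_ne_top _)]
      refine ENNReal.ofReal_le_ofReal ?_
      rw [← Lp.norm_def]
      refine (norm_sum_le _ _).trans ?_
      refine (Finset.sum_le_sum fun j _ => hρV j).trans ?_
      refine (summable_geometric_two.sum_le_tsum _ fun j _ => by positivity).trans (le_of_eq ?_)
      exact tsum_geometric_two
    have hfm : ∀ m, AEStronglyMeasurable (f m) volume := fun m =>
      (Lp.aestronglyMeasurable _).congr (hfe m).symm
    have hmeas : AEStronglyMeasurable (fun ξ => (φ (br ξ) : ℂ) * V ξ) volume :=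
      (Complex.measurable_ofReal.comp
        (hmono.measurable.comp measurable_br)).aestronglyMeasurable.mul (Lp.memLp V).1
    refine ⟨hmeas, ?_⟩
    -- Fatou's lemma: the partial sums have L² norm at most Σ 2^(-j) = 2.
    have hl := Lp.eLpNorm_lim_le_liminf_eLpNorm (p := 2) hfm (fun ξ => (φ (br ξ) : ℂ) * V ξ)
      (Eventually.of_forall fun ξ => by
        have h1 := (hsum (br ξ)).hasSum.tendsto_sum_nat
        exact ((Complex.continuous_ofReal.tendsto _).comp h1).mul_const (V ξ))
    refine hl.trans_lt (lt_of_le_of_lt ?_ (ENNReal.ofReal_lt_top (r := 2)))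
    exact liminf_le_of_le (by isBoundedDefault) fun b hb => by
      obtain ⟨m, hm⟩ := hb.exists
      exact hm.trans (hfn m)

end AdaptedWeight

/-! ### Existence on the Fourier side -/

section Existence

variable {n : ℕ} {c : Space n → Space n} {C s : ℝ} {N : L2C n →L[ℝ] L2C n →L[ℝ] L2C n}

theorem tendsto_cut (U : L2C n) :
    Tendsto (fun j : ℕ => mulLp (cut (j : ℝ)) (isMult_cut j) U) atTop (𝓝 U) := by
  have hint : Integrable (fun ξ => ‖U ξ‖ ^ 2) :=
    (memLp_two_iff_integrable_sq_norm (Lp.memLp U).1).1 (Lp.memLp U)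
  have hlim : Tendsto (fun j : ℕ => ∫ ξ, (cut j ξ - 1) ^ 2 * ‖U ξ‖ ^ 2) atTop
      (𝓝 (∫ _ : Space n, (0 : ℝ))) := by
    refine tendsto_integral_of_dominated_convergence (fun ξ => ‖U ξ‖ ^ 2) ?_ hint ?_ ?_
    · exact fun j => ((((measurable_cut (n := n) j).sub_const 1).pow_const
        2).aestronglyMeasurable).mul hint.1
    · refine fun j => Eventually.of_forall fun ξ => ?_
      rw [Real.norm_of_nonneg (by positivity)]
      refine mul_le_of_le_one_left (by positivity) ?_
      unfold cut; split_ifs <;> norm_num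
    · refine Eventually.of_forall fun ξ => ?_
      refine tendsto_const_nhds.congr' ?_
      obtain ⟨m, hm⟩ := exists_nat_ge ‖ξ‖
      filter_upwards [eventually_ge_atTop m] with j hj
      have : ‖ξ‖ ≤ j := hm.trans (by exact_mod_cast hj)
      simp [cut, this]
  rw [integral_zero] at hlim
  rw [tendsto_iff_norm_sub_tendsto_zero]
  have h : ∀ j : ℕ, ‖mulLp (cut (j : ℝ)) (isMult_cut j) U - U‖ =
      √(∫ ξ, (cut j ξ - 1) ^ 2 * ‖U ξ‖ ^ 2) := by
    intro j
    rw [eq_comm, Real.sqrt_eq_iff_eq_sq (integral_nonneg fun ξ => by positivity) (norm_nonneg _),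
      norm_sq_eq_integral]
    refine integral_congr_ae ?_
    filter_upwards [Lp.coeFn_sub (mulLp (cut (j : ℝ)) (isMult_cut j) U) U,
      coeFn_mulLp (isMult_cut (n := n) j) U] with ξ h1 h2
    rw [h1, Pi.sub_apply, h2, ← sub_one_mul, norm_mul, mul_pow]
    congr 1
    rw [← Complex.ofReal_one, ← Complex.ofReal_sub, Complex.norm_real, Real.norm_eq_abs, sq_abs]
  simp only [h]
  simpa using hlim.sqrt

/-- Splitting into low and high frequencies. -/
theorem norm_le_lower_add_weight (hs0 : 0 ≤ s) {φ : ℝ → ℝ} (hφ : IsWeight φ) (hφm : Measurable φ)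
    {K r : ℝ} (hr : 1 ≤ r) (hφr : 0 < φ r) {D : L2C n}
    (hD : mulLp (cut K) (isMult_cut K) D = D) :
    ‖D‖ ≤ r ^ s * ‖lower n s hs0 D‖ + (φ r)⁻¹ * ‖mulLp _ (isMult_weight hφ hφm K) D‖ := by
  -- The radius r - 1 is chosen so that the ball is exactly the set where 1+|ξ| ≤ r.
  have h1 : ‖mulLp (cut (r - 1)) (isMult_cut (r - 1)) D‖ ≤ r ^ s * ‖lower n s hs0 D‖ := by
    refine norm_mulLp_le_norm_mulLp _ _ (Eventually.of_forall fun ξ => ?_)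
    rw [← mul_assoc]
    refine mul_le_mul_of_nonneg_right ?_ (norm_nonneg _)
    unfold cut
    split_ifs with h
    · have hb : br ξ ≤ r := by simp only [br]; linarith
      rw [abs_one, abs_of_nonneg (br_rpow_nonneg _ _), Real.rpow_neg (br_pos ξ).le,
        ← div_eq_mul_inv, le_div_iff₀ (Real.rpow_pos_of_pos (br_pos ξ) _), one_mul]
      exact Real.rpow_le_rpow (br_pos ξ).le hb hs0
    · rw [abs_zero]; positivity
  have h2 : ‖D - mulLp (cut (r - 1)) (isMult_cut (r - 1)) D‖ ≤
      (φ r)⁻¹ * ‖mulLp _ (isMult_weight hφ hφm K) D‖ := by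
    refine Lp.norm_le_mul_norm_of_ae_le_mul ?_
    filter_upwards [Lp.coeFn_sub D (mulLp (cut (r - 1)) (isMult_cut (r - 1)) D),
      coeFn_mulLp (isMult_cut (n := n) (r - 1)) D, mulLp_weight_congr hφ hφm hD] with ξ e1 e2 e3
    rw [e1, Pi.sub_apply, e2, e3, ← one_sub_mul, norm_mul, norm_mul, ← mul_assoc]
    refine mul_le_mul_of_nonneg_right ?_ (norm_nonneg _)
    rw [← Complex.ofReal_one, ← Complex.ofReal_sub, Complex.norm_real, Complex.norm_real,
      Real.norm_eq_abs, Real.norm_eq_abs, abs_of_nonneg (hφ.nonneg _ (one_le_br ξ))]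
    unfold cut
    split_ifs with h
    · rw [sub_self, abs_zero]
      exact mul_nonneg (inv_nonneg.2 hφr.le) (hφ.nonneg _ (one_le_br ξ))
    · have hb : r ≤ br ξ := by simp only [br]; linarith
      rw [sub_zero, abs_one, inv_mul_eq_div, le_div_iff₀ hφr, one_mul]
      exact hφ.mono _ _ hr hb
  calc ‖D‖ = ‖mulLp (cut (r - 1)) (isMult_cut (r - 1)) D +
        (D - mulLp (cut (r - 1)) (isMult_cut (r - 1)) D)‖ := by rw [add_sub_cancel]
    _ ≤ _ := (norm_add_le _ _).trans (add_le_add h1 h2)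

/-- The Galerkin approximations form a uniform Cauchy sequence. -/
theorem IsVel.uniformCauchySeqOn_galerkin (hc : IsVel c C) (hs : (n : ℝ) / 2 + 1 < s)
    (hN : ∀ V W k : L2C n, inner ℂ k (N V W) = tri (baseSym c s) V W k)
    {R T : ℝ} (hR : 0 < R) {V₀ : L2C n} (hV₀R : ‖V₀‖ ≤ R) {V : ℕ → ℝ → L2C n}
    (hV0 : ∀ j, V j 0 = mulLp (cut (j : ℝ)) (isMult_cut j) V₀)
    (hV : ∀ j : ℕ, ∀ t ∈ Icc 0 T,
      HasDerivWithinAt (V j) (-(mulLp (brCut (j : ℝ)) (isMult_brCut j) (N (V j t) (V j t))))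
        (Icc 0 T) t ∧
      mulLp (cut (j : ℝ)) (isMult_cut j) (V j t) = V j t ∧ conjRefl (V j t) = V j t ∧
      ‖V j t‖ ≤ 2 * R ∧
      ∀ (φ : ℝ → ℝ) (hφ : IsWeight φ) (hφm : Measurable φ),
        ‖mulLp _ (isMult_weight hφ hφm j) (V j t)‖ ≤
          2 * ‖mulLp _ (isMult_weight hφ hφm j) V₀‖) :
    UniformCauchySeqOn V atTop (Icc 0 T) := by
  have hn : (0 : ℝ) ≤ n := by positivity
  have hs0 : 0 ≤ s := by linarith
  have hs1 : 0 ≤ s - 1 := by linarith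
  -- The weight depends on V₀ alone, so the weighted bounds hold uniformly in time and in the
  -- truncation.
  obtain ⟨φ, hφ, hφm, hφt, hφV⟩ := exists_adapted_weight V₀
  set M := ‖hφV.toLp‖ with hM
  set G := (R ^ 2 + (‖N‖ * (2 * R) ^ 2) ^ 2) * Real.exp ((8 * C * decayNorm n s * R + 1) * T)
    with hG
  have hG0 : 0 ≤ G := by positivity
  have hQ : ∀ j : ℕ, ‖mulLp _ (isMult_weight hφ hφm j) V₀‖ ≤ M := by
    intro j
    refine Lp.norm_le_norm_of_ae_le ?_
    filter_upwards [coeFn_mulLp (isMult_weight (n := n) hφ hφm j) V₀, hφV.coeFn_toLp] with ξ h1 h2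
    rw [h1, h2, norm_mul, norm_mul]
    refine mul_le_mul_of_nonneg_right ?_ (norm_nonneg _)
    rw [Complex.norm_real, Complex.norm_real, norm_mul]
    exact mul_le_of_le_one_right (norm_nonneg _) (abs_cut_le _ _)
  have key : ∀ r : ℝ, 1 ≤ r → 0 < φ r → ∀ j l : ℕ, j ≤ l → ∀ t ∈ Icc 0 T,
      ‖V l t - V j t‖ ≤ r ^ s * ((1 + (j : ℝ)) ^ (-(s - 1)) * √G) + (φ r)⁻¹ * (4 * M) := by
    intro r hr hφr j l hjl t ht
    have hjl' : (j : ℝ) ≤ l := by exact_mod_cast hjl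
    obtain ⟨-, pj, jj, nj, wj⟩ := hV j t ht
    obtain ⟨-, pl, jl, nl, wl⟩ := hV l t ht
    have hcutj : mulLp (cut (l : ℝ)) (isMult_cut l) (V j t) = V j t := by
      rw [← pj, mulLp_mulLp]
      refine mulLp_congr _ _ (Eventually.of_forall fun ξ => ?_)
      rw [cut_mul_cut hjl']
    have hD : mulLp (cut (l : ℝ)) (isMult_cut l) (V l t - V j t) = V l t - V j t := by
      rw [map_sub, pl, hcutj]
    refine (norm_le_lower_add_weight hs0 hφ hφm hr hφr hD).trans ?_
    have h1 := hc.galerkin_difference hs hs0 hs1 hN hR (Nat.cast_nonneg j) hjl' hV₀R (hV0 j)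
      (hV0 l) (fun t ht => ⟨(hV j t ht).1, (hV j t ht).2.1, (hV j t ht).2.2.2.1⟩)
      (fun t ht => ⟨(hV l t ht).1, (hV l t ht).2.1, (hV l t ht).2.2.1, (hV l t ht).2.2.2.1⟩) t ht
    rw [← hG] at h1
    have h2 : ‖lower n s hs0 (V l t - V j t)‖ ≤ (1 + (j : ℝ)) ^ (-(s - 1)) * √G := by
      refine abs_le_of_sq_le_sq' ?_ (by positivity) |>.2
      rw [mul_pow, Real.sq_sqrt hG0]
      exact h1
    have h3 : ‖mulLp _ (isMult_weight hφ hφm l) (V l t - V j t)‖ ≤ 4 * M := by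
      rw [map_sub]
      -- V j is supported in |ξ| ≤ j ≤ l, so both truncated weights act on it in the same way.
      have e : mulLp _ (isMult_weight hφ hφm l) (V j t) =
          mulLp _ (isMult_weight hφ hφm j) (V j t) := by
        refine mulLp_congr _ _ ?_
        have h := coeFn_mulLp (isMult_cut (n := n) j) (V j t)
        rw [pj] at h
        filter_upwards [h] with ξ hξ
        have hcc : cut (l : ℝ) ξ * cut j ξ = cut j ξ := cut_mul_cut hjl' ξ
        have hcc' : cut (j : ℝ) ξ * cut j ξ = cut j ξ := cut_mul_cut le_rfl ξ
        have hcc2 : (cut (l : ℝ) ξ : ℂ) * cut j ξ = cut (j : ℝ) ξ * cut j ξ := by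
          rw [← Complex.ofReal_mul, ← Complex.ofReal_mul, hcc, hcc']
        rw [hξ]
        push_cast
        linear_combination ((φ (br ξ) : ℂ) * V j t ξ) * hcc2
      rw [e]
      refine (norm_sub_le _ _).trans ?_
      have := wl φ hφ hφm
      have := wj φ hφ hφm
      have := hQ l
      have := hQ j
      linarith
    have := hφr.le
    gcongr
  rw [Metric.uniformCauchySeqOn_iff]
  intro ε hε
  have hM0 : 0 ≤ M := norm_nonneg _
  -- The frequency threshold r comes first and makes the high frequencies small for all indices;
  -- with r fixed, J handles the factor r^s on the low frequencies.
  obtain ⟨r, hr1, hr2, hr3⟩ : ∃ r, 1 ≤ r ∧ 0 < φ r ∧ (φ r)⁻¹ * (4 * M) < ε / 2 := by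
    have h1 : Tendsto (fun r => (φ r)⁻¹ * (4 * M)) atTop (𝓝 (0 * (4 * M))) :=
      (tendsto_inv_atTop_zero.comp hφt).mul_const _
    rw [zero_mul] at h1
    obtain ⟨r, a1, a2, a3⟩ := ((h1.eventually_lt_const (half_pos hε)).and
      ((hφt.eventually_gt_atTop 0).and (eventually_ge_atTop 1))).exists
    exact ⟨r, a3, a2, a1⟩
  obtain ⟨J, hJ⟩ : ∃ J : ℕ, ∀ j ≥ J, r ^ s * ((1 + (j : ℝ)) ^ (-(s - 1)) * √G) < ε / 2 := by
    have h1 : Tendsto (fun j : ℕ => (1 + (j : ℝ)) ^ (-(s - 1))) atTop (𝓝 0) :=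
      (tendsto_rpow_neg_atTop (by linarith)).comp
        (tendsto_atTop_add_const_left _ _ tendsto_natCast_atTop_atTop)
    have h2 := (h1.mul_const (√G)).const_mul (r ^ s)
    rw [zero_mul, mul_zero] at h2
    exact eventually_atTop.1 (h2.eventually_lt_const (half_pos hε))
  refine ⟨J, fun m hm l hl t ht => ?_⟩
  rcases le_total m l with h | h
  · rw [dist_comm, dist_eq_norm]
    have := key r hr1 hr2 m l h t ht
    have := hJ m hm
    linarith
  · rw [dist_eq_norm]
    have := key r hr1 hr2 l m h t ht
    have := hJ l hl
    linarith

theorem lower_one_brCut (K : ℝ) (U : L2C n) :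
    lower n 1 zero_le_one (mulLp (brCut K) (isMult_brCut K) U) =
      mulLp (cut K) (isMult_cut K) U := by
  rw [lower, mulLp_mulLp]
  refine mulLp_congr _ _ (Eventually.of_forall fun ξ => ?_)
  congr 2
  have : br ξ * br ξ ^ (-1 : ℝ) = 1 := by rw [br_mul_rpow]; norm_num
  simp only [brCut]
  linear_combination cut K ξ * this

/-- Local existence for the equation on the Fourier side. -/
theorem IsVel.exists_solution (hc : IsVel c C) (hs : (n : ℝ) / 2 + 1 < s)
    (hN : ∀ V W k : L2C n, inner ℂ k (N V W) = tri (baseSym c s) V W k)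
    {R T : ℝ} (hR : 0 < R) (hT : 0 ≤ T) (hRT : 4 * energyConst n C s * R * T ≤ 1)
    {V₀ : L2C n} (hV₀ : conjRefl V₀ = V₀) (hV₀R : ‖V₀‖ ≤ R) :
    ∃ V : ℝ → L2C n, ContinuousOn V (Icc 0 T) ∧ V 0 = V₀ ∧
      (∀ t ∈ Icc 0 T, conjRefl (V t) = V t) ∧
      ∀ t ∈ Icc 0 T, lower n 1 zero_le_one (V t) =
        lower n 1 zero_le_one V₀ - ∫ τ in (0)..t, N (V τ) (V τ) := by
  choose V hV0 hV using fun j : ℕ => hc.exists_galerkin hs hN hR hT hRT hV₀ hV₀R (j : ℝ)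
  have hu := hc.uniformCauchySeqOn_galerkin hs hN hR hV₀R hV0 hV
  have hex : ∀ t, ∃ W, t ∈ Icc 0 T → Tendsto (fun j => V j t) atTop (𝓝 W) := by
    intro t
    by_cases ht : t ∈ Icc 0 T
    · obtain ⟨W, hW⟩ := cauchySeq_tendsto_of_complete (hu.cauchySeq ht)
      exact ⟨W, fun _ => hW⟩
    · exact ⟨0, fun h => absurd h ht⟩
  choose W hW using hex
  have hVc : ∀ j, ContinuousOn (V j) (Icc 0 T) := fun j t ht =>
    (hV j t ht).1.continuousWithinAt
  have hWu : TendstoUniformlyOn V W atTop (Icc 0 T) :=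
    hu.tendstoUniformlyOn_of_tendsto (fun t ht => hW t ht)
  have hWc : ContinuousOn W (Icc 0 T) := hWu.continuousOn (Frequently.of_forall hVc)
  have h0 : (0 : ℝ) ∈ Icc 0 T := ⟨le_rfl, hT⟩
  have hW0 : W 0 = V₀ := by
    refine tendsto_nhds_unique (hW 0 h0) ?_
    simp only [hV0]
    exact tendsto_cut V₀
  refine ⟨W, hWc, hW0, fun t ht => ?_, fun t ht => ?_⟩
  · refine tendsto_nhds_unique ((conjRefl.continuous.tendsto _).comp (hW t ht)) ?_
    refine (hW t ht).congr fun j => ?_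
    exact ((hV j t ht).2.2.1).symm
  · set A := lower n 1 zero_le_one with hA
    have hNc : Continuous (fun U : L2C n => N U U) := by fun_prop
    -- Division by 1+|ξ| cancels the unbounded factor in the field, so that the integral equation
    -- can pass to the limit in L².
    have heq : ∀ j : ℕ, A (V j t) - A (V j 0) =
        ∫ τ in (0)..t, -(mulLp (cut (j : ℝ)) (isMult_cut j) (N (V j τ) (V j τ))) := by
      intro j
      have hsub : Icc 0 t ⊆ Icc 0 T := Icc_subset_Icc_right ht.2
      refine (intervalIntegral.integral_eq_sub_of_hasDeriv_right_of_le ht.1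
        (A.continuous.comp_continuousOn ((hVc j).mono hsub)) (fun τ hτ => ?_) ?_).symm
      · have hτ' : τ ∈ Ico 0 T := ⟨hτ.1.le, hτ.2.trans_le ht.2⟩
        have h1 := hasDerivWithinAt_Ici_of_Icc hτ' (hV j τ (Ico_subset_Icc_self hτ')).1
        have h2 := (A.hasFDerivAt.comp_hasDerivWithinAt τ h1).mono Ioi_subset_Ici_self
        rw [map_neg, hA, lower_one_brCut] at h2
        exact h2
      · refine ContinuousOn.intervalIntegrable ?_
        rw [uIcc_of_le ht.1]
        exact ((mulLp (cut (j : ℝ)) (isMult_cut j)).continuous.comp_continuousOn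
          (hNc.comp_continuousOn ((hVc j).mono hsub))).neg
    have hlim1 : Tendsto (fun j => A (V j t) - A (V j 0)) atTop (𝓝 (A (W t) - A (W 0))) :=
      ((A.continuous.tendsto _).comp (hW t ht)).sub ((A.continuous.tendsto _).comp (hW 0 h0))
    have hlim2 : Tendsto (fun j : ℕ => ∫ τ in (0)..t,
        -(mulLp (cut (j : ℝ)) (isMult_cut j) (N (V j τ) (V j τ)))) atTop
        (𝓝 (∫ τ in (0)..t, -(N (W τ) (W τ)))) := by
      refine intervalIntegral.tendsto_integral_filter_of_dominated_convergence
        (fun _ => ‖N‖ * (2 * R) * (2 * R)) (Eventually.of_forall fun j => ?_)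
        (Eventually.of_forall fun j => Eventually.of_forall fun τ hτ => ?_)
        intervalIntegrable_const (Eventually.of_forall fun τ hτ => ?_)
      · refine ContinuousOn.aestronglyMeasurable ?_ measurableSet_uIoc
        rw [uIoc_of_le ht.1]
        exact ((mulLp (cut (j : ℝ)) (isMult_cut j)).continuous.comp_continuousOn
          (hNc.comp_continuousOn ((hVc j).mono
            (Ioc_subset_Icc_self.trans (Icc_subset_Icc_right ht.2))))).neg
      · rw [uIoc_of_le ht.1] at hτ
        have hτ' : τ ∈ Icc 0 T := ⟨hτ.1.le, hτ.2.trans ht.2⟩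
        have h1 := (hV j τ hτ').2.2.2.1
        rw [norm_neg]
        refine (norm_mulLp_cut_le _ _).trans ((N.le_opNorm₂ _ _).trans ?_)
        gcongr
      · rw [uIoc_of_le ht.1] at hτ
        have hτ' : τ ∈ Icc 0 T := ⟨hτ.1.le, hτ.2.trans ht.2⟩
        refine Tendsto.neg ?_
        have h1 : Tendsto (fun j => N (V j τ) (V j τ)) atTop (𝓝 (N (W τ) (W τ))) :=
          (hNc.tendsto _).comp (hW τ hτ')
        have h2 := tendsto_cut (N (W τ) (W τ))
        have h3 : Tendsto (fun j : ℕ => mulLp (cut (j : ℝ)) (isMult_cut j)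
            (N (V j τ) (V j τ) - N (W τ) (W τ))) atTop (𝓝 0) := by
          refine squeeze_zero_norm (fun j => norm_mulLp_cut_le _ _) ?_
          exact tendsto_iff_norm_sub_tendsto_zero.1 h1
        have h4 := h3.add h2
        rw [zero_add] at h4
        refine h4.congr fun j => ?_
        rw [map_sub, sub_add_cancel]
    have h := tendsto_nhds_unique (hlim1.congr heq) hlim2
    rw [intervalIntegral.integral_neg, hW0] at h
    rw [sub_eq_iff_eq_add] at h
    rw [h]; abel

end Existence

/-! ### Uniqueness on the Fourier side -/

section Uniqueness

variable {n : ℕ} {c : Space n → Space n} {C s : ℝ} {N : L2C n →L[ℝ] L2C n →L[ℝ] L2C n}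

theorem hasDerivAt_norm_sq_of_inner {H : Type*} [NormedAddCommGroup H] [InnerProductSpace ℂ H]
    [NormedSpace ℝ H] [IsScalarTower ℝ ℂ H] {Z : ℝ → H} {Z' : H} {t : ℝ}
    (hZ : HasDerivAt Z Z' t) :
    HasDerivAt (fun t => ‖Z t‖ ^ 2) (2 * (inner ℂ (Z t) Z').re) t := by
  have h1 := HasDerivAt.inner ℂ hZ hZ
  have h2 := Complex.reCLM.hasFDerivAt.comp_hasDerivAt t h1
  have e1 : (Complex.reCLM ∘ fun t => inner ℂ (Z t) (Z t)) = fun t => ‖Z t‖ ^ 2 := by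
    ext τ
    rw [Function.comp, inner_self_eq_norm_sq_to_K, Complex.reCLM_apply]
    norm_cast
  have e2 : Complex.reCLM (inner ℂ (Z t) Z' + inner ℂ Z' (Z t)) = 2 * (inner ℂ (Z t) Z').re := by
    rw [Complex.reCLM_apply, Complex.add_re, ← inner_conj_symm Z', Complex.conj_re]; ring
  rw [e1, e2] at h2
  exact h2

theorem lower_lower {σ τ : ℝ} (hσ : 0 ≤ σ) (hτ : 0 ≤ τ) (hστ : 0 ≤ σ + τ) (V : L2C n) :
    lower n σ hσ (lower n τ hτ V) = lower n (σ + τ) hστ V := by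
  rw [lower, lower, lower, mulLp_mulLp]
  refine mulLp_congr _ _ (Eventually.of_forall fun ξ => ?_)
  rw [br_rpow_mul, neg_add]

/-- Uniqueness for the equation on the Fourier side. -/
theorem IsVel.eqOn_of_solutions (hc : IsVel c C) (hs : (n : ℝ) / 2 + 1 < s)
    (hN : ∀ V W k : L2C n, inner ℂ k (N V W) = tri (baseSym c s) V W k)
    {T : ℝ} {V W : ℝ → L2C n} (hV : ContinuousOn V (Ico 0 T)) (hW : ContinuousOn W (Ico 0 T))
    (hWh : ∀ t ∈ Ico 0 T, conjRefl (W t) = W t)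
    (hVd : ∀ t ∈ Ioo 0 T, HasDerivAt (fun τ => lower n 1 zero_le_one (V τ)) (-(N (V t) (V t))) t)
    (hWd : ∀ t ∈ Ioo 0 T, HasDerivAt (fun τ => lower n 1 zero_le_one (W τ)) (-(N (W t) (W t))) t)
    (h0 : V 0 = W 0) : EqOn V W (Ico 0 T) := by
  intro t ht
  have hn : (0 : ℝ) ≤ n := by positivity
  have hs0 : 0 ≤ s := by linarith
  have hs1 : 0 ≤ s - 1 := by linarith
  have hsub : Icc 0 t ⊆ Ico 0 T := fun x hx => ⟨hx.1, hx.2.trans_lt ht.2⟩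
  have hVt := hV.mono hsub
  have hWt := hW.mono hsub
  -- The curves need not be bounded on [0, T); compactness of [0, t] supplies the Grönwall constant.
  obtain ⟨MV, hMV⟩ := isCompact_Icc.exists_bound_of_continuousOn hVt
  obtain ⟨MW, hMW⟩ := isCompact_Icc.exists_bound_of_continuousOn hWt
  set S := lower n s hs0 with hS
  set A := lower n (s - 1) hs1 with hA
  set a := 2 * (C * decayNorm n s * (MV + MW)) with ha
  have hS1 : ∀ U : L2C n, S U = A (lower n 1 zero_le_one U) := by
    intro U
    rw [hA, lower_lower hs1 zero_le_one (by linarith), hS]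
    congr 1
    simp only [sub_add_cancel]
  -- Differentiability is available only in the open interval, so Grönwall is run as monotonicity of
  -- the damped energy, with continuity at the endpoints.
  set f : ℝ → ℝ := fun τ => ‖S (V τ - W τ)‖ ^ 2 * Real.exp (-(a * τ)) with hf
  have hfd : ∀ τ ∈ Ioo 0 t, ∃ f', HasDerivAt f f' τ ∧ f' ≤ 0 := by
    intro τ hτ
    have hτT : τ ∈ Ioo 0 T := ⟨hτ.1, hτ.2.trans ht.2⟩
    set D := V τ - W τ with hD
    have hZ : HasDerivAt (fun τ => S (V τ - W τ)) (-(A (N D (V τ) + N (W τ) D))) τ := by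
      have h1 := A.hasFDerivAt.comp_hasDerivAt τ ((hVd τ hτT).sub (hWd τ hτT))
      have e1 : (⇑A ∘ ((fun τ => lower n 1 zero_le_one (V τ)) -
          fun τ => lower n 1 zero_le_one (W τ))) = fun τ => S (V τ - W τ) := by
        ext1 x
        rw [hS1, map_sub]; rfl
      have e2 : A (-(N (V τ) (V τ)) - -(N (W τ) (W τ))) = -(A (N D (V τ) + N (W τ) D)) := by
        rw [← map_neg A]
        congr 1
        simp only [hD, map_sub, sub_apply]
        abel
      rw [e1, e2] at h1
      exact h1
    have h1 := hasDerivAt_norm_sq_of_inner hZ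
    have h2 : HasDerivAt (fun τ => Real.exp (-(a * τ))) (Real.exp (-(a * τ)) * (-a)) τ := by
      have := ((hasDerivAt_id τ).const_mul a).neg.exp
      simpa using this
    refine ⟨_, h1.mul h2, ?_⟩
    have h3 := hc.difference_energy hs hs0 hs1 hN D (V τ) (W τ) (hWh τ ⟨hτ.1.le, hτT.2⟩)
    rw [← hS, ← hA] at h3
    have h4 : C * decayNorm n s * (‖V τ‖ + ‖W τ‖) * ‖S D‖ ^ 2 ≤
        C * decayNorm n s * (MV + MW) * ‖S D‖ ^ 2 := by
      have := hMV τ ⟨hτ.1.le, hτ.2.le⟩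
      have := hMW τ ⟨hτ.1.le, hτ.2.le⟩
      have := hc.const_nonneg
      have := decayNorm_nonneg n s
      gcongr
    rw [inner_neg_right, Complex.neg_re]
    have h5 := (neg_le_abs _).trans (h3.trans h4)
    have h6 : 0 < Real.exp (-(a * τ)) := Real.exp_pos _
    have h7 : 2 * -(inner ℂ (S D) (A (N D (V τ) + N (W τ) D))).re - a * ‖S D‖ ^ 2 ≤ 0 := by
      rw [ha]; linarith
    have h8 := mul_nonpos_of_nonpos_of_nonneg h7 h6.le
    refine le_trans (le_of_eq ?_) h8
    ring
  have hanti : AntitoneOn f (Icc 0 t) := by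
    refine antitoneOn_of_deriv_nonpos (convex_Icc 0 t) ?_ ?_ ?_
    · exact ((S.continuous.comp_continuousOn (hVt.sub hWt)).norm.pow 2).mul
        (by fun_prop)
    · intro τ hτ
      rw [interior_Icc] at hτ
      obtain ⟨f', h1, -⟩ := hfd τ hτ
      exact h1.differentiableAt.differentiableWithinAt
    · intro τ hτ
      rw [interior_Icc] at hτ
      obtain ⟨f', h1, h2⟩ := hfd τ hτ
      rw [h1.deriv]; exact h2
  have h := hanti ⟨le_rfl, ht.1⟩ ⟨ht.1, le_rfl⟩ ht.1
  have hf0 : f 0 = 0 := by simp [hf, h0]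
  rw [hf0] at h
  have h1 : ‖S (V t - W t)‖ ^ 2 ≤ 0 := by
    have h6 : 0 < Real.exp (-(a * t)) := Real.exp_pos _
    by_contra hcon
    push Not at hcon
    exact absurd h (not_le.2 (mul_pos hcon h6))
  have h2 : S (V t - W t) = 0 := by
    have : ‖S (V t - W t)‖ = 0 := by
      have := sq_nonneg ‖S (V t - W t)‖
      nlinarith
    exact norm_eq_zero.1 this
  have h3 : V t - W t = 0 := lower_injective hs0 (by rw [← hS, h2, map_zero])
  exact sub_eq_zero.1 h3

end Uniqueness

/-! ### The kernel -/

section Kernel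

variable {n : ℕ}

/-- The normalizing constant of the kernel. -/
def kerConst (n : ℕ) : ℝ := Real.Gamma (((n : ℝ) + 1) / 2) / Real.pi ^ (((n : ℝ) + 1) / 2)

theorem kerConst_pos (n : ℕ) : 0 < kerConst n :=
  div_pos (Real.Gamma_pos_of_pos (by positivity)) (Real.rpow_pos_of_pos Real.pi_pos _)

/-- The radial profile of the kernel. -/
def profile (n : ℕ) (a r : ℝ) : ℝ :=
  kerConst n * ((r ^ (n + 1))⁻¹ - ((r ^ 2 + a ^ 2) ^ (((n : ℝ) + 1) / 2))⁻¹)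

theorem kernel_eq (a : ℝ) (z : Space n) : kernel a z = profile n a ‖z‖ • z := by
  rw [kernel, profile, kerConst, ← sub_smul, smul_smul]

theorem measurable_profile (a : ℝ) : Measurable (profile n a) := by
  unfold profile
  refine measurable_const.mul (((measurable_id.pow_const _).inv).sub ?_)
  exact (((measurable_id.pow_const 2).add_const _).pow_const _).inv

theorem measurable_kernel (a : ℝ) : Measurable (kernel a : Space n → Space n) := by
  have : (kernel a : Space n → Space n) = fun z => profile n a ‖z‖ • z := funext (kernel_eq a)
  rw [this]
  exact ((measurable_profile a).comp measurable_norm).smul measurable_id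

theorem kernel_neg (a : ℝ) (z : Space n) : kernel a (-z) = -kernel a z := by
  rw [kernel_eq, kernel_eq, norm_neg, smul_neg]

theorem sq_rpow_half_succ {r : ℝ} (hr : 0 ≤ r) (n : ℕ) :
    (r ^ 2) ^ (((n : ℝ) + 1) / 2) = r ^ (n + 1) := by
  rw [← Real.rpow_natCast r 2, ← Real.rpow_mul hr, ← Real.rpow_natCast]
  congr 1; push_cast; ring

theorem one_sub_mul_le_inv_rpow {x p : ℝ} (hx : 0 ≤ x) (hp : 0 ≤ p) :
    1 - p * x ≤ ((1 + x) ^ p)⁻¹ := by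
  have h1 : (0 : ℝ) < 1 + x := by linarith
  rw [← Real.rpow_neg h1.le, Real.rpow_def_of_pos h1]
  have h2 := Real.log_le_sub_one_of_pos h1
  have h3 := Real.add_one_le_exp (Real.log (1 + x) * -p)
  nlinarith

theorem profile_nonneg (a : ℝ) {r : ℝ} (hr : 0 < r) : 0 ≤ profile n a r := by
  refine mul_nonneg (kerConst_pos n).le (sub_nonneg.2 ?_)
  rw [← sq_rpow_half_succ hr.le n]
  have : 0 < r ^ 2 := by positivity
  refine inv_anti₀ (Real.rpow_pos_of_pos this _) (Real.rpow_le_rpow this.le ?_ (by positivity))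
  nlinarith [sq_nonneg a]

theorem profile_le (a : ℝ) {r : ℝ} (hr : 0 < r) :
    profile n a r ≤ kerConst n * (r ^ (n + 1))⁻¹ := by
  refine mul_le_mul_of_nonneg_left ?_ (kerConst_pos n).le
  have : 0 ≤ ((r ^ 2 + a ^ 2) ^ (((n : ℝ) + 1) / 2))⁻¹ := by positivity
  linarith

/-- The two kernels agree to leading order at infinity. The inequality (1+x)^(-p) ≥ 1 - px at x =
a²/r² shows that two powers of r are gained. -/
theorem profile_le' (a : ℝ) {r : ℝ} (hr : 0 < r) :
    profile n a r ≤ kerConst n * (((n : ℝ) + 1) / 2) * a ^ 2 * (r ^ (n + 3))⁻¹ := by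
  have h1 : ((r ^ 2 + a ^ 2) ^ (((n : ℝ) + 1) / 2))⁻¹
      = (r ^ (n + 1))⁻¹ * ((1 + a ^ 2 / r ^ 2) ^ (((n : ℝ) + 1) / 2))⁻¹ := by
    rw [← mul_inv, ← sq_rpow_half_succ hr.le n, ← Real.mul_rpow (by positivity) (by positivity)]
    congr 3
    field_simp
  have h2 := one_sub_mul_le_inv_rpow (x := a ^ 2 / r ^ 2) (p := ((n : ℝ) + 1) / 2)
    (by positivity) (by positivity)
  rw [profile, h1]
  have h3 : kerConst n * (((n : ℝ) + 1) / 2) * a ^ 2 * (r ^ (n + 3))⁻¹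
      = kerConst n * ((r ^ (n + 1))⁻¹ * ((((n : ℝ) + 1) / 2) * (a ^ 2 / r ^ 2))) := by
    field_simp
    ring
  rw [h3]
  refine mul_le_mul_of_nonneg_left ?_ (kerConst_pos n).le
  rw [← mul_one_sub]
  refine mul_le_mul_of_nonneg_left ?_ (by positivity)
  linarith

/-- In polar coordinates the integrand is bounded near the origin, where the factor |z| compensates
the singularity, and is O(r^(-3)) at infinity. The factor min(1,|z|) is what a sine provides. -/
theorem integrable_min_mul_norm_kernel [NeZero n] (a : ℝ) :
    Integrable (fun z : Space n => min 1 ‖z‖ * ‖kernel a z‖) := by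
  have hn : 1 ≤ n := Nat.one_le_iff_ne_zero.2 (NeZero.ne n)
  have hfr : Module.finrank ℝ (Space n) = n := by simp
  have : Nontrivial (Space n) := Module.nontrivial_of_finrank_pos (R := ℝ) (by omega)
  have h : (fun z : Space n => min 1 ‖z‖ * ‖kernel a z‖)
      = fun z : Space n => (fun r : ℝ => min 1 r * (|profile n a r| * r)) ‖z‖ := by
    funext z
    rw [kernel_eq, norm_smul, Real.norm_eq_abs]
  rw [h, integrable_fun_norm_addHaar volume (f := fun r : ℝ => min 1 r * (|profile n a r| * r)), hfr]
  have hmeas : Measurable (fun r : ℝ => r ^ (n - 1) • (min 1 r * (|profile n a r| * r))) :=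
    (measurable_id.pow_const _).smul ((measurable_const.min measurable_id).mul
      ((measurable_profile a).abs.mul measurable_id))
  have key : ∀ r : ℝ, 0 < r → ∀ m : ℕ, ∀ A : ℝ, profile n a r ≤ A * (r ^ (n + m))⁻¹ →
      ‖r ^ (n - 1) • (min 1 r * (|profile n a r| * r))‖ ≤ min 1 r * (A * (r ^ m)⁻¹) := by
    intro r hr m A hA
    have hp := profile_nonneg (n := n) a hr
    have hmin : 0 ≤ min 1 r := le_min zero_le_one hr.le
    rw [abs_of_nonneg hp, Real.norm_eq_abs, smul_eq_mul, abs_of_nonneg (by positivity)]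
    have : r ^ (n - 1) * (min 1 r * (profile n a r * r))
        = min 1 r * (r ^ n * profile n a r) := by
      have : r ^ n = r ^ (n - 1) * r := by rw [← pow_succ]; congr 1; omega
      rw [this]; ring
    rw [this]
    refine mul_le_mul_of_nonneg_left ?_ hmin
    refine (mul_le_mul_of_nonneg_left hA (by positivity)).trans (le_of_eq ?_)
    rw [pow_add]; field_simp
  rw [← Ioc_union_Ioi_eq_Ioi (zero_le_one (α := ℝ))]
  refine IntegrableOn.union ?_ ?_
  · refine Measure.integrableOn_of_bounded (M := kerConst n) (by simp)
      hmeas.aestronglyMeasurable ?_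
    refine (ae_restrict_iff' measurableSet_Ioc).2 (Eventually.of_forall fun r hr => ?_)
    refine (key r hr.1 1 _ (profile_le a hr.1)).trans (le_of_eq ?_)
    rw [min_eq_right hr.2]
    have := hr.1.ne'
    field_simp
  · refine Integrable.mono' (g := fun r : ℝ => kerConst n * (((n : ℝ) + 1) / 2) * a ^ 2 *
      r ^ (-3 : ℝ)) ((integrableOn_Ioi_rpow_of_lt (by norm_num) one_pos).const_mul _)
      hmeas.aestronglyMeasurable ?_
    refine (ae_restrict_iff' measurableSet_Ioi).2 (Eventually.of_forall fun r hr => ?_)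
    have hr' : (1 : ℝ) < r := hr
    refine (key r (by linarith) 3 _ (profile_le' a (by linarith))).trans (le_of_eq ?_)
    rw [min_eq_left hr'.le, one_mul, Real.rpow_neg (by linarith)]
    norm_cast

theorem integrableOn_kernel [NeZero n] (a : ℝ) {ε : ℝ} (hε : 0 < ε) :
    IntegrableOn (kernel a : Space n → Space n) {z | ε < ‖z‖} := by
  refine Integrable.mono' (g := fun z => (min 1 ε)⁻¹ * (min 1 ‖z‖ * ‖kernel a z‖))
    ((integrable_min_mul_norm_kernel a).const_mul _).integrableOn
    (measurable_kernel a).aestronglyMeasurable ?_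
  refine (ae_restrict_iff' (measurableSet_lt measurable_const measurable_norm)).2
    (Eventually.of_forall fun z hz => ?_)
  have hz' : ε < ‖z‖ := hz
  have h0 : 0 < min 1 ε := lt_min one_pos hε
  have h1 : min 1 ε ≤ min 1 ‖z‖ := min_le_min_left _ hz'.le
  rw [← mul_assoc]
  refine le_mul_of_one_le_left (norm_nonneg _) ?_
  rw [inv_mul_eq_div, one_le_div h0]
  exact h1

end Kernel

/-! ### Gaussian integrals -/

section Gaussian

variable {n : ℕ}

theorem integrable_exp_neg_mul_sq_norm {t : ℝ} (ht : 0 < t) :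
    Integrable (fun z : Space n => Real.exp (-(‖z‖ ^ 2 * t))) := by
  have h := (GaussianFourier.integrable_cexp_neg_mul_sq_norm_add (V := Space n) (b := (t : ℂ))
    (by simpa using ht) 0 0).re
  refine h.congr (Eventually.of_forall fun z => ?_)
  have : (-(t : ℂ) * (‖z‖ : ℂ) ^ 2 + 0 * ((inner ℝ (0 : Space n) z : ℝ) : ℂ))
      = ((-(‖z‖ ^ 2 * t) : ℝ) : ℂ) := by push_cast; ring
  simp only [this]
  rw [← Complex.ofReal_exp]
  exact Complex.ofReal_re _

theorem integrable_norm_mul_exp_neg_mul_sq_norm {t : ℝ} (ht : 0 < t) :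
    Integrable (fun z : Space n => ‖z‖ * Real.exp (-(‖z‖ ^ 2 * t))) := by
  refine Integrable.mono' ((integrable_exp_neg_mul_sq_norm (n := n) (half_pos ht)).const_mul
    (1 + 2 / t)) (by fun_prop) (Eventually.of_forall fun z => ?_)
  rw [Real.norm_eq_abs, abs_of_nonneg (by positivity)]
  have h1 : Real.exp (-(‖z‖ ^ 2 * t))
      = Real.exp (-(‖z‖ ^ 2 * (t / 2))) * Real.exp (-(‖z‖ ^ 2 * (t / 2))) := by
    rw [← Real.exp_add]; congr 1; ring
  have h2 : ‖z‖ * Real.exp (-(‖z‖ ^ 2 * (t / 2))) ≤ 1 + 2 / t := by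
    rw [Real.exp_neg, ← div_eq_mul_inv, div_le_iff₀ (Real.exp_pos _)]
    have h3 := Real.add_one_le_exp (‖z‖ ^ 2 * (t / 2))
    have h4 : 0 ≤ 2 / t := by positivity
    have h5 : ‖z‖ ≤ (1 + 2 / t) * (‖z‖ ^ 2 * (t / 2) + 1) := by
      have : (1 + 2 / t) * (‖z‖ ^ 2 * (t / 2) + 1)
          = ‖z‖ ^ 2 * (t / 2) + 1 + ‖z‖ ^ 2 + 2 / t := by field_simp; ring
      rw [this]
      have : 0 ≤ ‖z‖ ^ 2 * (t / 2) := by positivity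
      nlinarith [sq_nonneg (‖z‖ - 1)]
    exact h5.trans (mul_le_mul_of_nonneg_left h3 (by positivity))
  rw [h1, ← mul_assoc]
  exact mul_le_mul_of_nonneg_right h2 (Real.exp_pos _).le

theorem integral_cos_mul_exp_neg_mul_sq_norm {t : ℝ} (ht : 0 < t) (ζ : Space n) :
    ∫ z : Space n, Real.cos (2 * Real.pi * ⟪z, ζ⟫) * Real.exp (-(‖z‖ ^ 2 * t))
      = (Real.pi / t) ^ ((n : ℝ) / 2) * Real.exp (-(Real.pi ^ 2 * ‖ζ‖ ^ 2 / t)) := by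
  have h := GaussianFourier.integral_cexp_neg_mul_sq_norm_add (V := Space n) (b := (t : ℂ))
    (by simpa using ht) (2 * Real.pi * Complex.I) ζ
  have hi := GaussianFourier.integrable_cexp_neg_mul_sq_norm_add (V := Space n) (b := (t : ℂ))
    (by simpa using ht) (2 * Real.pi * Complex.I) ζ
  have h' := congrArg Complex.re h
  rw [← Complex.reCLM_apply, ← ContinuousLinearMap.integral_comp_comm _ hi] at h'
  have hfr : Module.finrank ℝ (Space n) = n := by simp
  rw [hfr] at h'
  have e1 : ((Real.pi : ℂ) / t) ^ ((n : ℂ) / 2)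
      * Complex.exp ((2 * Real.pi * Complex.I) ^ 2 * (‖ζ‖ : ℂ) ^ 2 / (4 * t))
      = (((Real.pi / t) ^ ((n : ℝ) / 2) * Real.exp (-(Real.pi ^ 2 * ‖ζ‖ ^ 2 / t)) : ℝ) : ℂ) := by
    rw [Complex.ofReal_mul, Complex.ofReal_cpow (by positivity), Complex.ofReal_exp]
    push_cast
    congr 2
    rw [mul_pow, Complex.I_sq]
    field_simp
    ring
  rw [e1, Complex.ofReal_re] at h'
  rw [← h']
  refine integral_congr_ae (Eventually.of_forall fun z => ?_)
  have : (-(t : ℂ) * (‖z‖ : ℂ) ^ 2 + 2 * Real.pi * Complex.I * ((inner ℝ ζ z : ℝ) : ℂ))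
      = ((-(‖z‖ ^ 2 * t) : ℝ) : ℂ) + ((2 * Real.pi * ⟪z, ζ⟫ : ℝ) : ℂ) * Complex.I := by
    rw [real_inner_comm]; push_cast; ring
  simp only [this, Complex.reCLM_apply, Complex.exp_add, ← Complex.ofReal_exp,
    Complex.re_ofReal_mul, Complex.exp_ofReal_mul_I_re]
  ring

/-- Integration by parts in the direction e: the derivative of the Gaussian produces the factor
⟨z,e⟩ and that of the sine a cosine, whose Gaussian integral is known. -/
theorem integral_sin_mul_inner_mul_exp_neg_mul_sq_norm {t : ℝ} (ht : 0 < t) (ζ e : Space n) :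
    ∫ z : Space n, Real.sin (2 * Real.pi * ⟪z, ζ⟫) * (⟪z, e⟫ * Real.exp (-(‖z‖ ^ 2 * t)))
      = Real.pi / t * ⟪ζ, e⟫ * ((Real.pi / t) ^ ((n : ℝ) / 2)
        * Real.exp (-(Real.pi ^ 2 * ‖ζ‖ ^ 2 / t))) := by
  rw [← integral_cos_mul_exp_neg_mul_sq_norm ht]
  have hf : ∀ z : Space n, HasLineDerivAt ℝ (fun z => Real.sin (2 * Real.pi * ⟪z, ζ⟫))
      (2 * Real.pi * ⟪ζ, e⟫ * Real.cos (2 * Real.pi * ⟪z, ζ⟫)) z e := by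
    intro z
    have h1 : HasFDerivAt (fun z : Space n => 2 * Real.pi * ⟪z, ζ⟫)
        ((2 * Real.pi) • innerSL ℝ ζ) z := by
      have := ((innerSL ℝ ζ).hasFDerivAt (x := z)).const_mul (2 * Real.pi)
      refine this.congr_of_eventuallyEq (Eventually.of_forall fun y => ?_)
      simp [real_inner_comm]
    have h2 : 2 * Real.pi * ⟪ζ, e⟫ * Real.cos (2 * Real.pi * ⟪z, ζ⟫)
        = (Real.cos (2 * Real.pi * ⟪z, ζ⟫) • (2 * Real.pi) • innerSL ℝ ζ) e := by
      simp only [_root_.smul_apply, innerSL_apply_apply, smul_eq_mul]; ring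
    rw [h2]
    exact h1.sin.hasLineDerivAt e
  have hg : ∀ z : Space n, HasLineDerivAt ℝ (fun z => Real.exp (-(‖z‖ ^ 2 * t)))
      (-(2 * t) * (⟪z, e⟫ * Real.exp (-(‖z‖ ^ 2 * t)))) z e := by
    intro z
    have h1 : HasFDerivAt (fun z : Space n => -(‖z‖ ^ 2 * t)) _ z :=
      ((hasStrictFDerivAt_norm_sq z).hasFDerivAt.mul_const t).neg
    have h2 : -(2 * t) * (⟪z, e⟫ * Real.exp (-(‖z‖ ^ 2 * t)))
        = (Real.exp (-(‖z‖ ^ 2 * t)) • -(t • 2 • innerSL ℝ z)) e := by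
      simp only [_root_.smul_apply, _root_.neg_apply,
        innerSL_apply_apply, smul_eq_mul, nsmul_eq_mul]
      push_cast; ring
    rw [h2]
    exact h1.exp.hasLineDerivAt e
  have hi := integrable_exp_neg_mul_sq_norm (n := n) ht
  have hi1 := integrable_norm_mul_exp_neg_mul_sq_norm (n := n) ht
  have key := integral_bilinear_hasLineDerivAt_right_eq_neg_left_of_integrable
    (μ := (volume : Measure (Space n))) (B := ContinuousLinearMap.mul ℝ ℝ)
    (f := fun z : Space n => Real.sin (2 * Real.pi * ⟪z, ζ⟫))
    (f' := fun z => 2 * Real.pi * ⟪ζ, e⟫ * Real.cos (2 * Real.pi * ⟪z, ζ⟫))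
    (g := fun z => Real.exp (-(‖z‖ ^ 2 * t)))
    (g' := fun z => -(2 * t) * (⟪z, e⟫ * Real.exp (-(‖z‖ ^ 2 * t)))) (v := e)
    ?_ ?_ ?_ (fun z _ => hf z) (fun z _ => hg z)
  · simp only [ContinuousLinearMap.mul_apply'] at key
    have e1 : ∀ z : Space n, Real.sin (2 * Real.pi * ⟪z, ζ⟫) *
        (-(2 * t) * (⟪z, e⟫ * Real.exp (-(‖z‖ ^ 2 * t))))
        = -(2 * t) * (Real.sin (2 * Real.pi * ⟪z, ζ⟫) *
          (⟪z, e⟫ * Real.exp (-(‖z‖ ^ 2 * t)))) := fun z => by ring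
    have e2 : ∀ z : Space n, 2 * Real.pi * ⟪ζ, e⟫ * Real.cos (2 * Real.pi * ⟪z, ζ⟫) *
        Real.exp (-(‖z‖ ^ 2 * t)) = 2 * Real.pi * ⟪ζ, e⟫ * (Real.cos (2 * Real.pi * ⟪z, ζ⟫) *
        Real.exp (-(‖z‖ ^ 2 * t))) := fun z => by ring
    simp_rw [e1, e2, integral_const_mul] at key
    have h2t : (2 * t) ≠ 0 := by positivity
    rw [← mul_right_inj' h2t, ← neg_inj, ← neg_mul, key]
    generalize (∫ z : Space n, Real.cos (2 * Real.pi * ⟪z, ζ⟫) * Real.exp (-(‖z‖ ^ 2 * t))) = J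
    field_simp
  · refine Integrable.mono' (hi.const_mul |2 * Real.pi * ⟪ζ, e⟫|)
      (by simp only [ContinuousLinearMap.mul_apply']; fun_prop)
      (Eventually.of_forall fun z => ?_)
    simp only [ContinuousLinearMap.mul_apply', norm_mul (_ * Real.cos _), Real.norm_eq_abs,
      Real.abs_exp, abs_mul _ (Real.cos _)]
    refine mul_le_mul_of_nonneg_right ?_ (Real.exp_pos _).le
    exact mul_le_of_le_one_right (abs_nonneg _) (Real.abs_cos_le_one _)
  · refine Integrable.mono' (hi1.const_mul (2 * t * ‖e‖))
      (by simp only [ContinuousLinearMap.mul_apply']; fun_prop)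
      (Eventually.of_forall fun z => ?_)
    simp only [ContinuousLinearMap.mul_apply', norm_mul, norm_neg, Real.norm_eq_abs,
      Real.abs_exp, abs_two, abs_of_pos ht]
    have h1 := Real.abs_sin_le_one (2 * Real.pi * ⟪z, ζ⟫)
    have h2 := abs_real_inner_le_norm z e
    have h3 := Real.exp_pos (-(‖z‖ ^ 2 * t))
    calc _ ≤ 1 * (2 * t * (‖z‖ * ‖e‖ * Real.exp (-(‖z‖ ^ 2 * t)))) := by gcongr
      _ = _ := by ring
  · refine Integrable.mono' hi (by simp only [ContinuousLinearMap.mul_apply']; fun_prop)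
      (Eventually.of_forall fun z => ?_)
    simp only [ContinuousLinearMap.mul_apply', norm_mul, Real.norm_eq_abs, Real.abs_exp]
    exact mul_le_of_le_one_left (Real.exp_pos _).le (Real.abs_sin_le_one _)

theorem integrableOn_rpow_mul_exp_neg {p b : ℝ} (hp : 0 < p) (hb : 0 < b) :
    IntegrableOn (fun t : ℝ => t ^ (p - 1) * Real.exp (-(b * t))) (Ioi 0) := by
  refine .of_integral_ne_zero ?_
  rw [Real.integral_rpow_mul_exp_neg_mul_Ioi hp hb]
  exact (mul_pos (Real.rpow_pos_of_pos (by positivity) _) (Real.Gamma_pos_of_pos hp)).ne'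

/-- The inversion t ↦ 1/t turns this into a Gamma integral. -/
theorem integrableOn_and_integral_rpow_mul_exp_neg_div {b : ℝ} (hb : 0 < b) :
    IntegrableOn (fun t : ℝ => t ^ (-(3 / 2) : ℝ) * Real.exp (-(b / t))) (Ioi 0) ∧
    ∫ t in Ioi (0 : ℝ), t ^ (-(3 / 2) : ℝ) * Real.exp (-(b / t))
      = (1 / b) ^ (1 / 2 : ℝ) * Real.Gamma (1 / 2) := by
  have h1 := integrableOn_rpow_mul_exp_neg (p := 1 / 2) (by norm_num) hb
  have h2 := Real.integral_rpow_mul_exp_neg_mul_Ioi (a := 1 / 2) (by norm_num) hb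
  have e : EqOn (fun x : ℝ => (|(-1 : ℝ)| * x ^ ((-1 : ℝ) - 1)) •
      (fun t : ℝ => t ^ ((1 / 2 : ℝ) - 1) * Real.exp (-(b * t))) (x ^ (-1 : ℝ)))
      (fun t : ℝ => t ^ (-(3 / 2) : ℝ) * Real.exp (-(b / t))) (Ioi 0) := by
    intro x hx
    have hx : 0 < x := hx
    simp only [abs_neg, abs_one, one_mul, smul_eq_mul]
    rw [← mul_assoc, ← Real.rpow_mul hx.le, ← Real.rpow_add hx, Real.rpow_neg_one, div_eq_mul_inv]
    norm_num [div_eq_mul_inv]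
  constructor
  · rw [← integrableOn_congr_fun e measurableSet_Ioi]
    exact (integrableOn_Ioi_comp_rpow_iff _ (by norm_num)).2 h1
  · rw [← h2, ← integral_comp_rpow_Ioi (fun t : ℝ => t ^ ((1 / 2 : ℝ) - 1) * Real.exp (-(b * t)))
      (by norm_num : (-1 : ℝ) ≠ 0)]
    exact (setIntegral_congr_fun measurableSet_Ioi e).symm

end Gaussian

/-! ### The symbol of the transform -/

section Symbol

variable {n : ℕ}

/-- Subordination: both inverse powers are Gamma integrals of Gaussians in r, which makes the kernel
a superposition of Gaussians with explicit Fourier transforms. -/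
theorem profile_eq_integral (a : ℝ) {r : ℝ} (hr : 0 < r) :
    profile n a r = kerConst n / Real.Gamma (((n : ℝ) + 1) / 2) *
      ∫ t in Ioi (0 : ℝ), t ^ (((n : ℝ) + 1) / 2 - 1) * (1 - Real.exp (-(a ^ 2 * t))) *
        Real.exp (-(r ^ 2 * t)) := by
  have hp : 0 < ((n : ℝ) + 1) / 2 := by positivity
  have hr2 : 0 < r ^ 2 := by positivity
  have hra : 0 < r ^ 2 + a ^ 2 := by positivity
  have h1 : ∀ t : ℝ, t ^ (((n : ℝ) + 1) / 2 - 1) * (1 - Real.exp (-(a ^ 2 * t))) *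
        Real.exp (-(r ^ 2 * t)) = t ^ (((n : ℝ) + 1) / 2 - 1) * Real.exp (-(r ^ 2 * t))
        - t ^ (((n : ℝ) + 1) / 2 - 1) * Real.exp (-((r ^ 2 + a ^ 2) * t)) := by
    intro t
    rw [add_mul, neg_add, Real.exp_add]; ring
  simp_rw [h1]
  rw [integral_sub (integrableOn_rpow_mul_exp_neg hp hr2) (integrableOn_rpow_mul_exp_neg hp hra),
    Real.integral_rpow_mul_exp_neg_mul_Ioi hp hr2, Real.integral_rpow_mul_exp_neg_mul_Ioi hp hra,
    ← sub_mul, one_div, one_div, Real.inv_rpow hr2.le, Real.inv_rpow hra.le,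
    sq_rpow_half_succ hr.le, profile]
  have := (Real.Gamma_pos_of_pos hp).ne'
  field_simp

theorem integrableOn_subordination (a : ℝ) {r : ℝ} (hr : 0 < r) :
    IntegrableOn (fun t : ℝ => t ^ (((n : ℝ) + 1) / 2 - 1) * (1 - Real.exp (-(a ^ 2 * t))) *
      Real.exp (-(r ^ 2 * t))) (Ioi 0) := by
  have hp : 0 < ((n : ℝ) + 1) / 2 := by positivity
  have hr2 : 0 < r ^ 2 := by positivity
  refine Integrable.mono' (integrableOn_rpow_mul_exp_neg hp hr2)
    (by fun_prop) ((ae_restrict_iff' measurableSet_Ioi).2 (Eventually.of_forall fun t ht => ?_))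
  have ht : 0 < t := ht
  have h1 : 0 ≤ 1 - Real.exp (-(a ^ 2 * t)) := by
    have : Real.exp (-(a ^ 2 * t)) ≤ 1 := Real.exp_le_one_iff.2 (by
      have : 0 ≤ a ^ 2 * t := by positivity
      linarith)
    linarith
  have h2 : 0 ≤ t ^ (((n : ℝ) + 1) / 2 - 1) := Real.rpow_nonneg ht.le _
  rw [Real.norm_eq_abs, abs_of_nonneg (by positivity)]
  refine mul_le_mul_of_nonneg_right (mul_le_of_le_one_right h2 ?_) (Real.exp_pos _).le
  have := Real.exp_pos (-(a ^ 2 * t))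
  linarith

/-- The odd symbol `ζ ↦ ∫ sin (2π z·ζ) K_a(z) dz` of the transform. -/
def symb (a : ℝ) (ζ : Space n) : Space n :=
  ∫ z, Real.sin (2 * Real.pi * ⟪z, ζ⟫) • kernel a z

theorem abs_sin_inner_le (z ζ : Space n) :
    |Real.sin (2 * Real.pi * ⟪z, ζ⟫)| ≤ (1 + 2 * Real.pi * ‖ζ‖) * min 1 ‖z‖ := by
  have hpi := Real.pi_pos
  rcases le_total 1 ‖z‖ with h | h
  · rw [min_eq_left h, mul_one]
    have : 0 ≤ 2 * Real.pi * ‖ζ‖ := by positivity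
    linarith [Real.abs_sin_le_one (2 * Real.pi * ⟪z, ζ⟫)]
  · rw [min_eq_right h]
    have h1 : |Real.sin (2 * Real.pi * ⟪z, ζ⟫)| ≤ |2 * Real.pi * ⟪z, ζ⟫| := Real.abs_sin_le_abs
    rw [abs_mul, abs_of_pos (by positivity : 0 < 2 * Real.pi)] at h1
    have h2 := mul_le_mul_of_nonneg_left (abs_real_inner_le_norm z ζ)
      (by positivity : 0 ≤ 2 * Real.pi)
    nlinarith [norm_nonneg z]

theorem norm_sin_smul_kernel_le (a : ℝ) (z ζ : Space n) :
    ‖Real.sin (2 * Real.pi * ⟪z, ζ⟫) • kernel a z‖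
      ≤ (1 + 2 * Real.pi * ‖ζ‖) * (min 1 ‖z‖ * ‖kernel a z‖) := by
  rw [norm_smul, Real.norm_eq_abs, ← mul_assoc]
  exact mul_le_mul_of_nonneg_right (abs_sin_inner_le z ζ) (norm_nonneg _)

theorem integrable_sin_smul_kernel [NeZero n] (a : ℝ) (ζ : Space n) :
    Integrable (fun z => Real.sin (2 * Real.pi * ⟪z, ζ⟫) • kernel a z) := by
  refine Integrable.mono' ((integrable_min_mul_norm_kernel a).const_mul (1 + 2 * Real.pi * ‖ζ‖))
    ?_ (Eventually.of_forall fun z => norm_sin_smul_kernel_le a z ζ)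
  have h : Continuous fun z : Space n => Real.sin (2 * Real.pi * ⟪z, ζ⟫) := by fun_prop
  exact h.aestronglyMeasurable.smul (measurable_kernel a).aestronglyMeasurable

theorem measurable_symb (a : ℝ) : Measurable (symb a : Space n → Space n) := by
  have h1 : Continuous fun p : Space n × Space n => Real.sin (2 * Real.pi * ⟪p.2, p.1⟫) := by
    fun_prop
  have h : StronglyMeasurable (fun p : Space n × Space n =>
      Real.sin (2 * Real.pi * ⟪p.2, p.1⟫) • kernel a p.2) :=
    (h1.measurable.smul ((measurable_kernel a).comp measurable_snd)).stronglyMeasurable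
  exact h.integral_prod_right.measurable

theorem symb_neg (a : ℝ) (ζ : Space n) : symb a (-ζ) = -symb a ζ := by
  rw [symb, symb, ← integral_neg]
  congr 1
  funext z
  rw [inner_neg_right, mul_neg, Real.sin_neg, neg_smul]

/-- A bound for the symbol. -/
def symbConst (n : ℕ) : ℝ :=
  kerConst n / Real.Gamma (((n : ℝ) + 1) / 2) * Real.pi ^ ((n : ℝ) / 2) * Real.Gamma (1 / 2)

theorem inner_symb [NeZero n] (a : ℝ) (ζ e : Space n) :
    ⟪symb a ζ, e⟫ = ∫ t in Ioi (0 : ℝ), kerConst n / Real.Gamma (((n : ℝ) + 1) / 2) *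
      (t ^ (((n : ℝ) + 1) / 2 - 1) * (1 - Real.exp (-(a ^ 2 * t)))) *
      (Real.pi / t * ⟪ζ, e⟫ * ((Real.pi / t) ^ ((n : ℝ) / 2)
        * Real.exp (-(Real.pi ^ 2 * ‖ζ‖ ^ 2 / t)))) := by
  set k := kerConst n / Real.Gamma (((n : ℝ) + 1) / 2) with hk
  set F : Space n → ℝ → ℝ := fun z t => k * (t ^ (((n : ℝ) + 1) / 2 - 1) *
    (1 - Real.exp (-(a ^ 2 * t)))) * (Real.sin (2 * Real.pi * ⟪z, ζ⟫) *
      (⟪z, e⟫ * Real.exp (-(‖z‖ ^ 2 * t)))) with hF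
  have hk0 : 0 ≤ k := div_nonneg (kerConst_pos n).le (Real.Gamma_nonneg_of_nonneg (by positivity))
  have hn : 1 ≤ n := Nat.one_le_iff_ne_zero.2 (NeZero.ne n)
  have : Nontrivial (Space n) := Module.nontrivial_of_finrank_pos (R := ℝ) (by simp; omega)
  have hne : ∀ᵐ z : Space n, z ≠ 0 := by
    rw [ae_iff]; simp
  have e1 : ∀ z t, F z t = (Real.sin (2 * Real.pi * ⟪z, ζ⟫) * ⟪z, e⟫ * k) *
      (t ^ (((n : ℝ) + 1) / 2 - 1) * (1 - Real.exp (-(a ^ 2 * t))) *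
        Real.exp (-(‖z‖ ^ 2 * t))) := by
    intro z t; simp only [hF]; ring
  have hint : ∀ z : Space n, z ≠ 0 → ∫ t in Ioi (0 : ℝ), F z t
      = Real.sin (2 * Real.pi * ⟪z, ζ⟫) * ⟪kernel a z, e⟫ := by
    intro z hz
    simp_rw [e1]
    rw [integral_const_mul, kernel_eq, real_inner_smul_left,
      profile_eq_integral a (norm_pos_iff.2 hz)]
    ring
  -- For fixed z the integrand keeps one sign in t, so integrating its absolute value loses nothing.
  -- This gives the joint integrability that Fubini needs.
  have hnorm : ∀ z : Space n, z ≠ 0 → ∫ t in Ioi (0 : ℝ), ‖F z t‖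
      = |Real.sin (2 * Real.pi * ⟪z, ζ⟫) * ⟪kernel a z, e⟫| := by
    intro z hz
    have e2 : ∀ t ∈ Ioi (0 : ℝ), ‖F z t‖ = (|Real.sin (2 * Real.pi * ⟪z, ζ⟫) * ⟪z, e⟫| * k) *
      (t ^ (((n : ℝ) + 1) / 2 - 1) * (1 - Real.exp (-(a ^ 2 * t))) *
        Real.exp (-(‖z‖ ^ 2 * t))) := by
      intro t ht
      have ht : 0 < t := ht
      have h1 : 0 ≤ 1 - Real.exp (-(a ^ 2 * t)) := by
        have : Real.exp (-(a ^ 2 * t)) ≤ 1 := Real.exp_le_one_iff.2 (by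
          have : 0 ≤ a ^ 2 * t := by positivity
          linarith)
        linarith
      have h2 : 0 ≤ t ^ (((n : ℝ) + 1) / 2 - 1) := Real.rpow_nonneg ht.le _
      rw [e1, norm_mul, norm_mul, Real.norm_eq_abs, Real.norm_eq_abs, Real.norm_eq_abs,
        abs_of_nonneg hk0, abs_of_nonneg (mul_nonneg (mul_nonneg h2 h1) (Real.exp_pos _).le)]
    rw [setIntegral_congr_fun measurableSet_Ioi e2, integral_const_mul, kernel_eq,
      real_inner_smul_left, mul_left_comm, abs_mul (profile n a ‖z‖),
      abs_of_nonneg (profile_nonneg a (norm_pos_iff.2 hz)),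
      profile_eq_integral a (norm_pos_iff.2 hz)]
    ring
  have hFm : Measurable (Function.uncurry F) := by
    have : Function.uncurry F = fun q : Space n × ℝ => k * (q.2 ^ (((n : ℝ) + 1) / 2 - 1) *
      (1 - Real.exp (-(a ^ 2 * q.2)))) * (Real.sin (2 * Real.pi * ⟪q.1, ζ⟫) *
      (⟪q.1, e⟫ * Real.exp (-(‖q.1‖ ^ 2 * q.2)))) := rfl
    rw [this]
    have h1 : Measurable fun q : Space n × ℝ => q.2 ^ (((n : ℝ) + 1) / 2 - 1) :=
      measurable_snd.pow_const _
    exact (measurable_const.mul (h1.mul (Continuous.measurable (by fun_prop)))).mul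
      (Continuous.measurable (by fun_prop))
  have hsin : Integrable (fun z => Real.sin (2 * Real.pi * ⟪z, ζ⟫) * ⟪kernel a z, e⟫) := by
    have := (integrable_sin_smul_kernel a ζ).inner_const (𝕜 := ℝ) e
    simpa only [real_inner_smul_left] using this
  have hFi : Integrable (Function.uncurry F)
      ((volume : Measure (Space n)).prod (volume.restrict (Ioi (0 : ℝ)))) := by
    refine (integrable_prod_iff hFm.aestronglyMeasurable).2 ⟨?_, ?_⟩
    · filter_upwards [hne] with z hz
      have := (integrableOn_subordination (n := n) a (norm_pos_iff.2 hz)).const_mul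
        (Real.sin (2 * Real.pi * ⟪z, ζ⟫) * ⟪z, e⟫ * k)
      refine this.congr (Eventually.of_forall fun t => ?_)
      exact (e1 z t).symm
    · refine hsin.abs.congr ?_
      filter_upwards [hne] with z hz
      exact (hnorm z hz).symm
  have step : ⟪symb a ζ, e⟫ = ∫ z, ∫ t in Ioi (0 : ℝ), F z t := by
    rw [symb, real_inner_comm, ← integral_inner (integrable_sin_smul_kernel a ζ)]
    refine integral_congr_ae ?_
    filter_upwards [hne] with z hz
    rw [hint z hz, real_inner_comm, real_inner_smul_left]
  rw [step, integral_integral_swap hFi]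
  refine setIntegral_congr_fun measurableSet_Ioi fun t ht => ?_
  simp only [hF]
  rw [integral_const_mul, integral_sin_mul_inner_mul_exp_neg_mul_sq_norm ht]

/-- Bounding 1 - e^(-a²t) by 1 removes a and leaves the Riesz transform. The powers of t combine to
t^(-3/2), whose integral is a multiple of 1/|ζ| and cancels the factor |ζ|. -/
theorem abs_inner_symb_le [NeZero n] (a : ℝ) (ζ e : Space n) :
    |⟪symb a ζ, e⟫| ≤ symbConst n * ‖e‖ := by
  have hpi := Real.pi_pos
  have hk0 : 0 ≤ kerConst n / Real.Gamma (((n : ℝ) + 1) / 2) :=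
    div_nonneg (kerConst_pos n).le (Real.Gamma_nonneg_of_nonneg (by positivity))
  rcases eq_or_ne ζ 0 with rfl | hζ
  · have : symb a (0 : Space n) = 0 := by simp [symb]
    rw [this, inner_zero_left, abs_zero]
    exact mul_nonneg (mul_nonneg (mul_nonneg hk0 (by positivity))
      (Real.Gamma_nonneg_of_nonneg (by norm_num))) (norm_nonneg _)
  have hζ' : 0 < ‖ζ‖ := norm_pos_iff.2 hζ
  obtain ⟨hi, hv⟩ := integrableOn_and_integral_rpow_mul_exp_neg_div
    (b := Real.pi ^ 2 * ‖ζ‖ ^ 2) (by positivity)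
  set k := kerConst n / Real.Gamma (((n : ℝ) + 1) / 2) with hk
  rw [inner_symb, ← hk, ← Real.norm_eq_abs]
  refine (norm_integral_le_of_norm_le (hi.const_mul (k * Real.pi ^ ((n : ℝ) / 2) *
    (Real.pi * (‖ζ‖ * ‖e‖)))) ((ae_restrict_iff' measurableSet_Ioi).2
      (Eventually.of_forall fun t ht => ?_))).trans ?_
  · have ht : 0 < t := ht
    have h1 : 0 ≤ 1 - Real.exp (-(a ^ 2 * t)) := by
      have : Real.exp (-(a ^ 2 * t)) ≤ 1 := Real.exp_le_one_iff.2 (by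
        have : 0 ≤ a ^ 2 * t := by positivity
        linarith)
      linarith
    have h1' : 1 - Real.exp (-(a ^ 2 * t)) ≤ 1 := by
      linarith [Real.exp_pos (-(a ^ 2 * t))]
    have h2 : 0 ≤ t ^ (((n : ℝ) + 1) / 2 - 1) := Real.rpow_nonneg ht.le _
    have h3 : t ^ (-(3 / 2) : ℝ) = t ^ (((n : ℝ) + 1) / 2 - 1) * t⁻¹ * (t ^ ((n : ℝ) / 2))⁻¹ := by
      rw [← Real.rpow_neg_one, ← Real.rpow_neg ht.le, ← Real.rpow_add ht, ← Real.rpow_add ht]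
      congr 1; ring
    have h4 := abs_real_inner_le_norm ζ e
    rw [h3, norm_mul, norm_mul, norm_mul, norm_mul, norm_mul, norm_mul, Real.norm_eq_abs ⟪ζ, e⟫,
      Real.norm_of_nonneg hk0, Real.norm_of_nonneg h2, Real.norm_of_nonneg h1,
      Real.norm_of_nonneg (by positivity : 0 ≤ Real.pi / t),
      Real.norm_of_nonneg (by positivity : 0 ≤ (Real.pi / t) ^ ((n : ℝ) / 2)),
      Real.norm_of_nonneg (Real.exp_pos _).le, Real.div_rpow hpi.le ht.le]
    calc _ ≤ k * (t ^ (((n : ℝ) + 1) / 2 - 1) * 1) * (Real.pi / t * (‖ζ‖ * ‖e‖) *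
          (Real.pi ^ ((n : ℝ) / 2) / t ^ ((n : ℝ) / 2) *
            Real.exp (-(Real.pi ^ 2 * ‖ζ‖ ^ 2 / t)))) := by gcongr
      _ = _ := by simp only [div_eq_mul_inv]; ring
  · rw [integral_const_mul, hv, symbConst, ← hk]
    have h5 : (1 / (Real.pi ^ 2 * ‖ζ‖ ^ 2)) ^ (1 / 2 : ℝ) = (Real.pi * ‖ζ‖)⁻¹ := by
      rw [← mul_pow, ← Real.sqrt_eq_rpow, one_div, Real.sqrt_inv, Real.sqrt_sq (by positivity)]
    rw [h5]
    refine le_of_eq ?_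
    field_simp

theorem norm_symb_le [NeZero n] (a : ℝ) (ζ : Space n) : ‖symb a ζ‖ ≤ symbConst n := by
  rcases eq_or_ne (symb a ζ) 0 with h | h
  -- A unit vector is used only to see that the constant is nonnegative.
  · have h0 := abs_inner_symb_le a (0 : Space n) (EuclideanSpace.single 0 1)
    rw [h, norm_zero]
    have h1 : ‖(EuclideanSpace.single (0 : Fin n) (1 : ℝ) : Space n)‖ = 1 := by simp
    rw [h1, mul_one] at h0
    exact (abs_nonneg _).trans h0
  · have h1 := abs_inner_symb_le a ζ (symb a ζ)
    rw [real_inner_self_eq_norm_sq, abs_of_nonneg (by positivity), sq] at h1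
    exact le_of_mul_le_mul_right h1 (norm_pos_iff.2 h)

theorem isVel_symb [NeZero n] (a : ℝ) {κ : ℝ} (hκ : 0 ≤ κ) :
    IsVel (fun ζ : Space n => κ • symb a ζ) (κ * symbConst n) where
  measurable := (measurable_symb a).const_smul κ
  odd ζ := by rw [symb_neg, smul_neg]
  le ζ := by
    rw [norm_smul, Real.norm_of_nonneg hκ]
    exact mul_le_mul_of_nonneg_left (norm_symb_le a ζ) hκ

end Symbol

/-! ### Inverse Fourier integrals -/

section Synthesis

open scoped ComplexConjugate SchwartzMap

variable {n : ℕ}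

/-- The character `e^{2πi x·ξ}`. -/
def wave (x ξ : Space n) : ℂ := Complex.exp (((2 * Real.pi * ⟪ξ, x⟫ : ℝ) : ℂ) * Complex.I)

theorem norm_wave (x ξ : Space n) : ‖wave x ξ‖ = 1 := Complex.norm_exp_ofReal_mul_I _

theorem continuous_wave (x : Space n) : Continuous (wave x) := by
  unfold wave; fun_prop

theorem wave_neg (x ξ : Space n) : wave x (-ξ) = conj (wave x ξ) := by
  rw [wave, wave, ← Complex.exp_conj, map_mul, Complex.conj_ofReal, Complex.conj_I,
    inner_neg_left]
  congr 1; push_cast; ring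

theorem wave_add (x ξ η : Space n) : wave x (ξ + η) = wave x ξ * wave x η := by
  rw [wave, wave, wave, ← Complex.exp_add, inner_add_left]
  congr 1; push_cast; ring

/-- The inverse Fourier integral `∫ e^{2πi x·ξ} w(ξ) dξ`. -/
def synth (w : Space n → ℂ) (x : Space n) : ℂ := ∫ ξ, wave x ξ * w ξ

theorem synth_eq (w : Space n → ℂ) : synth w = 𝓕⁻ w := by
  funext x
  rw [Real.fourierInv_eq']
  rfl

theorem synth_congr {w w' : Space n → ℂ} (h : w =ᵐ[volume] w') : synth w = synth w' := by
  funext x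
  refine integral_congr_ae ?_
  filter_upwards [h] with ξ hξ
  rw [hξ]

theorem integrable_wave_mul {w : Space n → ℂ} (hw : Integrable w) (x : Space n) :
    Integrable (fun ξ => wave x ξ * w ξ) := by
  refine hw.bdd_mul (c := 1) (continuous_wave x).aestronglyMeasurable ?_
  exact Eventually.of_forall fun ξ => (norm_wave x ξ).le

theorem continuous_synth {w : Space n → ℂ} (hw : Integrable w) : Continuous (synth w) := by
  rw [synth_eq, Real.fourierInv_eq_fourier_comp_neg]
  exact VectorFourier.fourierIntegral_continuous Real.continuous_fourierChar
    (by exact continuous_inner) hw.comp_neg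

theorem norm_synth_le (w : Space n → ℂ) (x : Space n) : ‖synth w x‖ ≤ ∫ ξ, ‖w ξ‖ := by
  refine (norm_integral_le_integral_norm _).trans (le_of_eq ?_)
  simp_rw [norm_mul, norm_wave, one_mul]

/-- The `L²` inverse Fourier transform of an integrable function is its inverse Fourier
integral. -/
theorem fourierInv_ae_eq_synth (w : L2C n) (hw : Integrable w) :
    (𝓕⁻ w : L2C n) =ᵐ[volume] synth w := by
  refine ae_eq_of_integral_contDiff_smul_eq ((Lp.memLp _).locallyIntegrable one_le_two)
    (continuous_synth hw).locallyIntegrable fun g hg hgc => ?_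
  have hgC : ContDiff ℝ (↑(⊤ : ℕ∞)) (fun x => (g x : ℂ)) := Complex.ofRealCLM.contDiff.comp hg
  have hgcC : HasCompactSupport (fun x => (g x : ℂ)) := hgc.comp_left Complex.ofReal_zero
  set φ : 𝓢(Space n, ℂ) := hgcC.toSchwartzMap hgC with hφ
  have hφx : ∀ x, φ x = (g x : ℂ) := fun x => rfl
  -- The L² inverse transform agrees with the distributional one; the Fourier integral is then moved
  -- between test function and w by its symmetry.
  have h1 := congrArg (fun f => f φ) (Lp.fourierInv_toTemperedDistribution_eq w)
  simp only [TemperedDistribution.fourierInv_apply, Lp.toTemperedDistribution_apply] at h1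
  have e1 : ∫ x, g x • (𝓕⁻ w : L2C n) x = ∫ x, φ x • (𝓕⁻ w : L2C n) x := by
    simp_rw [hφx]; rfl
  have e2 : ∫ x, g x • synth w x = ∫ x, φ x • synth w x := by
    simp_rw [hφx]; rfl
  rw [e1, e2, ← h1, SchwartzMap.fourierInv_coe, synth_eq, Real.fourierInv_eq_fourier_comp_neg]
  have h2 := VectorFourier.integral_fourierIntegral_smul_eq_flip (f := fun x => φ (-x)) (g := w)
    (μ := (volume : Measure (Space n))) (ν := (volume : Measure (Space n)))
    (L := innerₗ (Space n)) Real.continuous_fourierChar (by exact continuous_inner)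
    φ.integrable.comp_neg hw
  rw [flip_innerₗ] at h2
  refine Eq.trans h2 ?_
  rw [← integral_neg_eq_self]
  refine integral_congr_ae (Eventually.of_forall fun x => ?_)
  simp only [neg_neg]
  congr 1
  rw [Real.fourierInv_eq_fourier_neg]
  rfl

theorem synth_conjRefl (w : L2C n) (x : Space n) : synth (conjRefl w) x = conj (synth w x) := by
  rw [synth_congr (coeFn_conjRefl w), synth, synth, ← integral_conj, ← integral_neg_eq_self]
  refine integral_congr_ae (Eventually.of_forall fun ξ => ?_)
  simp only [neg_neg, wave_neg, map_mul]

theorem integrable_conjRefl {w : L2C n} (hw : Integrable w) : Integrable (conjRefl w) := by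
  refine Integrable.congr ?_ (coeFn_conjRefl w).symm
  have h := hw.comp_neg
  exact (Complex.conjCLE.toContinuousLinearMap).integrable_comp h

theorem synth_real {w : L2C n} (hw : conjRefl w = w) (x : Space n) :
    ((synth w x).re : ℂ) = synth w x := by
  have h := synth_conjRefl w x
  rw [hw] at h
  exact Complex.conj_eq_iff_re.1 h.symm

theorem fourierInv_fhat (f : L2 n) :
    (𝓕⁻ (fhat f) : L2C n) =ᵐ[volume] fun x => ((f x : ℝ) : ℂ) := by
  rw [fhat, FourierTransform.fourierInv_fourier_eq]
  exact ContinuousLinearMap.coeFn_compLpL _ f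

theorem norm_fhat (f : L2 n) : ‖fhat f‖ = ‖f‖ := by
  rw [fhat, Lp.norm_fourier_eq]
  refine le_antisymm (Lp.norm_le_norm_of_ae_le ?_) (Lp.norm_le_norm_of_ae_le ?_) <;>
    filter_upwards [ContinuousLinearMap.coeFn_compLpL (p := 2) (μ := volume) Complex.ofRealCLM f]
      with x hx <;> rw [hx] <;> simp

theorem fhat_injective : Function.Injective (fhat : L2 n → L2C n) := by
  intro f g h
  have h1 := fourierInv_fhat f
  rw [h] at h1
  refine Lp.ext ?_
  filter_upwards [h1, fourierInv_fhat g] with x e1 e2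
  exact Complex.ofReal_injective (e1.symm.trans e2)

theorem ae_eq_synth_re {f : L2 n} (hw : Integrable (fhat f)) :
    (f : Space n → ℝ) =ᵐ[volume] fun x => (synth (fhat f) x).re := by
  filter_upwards [fourierInv_fhat f, fourierInv_ae_eq_synth _ hw] with x h1 h2
  rw [← h2, h1, Complex.ofReal_re]

/-- Integrability allows the inverse transforms to be compared pointwise: conjugate reflection
becomes conjugation, which fixes a real function. -/
theorem conjRefl_fhat {f : L2 n} (hw : Integrable (fhat f)) : conjRefl (fhat f) = fhat f := by
  have h : (𝓕⁻ (conjRefl (fhat f)) : L2C n) = 𝓕⁻ (fhat f) := by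
    refine Lp.ext ?_
    filter_upwards [fourierInv_fhat f, fourierInv_ae_eq_synth _ hw,
      fourierInv_ae_eq_synth _ (integrable_conjRefl hw)] with x h1 h2 h3
    rw [h3, synth_conjRefl, ← h2, h1, Complex.conj_ofReal]
  have h' := congrArg (fun u : L2C n => (𝓕 u : L2C n)) h
  simpa only [FourierTransform.fourier_fourierInv_eq] using h'

theorem exists_fhat_eq {w : L2C n} (hw : Integrable w) (hJ : conjRefl w = w) :
    ∃ f : L2 n, fhat f = w := by
  refine ⟨Complex.reCLM.compLpL 2 volume (𝓕⁻ w : L2C n), ?_⟩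
  have h : (Complex.ofRealCLM.compLpL 2 (volume : Measure (Space n))
      (Complex.reCLM.compLpL 2 volume (𝓕⁻ w : L2C n)) : L2C n) = 𝓕⁻ w := by
    refine Lp.ext ?_
    filter_upwards [fourierInv_ae_eq_synth _ hw,
      ContinuousLinearMap.coeFn_compLpL (p := 2) (μ := volume) Complex.reCLM (𝓕⁻ w : L2C n),
      ContinuousLinearMap.coeFn_compLpL (p := 2) (μ := volume) Complex.ofRealCLM
        (Complex.reCLM.compLpL 2 volume (𝓕⁻ w : L2C n))] with x h1 h2 h3
    rw [h3, h2, h1, Complex.reCLM_apply, Complex.ofRealCLM_apply, synth_real hJ]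
  rw [fhat, h, FourierTransform.fourier_fourierInv_eq]

theorem eq_zero_of_synth_eq_zero {w : L2C n} (hw : Integrable w) (h : ∀ x, synth w x = 0) :
    w = 0 := by
  have h0 : (𝓕⁻ w : L2C n) = 0 := by
    refine Lp.ext ?_
    filter_upwards [fourierInv_ae_eq_synth _ hw, Lp.coeFn_zero ℂ 2 (volume : Measure (Space n))]
      with x h1 h2
    rw [h1, h2, h x, Pi.zero_apply]
  have h' := congrArg (fun u : L2C n => (𝓕 u : L2C n)) h0
  simp only [FourierTransform.fourier_fourierInv_eq] at h'
  rw [h']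
  exact FourierTransform.fourier_zero

end Synthesis

/-! ### Sobolev functions on the Fourier side -/

section Sobolev

variable {n : ℕ} {σ : ℝ}

theorem br_rpow_le (hσ : 0 ≤ σ) (ξ : Space n) :
    br ξ ^ σ ≤ 2 ^ σ * (1 + (2 * Real.pi * ‖ξ‖) ^ σ) := by
  have hpi := Real.pi_gt_three
  have h2 : (0 : ℝ) ≤ 2 ^ σ := by positivity
  rcases le_total ‖ξ‖ 1 with h | h
  · have h1 : br ξ ^ σ ≤ 2 ^ σ := Real.rpow_le_rpow (br_pos ξ).le (by simp only [br]; linarith) hσ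
    have h3 : 0 ≤ (2 * Real.pi * ‖ξ‖) ^ σ := by positivity
    nlinarith
  · have h1 : br ξ ^ σ ≤ (2 * (2 * Real.pi * ‖ξ‖)) ^ σ :=
      Real.rpow_le_rpow (br_pos ξ).le (by simp only [br]; nlinarith) hσ
    rw [Real.mul_rpow two_pos.le (by positivity)] at h1
    nlinarith

theorem rpow_mul_br_rpow_neg_le (hσ : 0 ≤ σ) (ξ : Space n) :
    (2 * Real.pi * ‖ξ‖) ^ σ * br ξ ^ (-σ) ≤ (2 * Real.pi) ^ σ := by
  have hpi := Real.pi_pos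
  rw [Real.mul_rpow (by positivity) (norm_nonneg _), mul_assoc]
  refine mul_le_of_le_one_right (by positivity) ?_
  rw [Real.rpow_neg (br_pos ξ).le, ← div_eq_mul_inv,
    div_le_one (Real.rpow_pos_of_pos (br_pos ξ) _)]
  exact Real.rpow_le_rpow (norm_nonneg _) (norm_le_br ξ) hσ

theorem memLp_fracSymbol_toL2 (f : Hs n σ) : MemLp (fracSymbol σ (Hs.toL2 f)) 2 volume :=
  memLp_fracSymbol (n := n) (s := σ) f

theorem norm_fracLap (f : Hs n σ) :
    ‖fracLap f‖ = ‖((memLp_fracSymbol_toL2 f).toLp : L2C n)‖ := by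
  have h : fracLap f = 𝓕⁻ ((memLp_fracSymbol_toL2 f).toLp : L2C n) := rfl
  rw [h, ← Lp.norm_fourier_eq, FourierTransform.fourier_fourierInv_eq]

theorem norm_br_mul_fhat_le (hσ : 0 ≤ σ) (f : L2 n) (ξ : Space n) :
    ‖((br ξ ^ σ : ℝ) : ℂ) * fhat f ξ‖ ≤ 2 ^ σ * ‖(‖fhat f ξ‖ + ‖fracSymbol σ f ξ‖)‖ := by
  have hpi := Real.pi_pos
  rw [fracSymbol, norm_mul, norm_mul, Complex.norm_real, Complex.norm_real,
    Real.norm_of_nonneg (br_rpow_nonneg σ ξ),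
    Real.norm_of_nonneg (by positivity : 0 ≤ (2 * Real.pi * ‖ξ‖) ^ σ),
    Real.norm_of_nonneg (by positivity)]
  calc _ ≤ 2 ^ σ * (1 + (2 * Real.pi * ‖ξ‖) ^ σ) * ‖fhat f ξ‖ :=
        mul_le_mul_of_nonneg_right (br_rpow_le hσ ξ) (norm_nonneg _)
    _ = _ := by ring

theorem aestronglyMeasurable_br_mul_fhat (σ : ℝ) (f : L2 n) :
    AEStronglyMeasurable (fun ξ => ((br ξ ^ σ : ℝ) : ℂ) * fhat f ξ) volume :=
  (Complex.measurable_ofReal.comp (measurable_br_rpow σ)).aestronglyMeasurable.mul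
    (Lp.memLp (fhat f)).1

theorem memLp_br_mul_fhat (hσ : 0 ≤ σ) (f : Hs n σ) :
    MemLp (fun ξ => ((br ξ ^ σ : ℝ) : ℂ) * fhat (Hs.toL2 f) ξ) 2 volume :=
  MemLp.of_le_mul ((Lp.memLp (fhat (Hs.toL2 f))).norm.add (memLp_fracSymbol_toL2 f).norm)
    (aestronglyMeasurable_br_mul_fhat σ _)
    (Eventually.of_forall fun ξ => norm_br_mul_fhat_le hσ _ ξ)

/-- The weighted Fourier transform `(1+|ξ|)^σ f̂(ξ)` of a Sobolev function. -/
def lift (hσ : 0 ≤ σ) (f : Hs n σ) : L2C n := (memLp_br_mul_fhat hσ f).toLp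

theorem lower_lift (hσ : 0 ≤ σ) (f : Hs n σ) : lower n σ hσ (lift hσ f) = fhat (Hs.toL2 f) := by
  refine Lp.ext ?_
  filter_upwards [coeFn_lower hσ (lift hσ f), (memLp_br_mul_fhat hσ f).coeFn_toLp] with ξ h1 h2
  rw [h1, lift, h2, ← mul_assoc, ← Complex.ofReal_mul, br_rpow_mul]
  simp

theorem lift_sub (hσ : 0 ≤ σ) (f g : Hs n σ) : lift hσ (f - g) = lift hσ f - lift hσ g := by
  refine lower_injective hσ ?_
  rw [map_sub, lower_lift, lower_lift, lower_lift, map_sub, sub_eq_add_neg, fhat_add,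
    sub_eq_add_neg]
  congr 1
  have := fhat_smul (-1) (Hs.toL2 g)
  simpa using this

theorem norm_lift_le (hσ : 0 ≤ σ) (f : Hs n σ) : ‖lift hσ f‖ ≤ 2 ^ σ * ‖f‖ := by
  have h1 := eLpNorm_le_mul_eLpNorm_of_ae_le_mul (p := 2) (μ := (volume : Measure (Space n)))
    (Eventually.of_forall fun ξ => norm_br_mul_fhat_le hσ (Hs.toL2 f) ξ)
  have h2 : eLpNorm (fun ξ => ‖fhat (Hs.toL2 f) ξ‖ + ‖fracSymbol σ (Hs.toL2 f) ξ‖) 2 volume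
      ≤ eLpNorm (fhat (Hs.toL2 f)) 2 volume + eLpNorm (fracSymbol σ (Hs.toL2 f)) 2 volume := by
    refine (eLpNorm_add_le (Lp.memLp (fhat (Hs.toL2 f))).norm.1
      (memLp_fracSymbol_toL2 f).norm.1 one_le_two).trans (le_of_eq ?_)
    rw [eLpNorm_norm, eLpNorm_norm]
  rw [Hs.norm_def, norm_fracLap, ← norm_fhat, Lp.norm_toLp, Lp.norm_def (fhat _), lift,
    Lp.norm_toLp, ← ENNReal.toReal_add (Lp.memLp _).2.ne (memLp_fracSymbol_toL2 f).2.ne,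
    ← ENNReal.toReal_ofReal (by positivity : (0 : ℝ) ≤ 2 ^ σ), ← ENNReal.toReal_mul]
  refine ENNReal.toReal_mono ?_ (h1.trans (mul_le_mul_right h2 _))
  exact ENNReal.mul_ne_top ENNReal.ofReal_ne_top
    (ENNReal.add_ne_top.2 ⟨(Lp.memLp _).2.ne, (memLp_fracSymbol_toL2 f).2.ne⟩)

theorem norm_fracSymbol_le (hσ : 0 ≤ σ) {f : L2 n} {V : L2C n} (h : lower n σ hσ V = fhat f) :
    ∀ᵐ ξ, ‖fracSymbol σ f ξ‖ ≤ (2 * Real.pi) ^ σ * ‖V ξ‖ := by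
  have hpi := Real.pi_pos
  have h1 := coeFn_lower hσ V
  rw [h] at h1
  filter_upwards [h1] with ξ e
  rw [fracSymbol, e, ← mul_assoc, ← Complex.ofReal_mul, norm_mul, Complex.norm_real,
    Real.norm_of_nonneg (mul_nonneg (by positivity) (br_rpow_nonneg _ ξ))]
  exact mul_le_mul_of_nonneg_right (rpow_mul_br_rpow_neg_le hσ ξ) (norm_nonneg _)

theorem aestronglyMeasurable_fracSymbol (σ : ℝ) (f : L2 n) :
    AEStronglyMeasurable (fracSymbol σ f) volume := by
  refine AEStronglyMeasurable.mul ?_ (Lp.memLp (fhat f)).1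
  exact (Complex.measurable_ofReal.comp
    ((measurable_norm.const_mul (2 * Real.pi)).pow_const σ)).aestronglyMeasurable

theorem exists_toL2_eq (hσ : 0 ≤ σ) {f : L2 n} {V : L2C n} (h : lower n σ hσ V = fhat f) :
    ∃ F : Hs n σ, Hs.toL2 F = f :=
  ⟨(⟨f, MemLp.of_le_mul (Lp.memLp V) (aestronglyMeasurable_fracSymbol σ f)
    (norm_fracSymbol_le hσ h)⟩ : sobolevSubmodule n σ), rfl⟩

theorem norm_le_lift (hσ : 0 ≤ σ) (f : Hs n σ) :
    ‖f‖ ≤ (1 + (2 * Real.pi) ^ σ) * ‖lift hσ f‖ := by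
  have hl := lower_lift hσ f
  rw [Hs.norm_def, norm_fracLap, ← norm_fhat, ← hl, add_mul, one_mul]
  refine add_le_add ?_ ?_
  · have := norm_mulLp_le (isMult_br_rpow (n := n) (neg_nonpos.2 hσ)) (C := 1) (fun ξ => by
      rw [abs_of_nonneg (br_rpow_nonneg _ ξ)]; exact br_rpow_le_one (neg_nonpos.2 hσ) ξ)
      (lift hσ f)
    rwa [one_mul] at this
  · refine Lp.norm_le_mul_norm_of_ae_le_mul ?_
    filter_upwards [norm_fracSymbol_le hσ hl, (memLp_fracSymbol_toL2 f).coeFn_toLp] with ξ h1 h2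
    rw [h2]; exact h1

theorem lift_injective (hσ : 0 ≤ σ) : Function.Injective (lift hσ : Hs n σ → L2C n) := by
  intro f g h
  have h1 : ‖f - g‖ ≤ 0 := by
    refine (norm_le_lift hσ (f - g)).trans (le_of_eq ?_)
    rw [lift_sub, h, sub_self, norm_zero, mul_zero]
  exact sub_eq_zero.1 (norm_le_zero_iff.1 h1)

theorem continuousOn_lift {hσ : 0 ≤ σ} {S : Set ℝ} {ρ : ℝ → Hs n σ} (hρ : ContinuousOn ρ S) :
    ContinuousOn (fun t => lift hσ (ρ t)) S := by
  have hl : LipschitzWith (Real.toNNReal (2 ^ σ)) (lift hσ : Hs n σ → L2C n) := by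
    refine LipschitzWith.of_dist_le_mul fun f g => ?_
    rw [dist_eq_norm, dist_eq_norm, ← lift_sub, Real.coe_toNNReal _ (by positivity)]
    exact norm_lift_le hσ _
  exact hl.continuous.comp_continuousOn hρ

theorem dist_le_dist_lift (hσ : 0 ≤ σ) (f g : Hs n σ) :
    dist f g ≤ (1 + (2 * Real.pi) ^ σ) * dist (lift hσ f) (lift hσ g) := by
  rw [dist_eq_norm, dist_eq_norm, ← lift_sub]
  exact norm_le_lift hσ _

theorem continuousOn_of_lift (hσ : 0 ≤ σ) {S : Set ℝ} {ρ : ℝ → Hs n σ}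
    (h : ContinuousOn (fun t => lift hσ (ρ t)) S) : ContinuousOn ρ S := by
  intro t ht
  refine tendsto_iff_dist_tendsto_zero.2 ?_
  have h1 := (tendsto_iff_dist_tendsto_zero.1 (h t ht)).const_mul (1 + (2 * Real.pi) ^ σ)
  rw [mul_zero] at h1
  exact squeeze_zero (fun _ => dist_nonneg) (fun τ => dist_le_dist_lift hσ _ _) h1

theorem integrable_lower {hσ : 0 ≤ σ} (hσn : (n : ℝ) / 2 < σ) (V : L2C n) :
    Integrable (lower n σ hσ V) :=
  (memLp_one_iff_integrable.1 (memLp_mul_one (memLp_br_rpow hσn) (Lp.memLp V)).1).congr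
    (coeFn_lower hσ V).symm

theorem conjRefl_lower (hσ : 0 ≤ σ) (V : L2C n) :
    conjRefl (lower n σ hσ V) = lower n σ hσ (conjRefl V) :=
  conjRefl_mulLp _ (fun ξ => by rw [br_neg]) V

theorem conjRefl_lift {hσ : 0 ≤ σ} (hσn : (n : ℝ) / 2 < σ) (f : Hs n σ) :
    conjRefl (lift hσ f) = lift hσ f := by
  refine lower_injective hσ ?_
  rw [← conjRefl_lower, lower_lift]
  refine conjRefl_fhat ?_
  rw [← lower_lift hσ]
  exact integrable_lower hσn _

/-- Every Hermitian L² function is the weighted transform of a Sobolev function; σ > n/2 gives the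
integrability by which the inverse transform is seen to be real. -/
theorem exists_lift_eq (hσ : 0 ≤ σ) (hσn : (n : ℝ) / 2 < σ) {V : L2C n} (hV : conjRefl V = V) :
    ∃ f : Hs n σ, lift hσ f = V := by
  obtain ⟨f, hf⟩ := exists_fhat_eq (integrable_lower (hσ := hσ) hσn V)
    (by rw [conjRefl_lower, hV])
  obtain ⟨F, hF⟩ := exists_toL2_eq hσ hf.symm
  refine ⟨F, lower_injective hσ ?_⟩
  rw [lower_lift, hF, hf]

end Sobolev

/-! ### The classical representative and its transform -/

section Transform

open scoped ComplexConjugate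

variable {n : ℕ} {w : Space n → ℂ}

theorem eq_zero_of_eq_neg_self {v : Space n} (h : v = -v) : v = 0 := by
  have h2 : (2 : ℝ) • v = 0 := by
    rw [two_smul]
    nth_rewrite 1 [h]
    exact neg_add_cancel v
  exact (smul_eq_zero.1 h2).resolve_left two_ne_zero

theorem contDiff_synth (hw : Integrable w) (hw1 : Integrable (fun ξ => ‖ξ‖ * ‖w ξ‖)) :
    ContDiff ℝ 1 (synth w) := by
  rw [synth_eq, Real.fourierInv_eq_fourier_comp_neg]
  refine Real.contDiff_fourier (N := 1) fun k hk => ?_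
  have hk1 : k ≤ 1 := by exact_mod_cast hk
  interval_cases k
  · simpa using hw.comp_neg.norm
  · simpa using hw1.comp_neg

theorem hasGradientAt_synth_re (hw : Integrable w) (hw1 : Integrable (fun ξ => ‖ξ‖ * ‖w ξ‖))
    (x : Space n) : HasGradientAt (fun x => (synth w x).re)
      (-(2 * Real.pi) • ∫ ξ, (wave x ξ * w ξ).im • ξ) x := by
  have hw1' : Integrable (fun ξ => ‖ξ‖ * ‖w (-ξ)‖) := by simpa using hw1.comp_neg
  have h := Real.hasFDerivAt_fourier hw.comp_neg hw1' x
  rw [← Real.fourierInv_eq_fourier_comp_neg, ← synth_eq] at h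
  have h' := Complex.reCLM.hasFDerivAt.comp x h
  have hI : Integrable (fun ξ => (wave x ξ * w ξ).im • ξ) := by
    refine Integrable.mono' hw1 ((Complex.measurable_im.comp_aemeasurable
      (integrable_wave_mul hw x).1.aemeasurable).aestronglyMeasurable.smul
      aestronglyMeasurable_id) (Eventually.of_forall fun ξ => ?_)
    rw [norm_smul, mul_comm]
    refine mul_le_mul_of_nonneg_left ((Complex.abs_im_le_norm _).trans (le_of_eq ?_))
      (norm_nonneg _)
    rw [norm_mul, norm_wave, one_mul]
  rw [hasGradientAt_iff_hasFDerivAt]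
  refine h'.congr_fderiv ?_
  ext v
  have hs : Integrable (VectorFourier.fourierSMulRight (innerSL ℝ) (fun ξ => w (-ξ))) := by
    refine Integrable.mono' (hw1'.const_mul (2 * Real.pi * ‖innerSL ℝ (E := Space n)‖))
      hw.comp_neg.1.fourierSMulRight (Eventually.of_forall fun ξ => ?_)
    refine (VectorFourier.norm_fourierSMulRight_le _ _ _).trans (le_of_eq (by ring))
  rw [ContinuousLinearMap.comp_apply, Real.fourier_continuousLinearMap_apply hs,
    InnerProductSpace.toDual_apply_apply, real_inner_smul_left, real_inner_comm,
    ← integral_inner hI, Real.fourier_eq', ← integral_neg_eq_self]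
  have hJ : Integrable (fun ξ : Space n => Complex.exp (((-2 * Real.pi * ⟪-ξ, x⟫ : ℝ) : ℂ) *
      Complex.I) • (VectorFourier.fourierSMulRight (innerSL ℝ) (fun ξ => w (-ξ)) (-ξ)) v) := by
    have h1 := ((ContinuousLinearMap.apply ℝ ℂ v).integrable_comp hs).comp_neg
    refine h1.bdd_mul (c := 1) (Continuous.aestronglyMeasurable (by fun_prop))
      (Eventually.of_forall fun ξ => ?_)
    exact (Complex.norm_exp_ofReal_mul_I _).le
  rw [← ContinuousLinearMap.integral_comp_comm _ hJ, ← integral_const_mul]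
  refine integral_congr_ae (Eventually.of_forall fun ξ => ?_)
  simp only [VectorFourier.fourierSMulRight_apply, neg_neg, Complex.reCLM_apply]
  have e1 : Complex.exp (((-2 * Real.pi * ⟪-ξ, x⟫ : ℝ) : ℂ) * Complex.I) = wave x ξ := by
    rw [wave, inner_neg_left]; congr 3; ring
  have e2 : wave x ξ • -(2 * (Real.pi : ℂ) * Complex.I) • (innerSL ℝ (-ξ)) v • w ξ
      = ((2 * Real.pi * ⟪ξ, v⟫ : ℝ) : ℂ) * (Complex.I * (wave x ξ * w ξ)) := by
    simp only [innerSL_apply_apply, inner_neg_left, Complex.real_smul, smul_eq_mul]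
    push_cast; ring
  rw [e1, e2, Complex.re_ofReal_mul, Complex.I_mul_re, real_inner_comm, real_inner_smul_right,
    real_inner_comm]
  ring

/-- The kernel truncated near the origin. -/
def kerTrunc (a ε : ℝ) : Space n → Space n := {z | ε < ‖z‖}.indicator (kernel a)

theorem measurableSet_lt_norm (ε : ℝ) : MeasurableSet {z : Space n | ε < ‖z‖} :=
  measurableSet_lt measurable_const measurable_norm

theorem integrable_kerTrunc [NeZero n] (a : ℝ) {ε : ℝ} (hε : 0 < ε) :
    Integrable (kerTrunc a ε : Space n → Space n) :=
  (integrable_indicator_iff (measurableSet_lt_norm ε)).2 (integrableOn_kernel a hε)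

theorem measurable_kerTrunc (a ε : ℝ) : Measurable (kerTrunc a ε : Space n → Space n) :=
  (measurable_kernel a).indicator (measurableSet_lt_norm ε)

theorem kerTrunc_neg (a ε : ℝ) (z : Space n) : kerTrunc a ε (-z) = -kerTrunc a ε z := by
  by_cases h : ε < ‖z‖
  · have h' : ε < ‖-z‖ := by rwa [norm_neg]
    rw [kerTrunc, indicator_of_mem (by exact h'), indicator_of_mem (by exact h), kernel_neg]
  · have h' : ¬ ε < ‖-z‖ := by rwa [norm_neg]
    rw [kerTrunc, indicator_of_notMem (by exact h'), indicator_of_notMem (by exact h), neg_zero]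

theorem norm_kerTrunc_le (a ε : ℝ) (z : Space n) : ‖kerTrunc a ε z‖ ≤ ‖kernel a z‖ :=
  norm_indicator_le_norm_self _ _

/-- The symbol of the truncated transform. -/
def symbTrunc (a ε : ℝ) (ξ : Space n) : Space n :=
  ∫ z, Real.sin (2 * Real.pi * ⟪z, ξ⟫) • kerTrunc a ε z

theorem measurable_symbTrunc (a ε : ℝ) : Measurable (symbTrunc a ε : Space n → Space n) := by
  have h1 : Continuous fun p : Space n × Space n => Real.sin (2 * Real.pi * ⟪p.2, p.1⟫) := by
    fun_prop
  have h : StronglyMeasurable (fun p : Space n × Space n =>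
      Real.sin (2 * Real.pi * ⟪p.2, p.1⟫) • kerTrunc a ε p.2) :=
    (h1.measurable.smul ((measurable_kerTrunc a ε).comp measurable_snd)).stronglyMeasurable
  exact h.integral_prod_right.measurable

theorem norm_sin_smul_kerTrunc_le (a ε : ℝ) (z ξ : Space n) :
    ‖Real.sin (2 * Real.pi * ⟪z, ξ⟫) • kerTrunc a ε z‖
      ≤ (1 + 2 * Real.pi * ‖ξ‖) * (min 1 ‖z‖ * ‖kernel a z‖) := by
  refine le_trans ?_ (norm_sin_smul_kernel_le a z ξ)
  rw [norm_smul, norm_smul]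
  exact mul_le_mul_of_nonneg_left (norm_kerTrunc_le a ε z) (norm_nonneg _)

theorem norm_symbTrunc_le [NeZero n] (a ε : ℝ) (ξ : Space n) :
    ‖symbTrunc a ε ξ‖ ≤ (1 + 2 * Real.pi * ‖ξ‖) * ∫ z : Space n, min 1 ‖z‖ * ‖kernel a z‖ := by
  rw [← integral_const_mul]
  exact norm_integral_le_of_norm_le ((integrable_min_mul_norm_kernel a).const_mul _)
    (Eventually.of_forall fun z => norm_sin_smul_kerTrunc_le a ε z ξ)

theorem tendsto_symbTrunc [NeZero n] (a : ℝ) (ξ : Space n) :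
    Tendsto (fun ε => symbTrunc a ε ξ) (𝓝[>] 0) (𝓝 (symb a ξ)) := by
  have hc : Continuous fun z : Space n => Real.sin (2 * Real.pi * ⟪z, ξ⟫) := by fun_prop
  refine tendsto_integral_filter_of_dominated_convergence
    (fun z => (1 + 2 * Real.pi * ‖ξ‖) * (min 1 ‖z‖ * ‖kernel a z‖))
    (Eventually.of_forall fun ε => (hc.measurable.smul
      (measurable_kerTrunc a ε)).aestronglyMeasurable)
    (Eventually.of_forall fun ε => Eventually.of_forall fun z =>
      norm_sin_smul_kerTrunc_le a ε z ξ)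
    ((integrable_min_mul_norm_kernel a).const_mul _) (Eventually.of_forall fun z => ?_)
  rcases eq_or_ne z 0 with rfl | hz
  · simp
  · refine tendsto_const_nhds.congr' ?_
    filter_upwards [nhdsWithin_le_nhds (Iio_mem_nhds (norm_pos_iff.2 hz))] with ε hε
    have hε' : ε < ‖z‖ := hε
    rw [kerTrunc, indicator_of_mem (by exact hε')]

theorem integral_cos_smul_kerTrunc (a ε : ℝ) (ξ : Space n) :
    ∫ z, Real.cos (2 * Real.pi * ⟪z, ξ⟫) • kerTrunc a ε z = 0 := by
  have h := integral_neg_eq_self (fun z => Real.cos (2 * Real.pi * ⟪z, ξ⟫) • kerTrunc a ε z)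
    (volume : Measure (Space n))
  simp only [inner_neg_left, mul_neg, Real.cos_neg, kerTrunc_neg, smul_neg, integral_neg] at h
  exact eq_zero_of_eq_neg_self h.symm

theorem wave_sub_mul_re (x z ξ : Space n) (c : ℂ) :
    (wave (x - z) ξ * c).re = (wave x ξ * c).re * Real.cos (2 * Real.pi * ⟪z, ξ⟫)
      + (wave x ξ * c).im * Real.sin (2 * Real.pi * ⟪z, ξ⟫) := by
  have h : wave (x - z) ξ = wave x ξ * Complex.exp (((-(2 * Real.pi * ⟪z, ξ⟫) : ℝ) : ℂ) *
      Complex.I) := by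
    rw [wave, wave, ← Complex.exp_add, inner_sub_right, real_inner_comm z ξ]
    congr 1; push_cast; ring
  rw [h, mul_right_comm, Complex.mul_re, Complex.exp_ofReal_mul_I_re, Complex.exp_ofReal_mul_I_im,
    Real.cos_neg, Real.sin_neg]
  ring

/-- The truncated kernel is integrable, so Fubini applies. Its oddness removes the cosine part of
the shifted character, and only imaginary parts against sines remain. -/
theorem integral_truncated [NeZero n] (hw : Integrable w) (a : ℝ) {ε : ℝ} (hε : 0 < ε)
    (x : Space n) : ∫ z, (synth w (x - z)).re • kerTrunc a ε z
      = ∫ ξ, (wave x ξ * w ξ).im • symbTrunc a ε ξ := by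
  have hG := integrable_kerTrunc (n := n) a hε
  have h1 : ∀ z, (synth w (x - z)).re • kerTrunc a ε z
      = ∫ ξ, (wave (x - z) ξ * w ξ).re • kerTrunc a ε z := by
    intro z
    have e : (synth w (x - z)).re = ∫ ξ, (wave (x - z) ξ * w ξ).re :=
      (integral_re (integrable_wave_mul hw (x - z))).symm
    rw [integral_smul_const, e]
  simp_rw [h1]
  have hc : Continuous fun p : Space n × Space n => wave (x - p.1) p.2 := by
    unfold wave; fun_prop
  have hi : Integrable (Function.uncurry fun z ξ : Space n =>
      (wave (x - z) ξ * w ξ).re • kerTrunc a ε z)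
      ((volume : Measure (Space n)).prod (volume : Measure (Space n))) := by
    have hb := hG.norm.mul_prod hw.norm
    refine Integrable.mono' hb ?_ (Eventually.of_forall fun p => ?_)
    · have m1 : AEStronglyMeasurable (fun p : Space n × Space n => w p.2)
          ((volume : Measure (Space n)).prod (volume : Measure (Space n))) := hw.1.comp_snd
      have m2 : AEStronglyMeasurable (fun p : Space n × Space n => kerTrunc a ε p.1)
          ((volume : Measure (Space n)).prod (volume : Measure (Space n))) := hG.1.comp_fst
      exact AEStronglyMeasurable.smul (Complex.continuous_re.comp_aestronglyMeasurable
        (hc.aestronglyMeasurable.mul m1)) m2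
    · simp only [Function.uncurry]
      rw [norm_smul, mul_comm]
      refine mul_le_mul_of_nonneg_left ((Complex.abs_re_le_norm _).trans (le_of_eq ?_))
        (norm_nonneg _)
      rw [norm_mul, norm_wave, one_mul]
  rw [integral_integral_swap hi]
  refine integral_congr_ae (Eventually.of_forall fun ξ => ?_)
  simp only [wave_sub_mul_re, add_smul, mul_smul]
  have hcos : Integrable fun z => Real.cos (2 * Real.pi * ⟪z, ξ⟫) • kerTrunc a ε z := by
    have hc' : Continuous fun z : Space n => Real.cos (2 * Real.pi * ⟪z, ξ⟫) := by fun_prop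
    exact hG.bdd_smul 1 hc'.aestronglyMeasurable
      (Eventually.of_forall fun z => Real.abs_cos_le_one _)
  have hsin : Integrable fun z => Real.sin (2 * Real.pi * ⟪z, ξ⟫) • kerTrunc a ε z := by
    have hc' : Continuous fun z : Space n => Real.sin (2 * Real.pi * ⟪z, ξ⟫) := by fun_prop
    exact hG.bdd_smul 1 hc'.aestronglyMeasurable
      (Eventually.of_forall fun z => Real.abs_sin_le_one _)
  refine (integral_add (hcos.smul (wave x ξ * w ξ).re) (hsin.smul (wave x ξ * w ξ).im)).trans ?_
  simp only [Pi.smul_apply]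
  rw [integral_smul, integral_smul, integral_cos_smul_kerTrunc, smul_zero, zero_add, symbTrunc]

/-- The truncated symbols grow at most linearly in ξ, uniformly in ε. The first moment of w
therefore supplies the dominating function for the principal value limit. -/
theorem isTransform_synth_re [NeZero n] (hw : Integrable w)
    (hw1 : Integrable (fun ξ => ‖ξ‖ * ‖w ξ‖)) (a : ℝ) (x : Space n) :
    IsTransform a (fun y => (synth w y).re) x (∫ ξ, (wave x ξ * w ξ).im • symb a ξ) := by
  have hpi := Real.pi_pos
  have hind : ∀ ε : ℝ, {y | ε < ‖x - y‖}.indicator (fun y => (synth w y).re • kernel a (x - y))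
      = fun y => (synth w y).re • kerTrunc a ε (x - y) := by
    intro ε
    funext y
    by_cases h : ε < ‖x - y‖
    · rw [indicator_of_mem (by exact h), kerTrunc, indicator_of_mem (by exact h)]
    · rw [indicator_of_notMem (by exact h), kerTrunc, indicator_of_notMem (by exact h), smul_zero]
  have hms : ∀ ε : ℝ, MeasurableSet {y | ε < ‖x - y‖} := fun ε =>
    measurableSet_lt measurable_const (measurable_const.sub measurable_id).norm
  constructor
  · intro ε hε
    rw [← integrable_indicator_iff (hms ε), hind]
    refine ((integrable_kerTrunc a hε).comp_sub_left x).bdd_smul (∫ ξ, ‖w ξ‖)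
      (Complex.continuous_re.comp (continuous_synth hw)).aestronglyMeasurable
      (Eventually.of_forall fun y => (Complex.abs_re_le_norm _).trans (norm_synth_le w y))
  · have hval : ∀ ε > 0, ∫ y in {y | ε < ‖x - y‖}, (synth w y).re • kernel a (x - y)
        = ∫ ξ, (wave x ξ * w ξ).im • symbTrunc a ε ξ := by
      intro ε hε
      rw [← integral_indicator (hms ε), hind, ← integral_truncated hw a hε x,
        ← integral_sub_left_eq_self (fun z => (synth w (x - z)).re • kerTrunc a ε z) volume x]
      simp only [sub_sub_cancel]
    have hA := (Complex.measurable_im.comp_aemeasurable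
      (integrable_wave_mul hw x).1.aemeasurable)
    have ht : Tendsto (fun ε => ∫ ξ, (wave x ξ * w ξ).im • symbTrunc a ε ξ) (𝓝[>] 0)
        (𝓝 (∫ ξ, (wave x ξ * w ξ).im • symb a ξ)) := by
      set M := ∫ z : Space n, min 1 ‖z‖ * ‖kernel a z‖ with hM
      refine tendsto_integral_filter_of_dominated_convergence
        (fun ξ => M * (‖w ξ‖ + 2 * Real.pi * (‖ξ‖ * ‖w ξ‖)))
        (Eventually.of_forall fun ε => hA.aestronglyMeasurable.smul
          (measurable_symbTrunc a ε).aestronglyMeasurable)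
        (Eventually.of_forall fun ε => Eventually.of_forall fun ξ => ?_)
        ((hw.norm.add (hw1.const_mul _)).const_mul M)
        (Eventually.of_forall fun ξ => (tendsto_symbTrunc a ξ).const_smul _)
      rw [norm_smul]
      calc _ ≤ ‖w ξ‖ * ((1 + 2 * Real.pi * ‖ξ‖) * M) := by
            refine mul_le_mul ?_ (norm_symbTrunc_le a ε ξ) (norm_nonneg _) (norm_nonneg _)
            refine (Complex.abs_im_le_norm _).trans (le_of_eq ?_)
            rw [norm_mul, norm_wave, one_mul]
        _ = _ := by ring
    refine ht.congr' ?_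
    filter_upwards [self_mem_nhdsWithin] with ε hε
    exact (hval ε hε).symm

end Transform

/-! ### The nonlinearity in physical space -/

section Nonlinearity

open scoped ComplexConjugate

variable {n : ℕ} {w : Space n → ℂ} {c : Space n → Space n} {C s : ℝ}

/-- For Hermitian w the real part is even in ξ, so it integrates to zero against an odd field. -/
theorem integral_wave_re_smul (hw : IsHerm w) (hc : ∀ ξ, c (-ξ) = -c ξ) (x : Space n) :
    ∫ ξ, (wave x ξ * w ξ).re • c ξ = 0 := by
  refine eq_zero_of_eq_neg_self ?_
  rw [← integral_neg]
  nth_rewrite 1 [← integral_neg_eq_self]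
  refine integral_congr_ae ?_
  filter_upwards [hw] with ξ h
  rw [h, wave_neg, ← map_mul, Complex.conj_re, hc, smul_neg]

/-- The substitution ξ = ζ + η splits the character, and the double integral factors into inner
products of vector integrals. By symmetry those containing a real part vanish. -/
theorem tri_qsym_wave (hc : IsVel c C) (hw : Integrable w)
    (hw1 : Integrable (fun ξ => ‖ξ‖ * ‖w ξ‖)) (hwh : IsHerm w) (x : Space n) :
    tri (qsym c) w w (fun ξ => conj (wave x ξ))
      = ((-⟪∫ ξ, (wave x ξ * w ξ).im • c ξ, ∫ ξ, (wave x ξ * w ξ).im • ξ⟫ : ℝ) : ℂ) := by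
  have hA := integrable_wave_mul hw x
  have hAn : ∀ ξ, ‖wave x ξ * w ξ‖ = ‖w ξ‖ := fun ξ => by rw [norm_mul, norm_wave, one_mul]
  have hre := (Complex.measurable_re.comp_aemeasurable hA.1.aemeasurable).aestronglyMeasurable
  have him := (Complex.measurable_im.comp_aemeasurable hA.1.aemeasurable).aestronglyMeasurable
  have h1 : ∀ {f : Space n → ℝ}, AEStronglyMeasurable f volume → (∀ ξ, |f ξ| ≤ ‖w ξ‖) →
      Integrable (fun ξ => f ξ • c ξ) ∧ Integrable (fun ξ => f ξ • ξ) := by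
    intro f hf hfw
    refine ⟨Integrable.mono' (hw.norm.mul_const C)
      (hf.smul hc.measurable.aestronglyMeasurable) (Eventually.of_forall fun ξ => ?_),
      Integrable.mono' hw1 (hf.smul aestronglyMeasurable_id) (Eventually.of_forall fun ξ => ?_)⟩
    · rw [norm_smul]
      exact mul_le_mul (hfw ξ) (hc.le ξ) (norm_nonneg _) (norm_nonneg _)
    · rw [norm_smul, mul_comm]
      exact mul_le_mul_of_nonneg_left (hfw ξ) (norm_nonneg _)
  obtain ⟨rc, rx⟩ := h1 hre fun ξ => (Complex.abs_re_le_norm _).trans (hAn ξ).le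
  obtain ⟨ic, ix⟩ := h1 him fun ξ => (Complex.abs_im_le_norm _).trans (hAn ξ).le
  simp only [Function.comp_def] at rc rx ic ix
  have hprod : ∀ {f g : Space n → Space n}, Integrable f → Integrable g →
      Integrable (fun q : Space n × Space n => ⟪f q.1, g q.2⟫) ∧
      ∫ q : Space n × Space n, ⟪f q.1, g q.2⟫ = ⟪∫ ξ, f ξ, ∫ ξ, g ξ⟫ := by
    intro f g hf hg
    refine ⟨Integrable.op_fst_snd (op := fun a b : Space n => ⟪a, b⟫) ?_ ⟨1, fun a b => ?_⟩ hf hg,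
      integral_prod_bilin (innerSL ℝ) hf hg⟩
    · exact continuous_inner
    · rw [one_mul]; exact norm_inner_le_norm a b
  obtain ⟨i1, e1⟩ := hprod rc rx
  obtain ⟨i2, e2⟩ := hprod ic ix
  obtain ⟨i3, e3⟩ := hprod rc ix
  obtain ⟨i4, e4⟩ := hprod ic rx
  have r0 := integral_wave_re_smul hwh hc.odd x
  have r1 := integral_wave_re_smul (c := fun ξ => ξ) hwh (fun ξ => rfl) x
  have hk : AEStronglyMeasurable (fun ξ => conj (wave x ξ)) volume :=
    (Complex.continuous_conj.comp (continuous_wave x)).aestronglyMeasurable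
  have hm := aestronglyMeasurable_triIntegrand hc.measurable_qsym hw.1 hw.1 hk
  rw [tri, ← measurePreserving_add_snd.map_eq, integral_map
    measurePreserving_add_snd.measurable.aemeasurable
    (by rw [measurePreserving_add_snd.map_eq]; exact hm)]
  have key : ∀ q : Space n × Space n, ((qsym c (q.1 + q.2) q.2 : ℝ) : ℂ) *
      (w (q.1 + q.2 - q.2) * w q.2 * conj (conj (wave x (q.1 + q.2))))
      = ((⟪(wave x q.1 * w q.1).re • c q.1, (wave x q.2 * w q.2).re • q.2⟫
        - ⟪(wave x q.1 * w q.1).im • c q.1, (wave x q.2 * w q.2).im • q.2⟫ : ℝ) : ℂ)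
        + ((⟪(wave x q.1 * w q.1).re • c q.1, (wave x q.2 * w q.2).im • q.2⟫
        + ⟪(wave x q.1 * w q.1).im • c q.1, (wave x q.2 * w q.2).re • q.2⟫ : ℝ) : ℂ)
          * Complex.I := by
    intro q
    rw [Complex.conj_conj, wave_add, qsym, add_sub_cancel_right]
    have h2 : w q.1 * w q.2 * (wave x q.1 * wave x q.2)
        = (wave x q.1 * w q.1) * (wave x q.2 * w q.2) := by ring
    rw [h2]
    generalize wave x q.1 * w q.1 = A
    generalize wave x q.2 * w q.2 = B
    simp only [real_inner_smul_left, real_inner_smul_right]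
    apply Complex.ext <;> simp <;> ring
  simp only [key]
  rw [integral_add (i1.sub i2).ofReal ((i3.add i4).ofReal.mul_const _), integral_mul_const]
  have a1 : ∫ q : Space n × Space n,
      ((⟪(wave x q.1 * w q.1).re • c q.1, (wave x q.2 * w q.2).re • q.2⟫
        - ⟪(wave x q.1 * w q.1).im • c q.1, (wave x q.2 * w q.2).im • q.2⟫ : ℝ) : ℂ)
      = ((-⟪∫ ξ, (wave x ξ * w ξ).im • c ξ, ∫ ξ, (wave x ξ * w ξ).im • ξ⟫ : ℝ) : ℂ) := by
    rw [integral_complex_ofReal, integral_sub i1 i2, e1, e2, r0, inner_zero_left, zero_sub]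
  have a2 : ∫ q : Space n × Space n,
      ((⟪(wave x q.1 * w q.1).re • c q.1, (wave x q.2 * w q.2).im • q.2⟫
        + ⟪(wave x q.1 * w q.1).im • c q.1, (wave x q.2 * w q.2).re • q.2⟫ : ℝ) : ℂ) = 0 := by
    rw [integral_complex_ofReal, integral_add i3 i4, e3, e4, r0, r1, inner_zero_left, inner_zero_right, add_zero]
    simp
  rw [a1, a2, zero_mul, add_zero]

theorem memLp_evKer {σ : ℝ} (hσ : (n : ℝ) / 2 < σ) (x : Space n) :
    MemLp (fun ξ => ((br ξ ^ (-σ) : ℝ) : ℂ) * conj (wave x ξ)) 2 volume := by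
  refine MemLp.of_le (memLp_br_rpow hσ)
    ((Complex.measurable_ofReal.comp (measurable_br_rpow _)).aestronglyMeasurable.mul
    (Complex.continuous_conj.comp (continuous_wave x)).aestronglyMeasurable)
    (Eventually.of_forall fun ξ => le_of_eq ?_)
  rw [norm_mul, RCLike.norm_conj, norm_wave, mul_one, Complex.norm_real]

/-- The function representing evaluation at `x` of the inverse Fourier integral. -/
def evKer {σ : ℝ} (hσ : (n : ℝ) / 2 < σ) (x : Space n) : L2C n := (memLp_evKer hσ x).toLp

theorem coeFn_evKer {σ : ℝ} (hσ : (n : ℝ) / 2 < σ) (x : Space n) :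
    evKer hσ x =ᵐ[volume] fun ξ => ((br ξ ^ (-σ) : ℝ) : ℂ) * conj (wave x ξ) :=
  (memLp_evKer hσ x).coeFn_toLp

theorem inner_evKer {σ : ℝ} (hσ : (n : ℝ) / 2 < σ) (hσ0 : 0 ≤ σ) (x : Space n) (U : L2C n) :
    inner ℂ (evKer hσ x) U = synth (lower n σ hσ0 U) x := by
  rw [L2.inner_def, synth]
  refine integral_congr_ae ?_
  filter_upwards [coeFn_evKer hσ x, coeFn_lower hσ0 U] with ξ h1 h2
  rw [h1, h2]
  simp only [RCLike.inner_apply, map_mul, Complex.conj_ofReal, Complex.conj_conj]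
  ring

/-- The pairings are point evaluations of the inverse Fourier integral of `lower n σ hσ0 U`, so
Fourier uniqueness applies. -/
theorem eq_zero_of_inner_evKer {σ : ℝ} (hσ : (n : ℝ) / 2 < σ) {U : L2C n}
    (h : ∀ x, inner ℂ (evKer hσ x) U = 0) : U = 0 := by
  have hσ0 : 0 ≤ σ := le_trans (by positivity) hσ.le
  refine lower_injective hσ0 ?_
  rw [map_zero]
  refine eq_zero_of_synth_eq_zero (integrable_lower hσ U) fun x => ?_
  rw [← inner_evKer hσ hσ0, h x]

variable {N : L2C n →L[ℝ] L2C n →L[ℝ] L2C n}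

theorem integrable_norm_mul_lower (hs : (n : ℝ) / 2 + 1 < s) (hs0 : 0 ≤ s) (V : L2C n) :
    Integrable (fun ξ => ‖ξ‖ * ‖lower n s hs0 V ξ‖) := by
  have h := (memLp_one_iff_integrable.1 (memLp_br_mul hs (Lp.memLp V)).1).norm
  refine h.mono' (measurable_norm.aestronglyMeasurable.mul (Lp.memLp _).1.norm) ?_
  filter_upwards [coeFn_lower hs0 V] with ξ e
  rw [e, norm_mul _ (_ * _), Complex.norm_real, Real.norm_of_nonneg (br_pos ξ).le, norm_mul,
    norm_norm, norm_norm]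
  exact mul_le_mul_of_nonneg_right (norm_le_br ξ) (norm_nonneg _)

theorem inner_evKer_bilinear (hc : IsVel c C) (hs : (n : ℝ) / 2 + 1 < s) (hs0 : 0 ≤ s)
    (hσ : (n : ℝ) / 2 < s - 1)
    (hN : ∀ V W k : L2C n, inner ℂ k (N V W) = tri (baseSym c s) V W k) {V : L2C n}
    (hV : conjRefl V = V) (x : Space n) :
    inner ℂ (evKer hσ x) (N V V) = ((-⟪∫ ξ, (wave x ξ * lower n s hs0 V ξ).im • c ξ,
      ∫ ξ, (wave x ξ * lower n s hs0 V ξ).im • ξ⟫ : ℝ) : ℂ) := by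
  have hJ : conjRefl (lower n s hs0 V) = lower n s hs0 V := by rw [conjRefl_lower, hV]
  rw [← tri_qsym_wave hc (integrable_lower (by linarith) V) (integrable_norm_mul_lower hs hs0 V)
    ((conjRefl_eq_iff _).1 hJ), hN,
    tri_congr (coeFn_lower hs0 V) (coeFn_lower hs0 V) (EventuallyEq.refl _ _),
    tri_congr (EventuallyEq.refl _ _) (EventuallyEq.refl _ _) (coeFn_evKer hσ x),
    tri, tri]
  congr 1
  funext p
  have h : br p.1 ^ (-(s - 1)) * br p.1 ^ (s - 1) = 1 := by rw [br_rpow_mul]; simp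
  have h' : br p.1 ^ (-(s - 1)) * baseSym c s p.1 p.2 =
      qsym c p.1 p.2 * (br (p.1 - p.2) ^ (-s) * br p.2 ^ (-s)) := by
    rw [baseSym, ← mul_assoc, h, one_mul]
  have h2 := congrArg (fun r : ℝ => (r : ℂ)) h'
  simp only [Complex.ofReal_mul] at h2
  simp only [map_mul, Complex.conj_ofReal, Complex.conj_conj]
  linear_combination (V (p.1 - p.2) * V p.2 * wave x p.1) * h2

end Nonlinearity

/-! ### Solutions in physical space and on the Fourier side -/

section Solutions

variable {n : ℕ} {a g s T : ℝ} {N : L2C n →L[ℝ] L2C n →L[ℝ] L2C n}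

theorem hasDerivAt_integral_of_continuousOn_Ioo {E : Type*} [NormedAddCommGroup E]
    [NormedSpace ℝ E] [CompleteSpace E] {F : ℝ → E} {α β t₀ t : ℝ} (hF : ContinuousOn F (Ioo α β))
    (hi : IntervalIntegrable F volume t₀ t) (ht : t ∈ Ioo α β) :
    HasDerivAt (fun τ => ∫ u in t₀..τ, F u) (F t) t :=
  intervalIntegral.integral_hasDerivAt_right hi
    (hF.stronglyMeasurableAtFilter isOpen_Ioo t ht) (hF.continuousAt (isOpen_Ioo.mem_nhds ht))

theorem inner_evKer_lower (hs0 : 0 ≤ s) (hσ : (n : ℝ) / 2 < s - 1) (V : L2C n) (x : Space n) :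
    inner ℂ (evKer hσ x) (lower n 1 zero_le_one V) = synth (lower n s hs0 V) x := by
  have hs1 : 0 ≤ s - 1 := le_trans (by positivity) hσ.le
  rw [inner_evKer hσ hs1, lower_lower hs1 zero_le_one (by linarith)]
  simp only [sub_add_cancel]

/-- The velocity symbol of the equation. -/
def velocity (n : ℕ) (a g : ℝ) (ζ : Space n) : Space n := (2 * Real.pi * g) • symb a ζ

theorem isVel_velocity [NeZero n] (a : ℝ) (hg : 0 ≤ g) :
    IsVel (velocity n a g) (2 * Real.pi * g * symbConst n) :=
  isVel_symb a (mul_nonneg (by positivity) hg)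

/-- The factor 2π in `velocity` comes from the gradient, and the minus sign of the gradient formula
cancels that of the product formula. -/
theorem inner_evKer_bilinear_eq [NeZero n] (hg : 0 ≤ g) (hs : (n : ℝ) / 2 + 1 < s)
    (hs0 : 0 ≤ s) (hσ : (n : ℝ) / 2 < s - 1)
    (hN : ∀ V W k : L2C n, inner ℂ k (N V W) = tri (baseSym (velocity n a g) s) V W k)
    {V : L2C n} (hV : conjRefl V = V) (x : Space n) :
    inner ℂ (evKer hσ x) (N V V)
      = ((g * ⟪∫ ξ, (wave x ξ * lower n s hs0 V ξ).im • symb a ξ,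
        gradient (fun y => (synth (lower n s hs0 V) y).re) x⟫ : ℝ) : ℂ) := by
  rw [inner_evKer_bilinear (isVel_velocity a hg) hs hs0 hσ hN hV,
    (hasGradientAt_synth_re (integrable_lower (by linarith) V)
      (integrable_norm_mul_lower hs hs0 V) x).gradient]
  congr 1
  simp only [velocity, smul_comm _ (2 * Real.pi * g)]
  rw [integral_smul, real_inner_smul_left, real_inner_smul_right]
  ring

theorem synth_lower_re (hs0 : 0 ≤ s) {V : L2C n} (hV : conjRefl V = V) (x : Space n) :
    ((synth (lower n s hs0 V) x).re : ℂ) = synth (lower n s hs0 V) x :=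
  synth_real (by rw [conjRefl_lower, hV]) x

theorem toL2_ae_eq_synth (hs : (n : ℝ) / 2 < s) (hs0 : 0 ≤ s) (f : Hs n s) :
    (Hs.toL2 f : Space n → ℝ) =ᵐ[volume] fun x => (synth (lower n s hs0 (lift hs0 f)) x).re := by
  have h := lower_lift hs0 f
  rw [h]
  refine ae_eq_synth_re ?_
  rw [← h]
  exact integrable_lower hs _

/-- A classical solution solves the equation on the Fourier side. -/
theorem IsSolution.hasDerivAt_lift [NeZero n] (hg : 0 ≤ g) (hs : (n : ℝ) / 2 + 1 < s)
    (hs0 : 0 ≤ s)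
    (hN : ∀ V W k : L2C n, inner ℂ k (N V W) = tri (baseSym (velocity n a g) s) V W k)
    {ρ₀ : Hs n s} {ρ : ℝ → Hs n s} (h : IsSolution a g T ρ₀ ρ) {t : ℝ} (ht : t ∈ Ioo 0 T) :
    HasDerivAt (fun τ => lower n 1 zero_le_one (lift hs0 (ρ τ)))
      (-(N (lift hs0 (ρ t)) (lift hs0 (ρ t)))) t := by
  have hσ : (n : ℝ) / 2 < s - 1 := by linarith
  have hsn : (n : ℝ) / 2 < s := by linarith
  obtain ⟨r, u, hr, hu, hd⟩ := h.equation
  set V : ℝ → L2C n := fun τ => lift hs0 (ρ τ) with hVdef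
  have hVc : ContinuousOn V (Ico 0 T) := continuousOn_lift h.continuousOn
  have hVh : ∀ τ, conjRefl (V τ) = V τ := fun τ => conjRefl_lift hsn _
  have hVi : ∀ τ, Integrable (lower n s hs0 (V τ)) := fun τ => integrable_lower hsn _
  have hVi1 : ∀ τ, Integrable (fun ξ => ‖ξ‖ * ‖lower n s hs0 (V τ) ξ‖) :=
    fun τ => integrable_norm_mul_lower hs hs0 _
  -- Both representatives are continuous, so agreement almost everywhere is agreement everywhere.
  have hrV : ∀ τ ∈ Ico 0 T, r τ = fun x => (synth (lower n s hs0 (V τ)) x).re := by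
    intro τ hτ
    refine (Continuous.ae_eq_iff_eq volume (hr τ hτ).1.continuous
      (Complex.continuous_re.comp (continuous_synth (hVi τ)))).1 ?_
    exact (hr τ hτ).2.symm.trans (toL2_ae_eq_synth hsn hs0 (ρ τ))
  set F : ℝ → L2C n := fun τ => N (V τ) (V τ) with hF
  have hFc : ContinuousOn F (Ioo 0 T) :=
    (((N.continuous.comp_continuousOn hVc).clm_apply hVc)).mono Ioo_subset_Ico_self
  have hFi : ∀ τ ∈ Ioo 0 T, IntervalIntegrable F volume t τ := fun τ hτ =>
    (hFc.mono (ordConnected_Ioo.uIcc_subset ht hτ)).intervalIntegrable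
  -- The equation on the Fourier side amounts to constancy of W. Each point evaluation of W has zero
  -- derivative, and evaluations separate; this upgrades pointwise derivatives to an L² derivative.
  set W : ℝ → L2C n := fun τ => lower n 1 zero_le_one (V τ) + ∫ v in t..τ, F v with hW
  have hpt : ∀ x, ∀ τ ∈ Ioo 0 T,
      HasDerivAt (fun τ => (inner ℂ (evKer hσ x) (W τ) : ℂ)) 0 τ := by
    intro x τ hτ
    have hτ' := Ioo_subset_Ico_self hτ
    have hux : u τ x = ∫ ξ, (wave x ξ * lower n s hs0 (V τ) ξ).im • symb a ξ := by
      have h1 := (hu τ hτ x).2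
      rw [hrV τ hτ'] at h1
      exact tendsto_nhds_unique h1 (isTransform_synth_re (hVi τ) (hVi1 τ) a x).2
    have h1 := (hd τ hτ x).ofReal_comp
    have h2 : HasDerivAt (fun τ => (inner ℂ (evKer hσ x) (lower n 1 zero_le_one (V τ)) : ℂ))
        (-(inner ℂ (evKer hσ x) (F τ) : ℂ)) τ := by
      rw [hF, inner_evKer_bilinear_eq hg hs hs0 hσ hN (hVh τ), ← hux, ← hrV τ hτ',
        ← Complex.ofReal_neg]
      refine h1.congr_of_eventuallyEq ?_
      filter_upwards [isOpen_Ioo.mem_nhds hτ] with v hv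
      rw [inner_evKer_lower hs0, hrV v (Ioo_subset_Ico_self hv), synth_lower_re hs0 (hVh v)]
    have h3 := (((innerSL ℂ (evKer hσ x)).restrictScalars ℝ).hasFDerivAt).comp_hasDerivAt τ
      (hasDerivAt_integral_of_continuousOn_Ioo hFc (hFi τ hτ) hτ)
    have h4 := h2.add h3
    have e : (fun τ => (inner ℂ (evKer hσ x) (W τ) : ℂ)) =
        (fun τ => (inner ℂ (evKer hσ x) (lower n 1 zero_le_one (V τ)) : ℂ)) +
        ⇑((innerSL ℂ (evKer hσ x)).restrictScalars ℝ) ∘ fun τ => ∫ v in t..τ, F v := by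
      funext v
      simp only [hW, inner_add_right, Pi.add_apply, Function.comp_apply]
      rfl
    have e' : (0 : ℂ) = -(inner ℂ (evKer hσ x) (F τ) : ℂ) +
        (innerSL ℂ (evKer hσ x)).restrictScalars ℝ (F τ) :=
      (neg_add_cancel (inner ℂ (evKer hσ x) (F τ) : ℂ)).symm
    rw [e, e']
    exact h4
  have hWc : ∀ τ ∈ Ioo 0 T, W τ = W t := by
    intro τ hτ
    rw [← sub_eq_zero]
    refine eq_zero_of_inner_evKer hσ fun x => ?_
    rw [inner_sub_right, sub_eq_zero]
    exact isOpen_Ioo.is_const_of_deriv_eq_zero isPreconnected_Ioo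
      (fun v hv => (hpt x v hv).differentiableAt.differentiableWithinAt)
      (fun v hv => (hpt x v hv).deriv) hτ ht
  have h5 := (hasDerivAt_integral_of_continuousOn_Ioo hFc (hFi t ht) ht).const_sub (W t)
  refine h5.congr_of_eventuallyEq ?_
  filter_upwards [isOpen_Ioo.mem_nhds ht] with τ hτ
  rw [← hWc τ hτ]
  simp only [hW, add_sub_cancel_right, hVdef]

theorem IsSolution.eqOn [NeZero n] (hg : 0 ≤ g) (hs : (n : ℝ) / 2 + 1 < s) {ρ₀ : Hs n s}
    {ρ₁ ρ₂ : ℝ → Hs n s} (h₁ : IsSolution a g T ρ₀ ρ₁) (h₂ : IsSolution a g T ρ₀ ρ₂) :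
    EqOn ρ₁ ρ₂ (Ico 0 T) := by
  have hn : (0 : ℝ) ≤ n := by positivity
  have hs0 : 0 ≤ s := by linarith
  obtain ⟨N, hN⟩ := ((isVel_velocity (n := n) a hg).isSymbol_baseSym hs).exists_bilinear
  have h := (isVel_velocity a hg).eqOn_of_solutions hs hN
    (continuousOn_lift (hσ := hs0) h₁.continuousOn) (continuousOn_lift h₂.continuousOn)
    (fun t _ => conjRefl_lift (by linarith) _)
    (fun t ht => h₁.hasDerivAt_lift hg hs hs0 hN ht)
    (fun t ht => h₂.hasDerivAt_lift hg hs hs0 hN ht) (by rw [h₁.initial, h₂.initial])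
  exact fun t ht => lift_injective hs0 (h ht)

theorem symbConst_nonneg (n : ℕ) [NeZero n] : 0 ≤ symbConst n :=
  (norm_nonneg _).trans (norm_symb_le 0 (0 : Space n))

theorem exists_isSolution [NeZero n] (hg : 0 ≤ g) (hs : (n : ℝ) / 2 + 1 < s) (ρ₀ : Hs n s)
    (hT : 0 ≤ T) (hRT : 4 * energyConst n (2 * Real.pi * g * symbConst n) s *
      (2 ^ s * ‖ρ₀‖ + 1) * T ≤ 1) :
    ∃ ρ : ℝ → Hs n s, IsSolution a g T ρ₀ ρ := by
  have hn : (0 : ℝ) ≤ n := by positivity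
  have hs0 : 0 ≤ s := by linarith
  have hs1 : 0 ≤ s - 1 := by linarith
  have hσ : (n : ℝ) / 2 < s - 1 := by linarith
  have hsn : (n : ℝ) / 2 < s := by linarith
  have hc := isVel_velocity (n := n) a hg
  obtain ⟨N, hN⟩ := (hc.isSymbol_baseSym hs).exists_bilinear
  obtain ⟨V, hVc, hV0, hVh, hVeq⟩ := hc.exists_solution hs hN
    -- The 2^s compares the two norms of H^s; the 1 keeps R positive for the zero datum.
    (R := 2 ^ s * ‖ρ₀‖ + 1) (by positivity) hT hRT (conjRefl_lift (hσ := hs0) hsn ρ₀)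
    ((norm_lift_le hs0 ρ₀).trans (by linarith))
  have hex : ∀ t, ∃ f : Hs n s, t ∈ Icc 0 T → lift hs0 f = V t := by
    intro t
    by_cases ht : t ∈ Icc 0 T
    · obtain ⟨f, hf⟩ := exists_lift_eq hs0 hsn (hVh t ht)
      exact ⟨f, fun _ => hf⟩
    · exact ⟨0, fun h => absurd h ht⟩
  choose ρ hρ using hex
  -- The same curve viewed in H^(s-1): its weighted transform carries one power of 1+|ξ| less.
  have hex' : ∀ t, ∃ f : Hs n (s - 1), t ∈ Icc 0 T →
      lift hs1 f = lower n 1 zero_le_one (V t) := by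
    intro t
    by_cases ht : t ∈ Icc 0 T
    · obtain ⟨f, hf⟩ := exists_lift_eq hs1 hσ (V := lower n 1 zero_le_one (V t))
        (by rw [conjRefl_lower, hVh t ht])
      exact ⟨f, fun _ => hf⟩
    · exact ⟨0, fun h => absurd h ht⟩
  choose q hq using hex'
  set F : ℝ → L2C n := fun τ => N (V τ) (V τ) with hF
  have hFc : ContinuousOn F (Icc 0 T) := (N.continuous.comp_continuousOn hVc).clm_apply hVc
  have hFi : ∀ t ∈ Icc 0 T, ∀ τ ∈ Icc 0 T, IntervalIntegrable F volume t τ := fun t ht τ hτ =>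
    (hFc.mono (ordConnected_Icc.uIcc_subset ht hτ)).intervalIntegrable
  have hVd : ∀ t ∈ Ioo 0 T,
      HasDerivAt (fun τ => lower n 1 zero_le_one (V τ)) (-(N (V t) (V t))) t := by
    intro t ht
    have h0 : (0 : ℝ) ∈ Icc 0 T := ⟨le_rfl, hT⟩
    refine ((hasDerivAt_integral_of_continuousOn_Ioo (hFc.mono Ioo_subset_Icc_self)
      (hFi 0 h0 t (Ioo_subset_Icc_self ht)) ht).const_sub
        (lower n 1 zero_le_one (lift hs0 ρ₀))).congr_of_eventuallyEq ?_
    filter_upwards [isOpen_Ioo.mem_nhds ht] with τ hτ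
    exact hVeq τ (Ioo_subset_Icc_self hτ)
  refine ⟨ρ, ⟨?_, ?_, ?_, ?_⟩⟩
  · refine continuousOn_of_lift hs0 ((hVc.mono Ico_subset_Icc_self).congr fun t ht => ?_)
    exact hρ t (Ico_subset_Icc_self ht)
  · refine ⟨q, fun t ht => fhat_injective ?_, ?_⟩
    · have ht' := Ioo_subset_Icc_self ht
      rw [← lower_lift hs1, ← lower_lift hs0, hq t ht', hρ t ht',
        lower_lower hs1 zero_le_one (by linarith)]
      simp only [sub_add_cancel]
    -- In the integral equation the speed in H^(s-1) is the L² norm of the nonlinearity, bounded on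
    -- the closed interval by compactness.
    · obtain ⟨M, hM⟩ := isCompact_Icc.exists_bound_of_continuousOn hFc
      have hM0 : 0 ≤ M := (norm_nonneg _).trans (hM 0 ⟨le_rfl, hT⟩)
      have hpi := Real.pi_pos
      refine ⟨Real.toNNReal ((1 + (2 * Real.pi) ^ (s - 1)) * M),
        LipschitzOnWith.of_dist_le_mul fun t ht τ hτ => ?_⟩
      have ht' := Ioo_subset_Icc_self ht
      have hτ' := Ioo_subset_Icc_self hτ
      have h0 : (0 : ℝ) ∈ Icc 0 T := ⟨le_rfl, hT⟩
      rw [Real.coe_toNNReal _ (by positivity), mul_assoc]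
      refine (dist_le_dist_lift hs1 _ _).trans (mul_le_mul_of_nonneg_left ?_ (by positivity))
      rw [hq t ht', hq τ hτ', hVeq t ht', hVeq τ hτ', dist_sub_left, dist_comm, dist_eq_norm,
        intervalIntegral.integral_interval_sub_left (hFi 0 h0 τ hτ') (hFi 0 h0 t ht'),
        Real.dist_eq, abs_sub_comm]
      exact intervalIntegral.norm_integral_le_of_norm_le_const fun v hv =>
        hM v (ordConnected_Icc.uIcc_subset ht' hτ' (uIoc_subset_uIcc hv))
  · refine ⟨fun t x => (synth (lower n s hs0 (V t)) x).re,
      fun t x => ∫ ξ, (wave x ξ * lower n s hs0 (V t) ξ).im • symb a ξ, ?_, ?_, ?_⟩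
    · intro t ht
      refine ⟨Complex.reCLM.contDiff.comp (contDiff_synth (integrable_lower hsn _)
        (integrable_norm_mul_lower hs hs0 _)), ?_⟩
      simp only [← hρ t (Ico_subset_Icc_self ht)]
      exact toL2_ae_eq_synth hsn hs0 (ρ t)
    · intro t _ x
      exact isTransform_synth_re (integrable_lower hsn _) (integrable_norm_mul_lower hs hs0 _) a x
    · intro t ht x
      -- Pairing with the evaluation functional converts the L² derivative into a time derivative at
      -- the point x.
      have h1 := (((innerSL ℂ (evKer hσ x)).restrictScalars ℝ).hasFDerivAt).comp_hasDerivAt t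
        (hVd t ht)
      have h2 := Complex.reCLM.hasFDerivAt.comp_hasDerivAt t h1
      have e1 : (⇑Complex.reCLM ∘ ⇑((innerSL ℂ (evKer hσ x)).restrictScalars ℝ) ∘
          fun τ => lower n 1 zero_le_one (V τ))
          = fun τ => (synth (lower n s hs0 (V τ)) x).re := by
        funext τ
        rw [← inner_evKer_lower hs0 hσ]
        rfl
      rw [e1] at h2
      have e2 := inner_evKer_bilinear_eq hg hs hs0 hσ hN (hVh t (Ioo_subset_Icc_self ht)) x
      refine h2.congr_deriv ?_
      rw [map_neg, map_neg]
      exact congrArg (fun z : ℂ => -z.re) e2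
  · have h0 : (0 : ℝ) ∈ Icc 0 T := ⟨le_rfl, hT⟩
    exact lift_injective hs0 (by rw [hρ 0 h0, hV0])

end Solutions

end KiselevSarsam

end

theorem theorem1p1 (n : ℕ) (hn : 2 ≤ n) (a g s : ℝ) (ha : 0 < a) (hg : 0 < g)
    (hs : (n : ℝ) / 2 + 1 < s) :
    ∃ T : ℝ → ℝ, (∀ R, 0 < T R) ∧
      ∀ ρ₀ : KiselevSarsam.Hs n s,
        (∃ ρ : ℝ → KiselevSarsam.Hs n s, KiselevSarsam.IsSolution a g (T ‖ρ₀‖) ρ₀ ρ) ∧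
        ∀ ρ₁ ρ₂ : ℝ → KiselevSarsam.Hs n s,
          KiselevSarsam.IsSolution a g (T ‖ρ₀‖) ρ₀ ρ₁ →
          KiselevSarsam.IsSolution a g (T ‖ρ₀‖) ρ₀ ρ₂ →
          Set.EqOn ρ₁ ρ₂ (Set.Ico 0 (T ‖ρ₀‖)) := by
  have : NeZero n := ⟨by omega⟩
  set E := KiselevSarsam.energyConst n (2 * Real.pi * g * KiselevSarsam.symbConst n) s with hE
  have hE0 : 0 ≤ E := KiselevSarsam.energyConst_nonneg hs
    (mul_nonneg (mul_nonneg (by positivity) hg.le) (KiselevSarsam.symbConst_nonneg n))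
  -- The denominator is the condition of `exists_isSolution` with E + 1 for E and |R| for R, which
  -- keeps the time positive even if E = 0 or R < 0.
  have hpos : ∀ R : ℝ, 0 < 1 / (4 * (E + 1) * (2 ^ s * |R| + 1)) := fun R => by positivity
  refine ⟨fun R => 1 / (4 * (E + 1) * (2 ^ s * |R| + 1)), hpos, fun ρ₀ =>
    ⟨KiselevSarsam.exists_isSolution hg.le hs ρ₀ (hpos _).le ?_,
      fun ρ₁ ρ₂ h₁ h₂ => h₁.eqOn hg.le hs h₂⟩⟩
  beta_reduce
  rw [← hE, abs_of_nonneg (norm_nonneg _), mul_one_div, div_le_one (by positivity)]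
  have : 0 ≤ 2 ^ s * ‖ρ₀‖ + 1 := by positivity
  nlinarith
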